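/- Throughout, $\mathbb T=\{z\in\mathbb C:|z|=1\}$ and $\omega=e^{2\pi i/3}$. A complex Hadamard matrix of order $N$ is an $N\times N$ matrix $H$ with entries in $\mathbb T$ and $H^\dagger H=NI$. Write $H\sim K$ if $H=P_1D_1KD_2P_2$ with permutation matrices $P_i$ and diagonal unitary matrices $D_i$. The dephased form of $H$ is the matrix $H_{ij}H_{11}\overline{H_{i1}}\,\overline{H_{1j}}$, whose first row and column consist of ones. The defect of $H$ is $d(H)=r-(2N-1)$, where $r$ is the dimension of the real vector space of real $N\times N$ matrices $R$ with $\frac{d}{dt}\big|_{t=0}H(t)^\dagger H(t)=0$ for $H(t)_{ij}=H_{ij}e^{itR_{ij}}$. A $p$-parameter orbit is a non-empty set $\mathcal O$ of complex Hadamard matrices which is a countable union of sets $\Phi(D)$, where $D\subseteq\mathbb R^p$, $\Phi:D\to\mathcal O$ is continuous, and there is an open set $U$ of $\mathbb R^p$ with $U\subseteq D\subseteq\overline U$ on which $\Phi$ is $C^1$ and the dephased form of $\Phi$ is an immersion. It is affine if, in addition, the set of dephased forms of its elements is $\{(H^0_{ij}e^{iR(t)_{ij}})_{ij}:t\in D\}$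 for a fixed matrix $H^0$, an injective linear map $R$ from $\mathbb R^p$ to the real $N\times N$ matrices, and a non-empty $D\subseteq\mathbb R^p$ contained in the closure of its interior. $\mathcal O$ is contained in (is a suborbit of) $\mathcal O'$ if every element of $\mathcal O$ is equivalent to an element of $\mathcal O'$; the two are equivalent if each is contained in the other. $\mathcal O$ has generic defect $d$ if $d$ is the smallest defect of an element of $\mathcal O$ and the elements of defect $d$ form a relatively open, dense subset of $\mathcal O$. For $x,y,u,w\in\mathbb T$ let $$H(x,y,u,w)=\begin{pmatrix}A&B&B^T\\B^T&A&B\\B&B^T&A\end{pmatrix},\quad A=\begin{pmatrix}1&x&x\\x&1&x\\x&x&1\end{pmatrix},\quad B=\begin{pmatrix}y&u&w\\w&y&u\\u&w&y\end{pmatrix},$$ and let $BC_9^{(2)}=\{H(x,y,u,w):x,y,u,w\in\mathbb T,\ x+y+u+w=1\}$. Let $F_9^{(4)}$ be the set of the matrices $$\begin{pmatrix}F_3&\Delta_1F_3&\Delta_2F_3\\F_3&\omega\Delta_1F_3&\omega^2\Delta_2F_3\\F_3&\omega^2\Delta_1F_3&\omega\Delta_2F_3\end{pmatrix},\quad F_3=\begin{pmatrix}1&1&1\\1&\omega&\omega^2\\1&\omega^2&\omega\end{pmatrix},$$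 with $\Delta_1=\mathrm{diag}(1,x_1,x_2)$, $\Delta_2=\mathrm{diag}(1,x_3,x_4)$ and $x_1,\dots,x_4\in\mathbb T$. Up to equivalence, $B_9^{(0)}$ is the matrix $H(x,y,u,w)$ with $(x,y,u,w)$ any permutation of $(\epsilon,\epsilon^3,\epsilon^7,\epsilon^9)$, $\epsilon=e^{2\pi i/10}$, and $W_{9A}$ is the one with $(x,y,u,w)$ any permutation of $(\tau,\tau,\bar\tau,\bar\tau)$, $\tau=\frac14(1+i\sqrt{15})$. **Theorem.** 1. $BC_9^{(2)}$ is a two-parameter orbit, and it is non-affine: no orbit equivalent to it is an affine two-parameter orbit. 2. The generic defect of $BC_9^{(2)}$ is $2$. The above representatives of $B_9^{(0)}$ and $W_{9A}$ lie in $BC_9^{(2)}$, and every matrix equivalent to one of them has defect $2$. 3. For every $p>2$, $BC_9^{(2)}$ is not contained in any $p$-parameter orbit. 4. $F_9^{(4)}$ is a four-parameter orbit with generic defect $4$; in particular all its elements have defect at least $4$. $BC_9^{(2)}$ is not a suborbit of $F_9^{(4)}$. -/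

import Mathlib

open scoped Matrix Topology

noncomputable section

namespace CHad

/-- A complex Hadamard matrix of order `N`: unimodular entries and `Hᴴ H = N I`. -/
def IsHadamard {N : ℕ} (H : Matrix (Fin N) (Fin N) ℂ) : Prop :=
  (∀ i j, ‖H i j‖ = 1) ∧ Hᴴ * H = (N : ℂ) • (1 : Matrix (Fin N) (Fin N) ℂ)

/-- `H ∼ K`: `H = P₁ D₁ K D₂ P₂` with permutation matrices `P₁, P₂` and diagonal unitary
matrices `D₁, D₂`. -/
def HEquiv {N : ℕ} (H K : Matrix (Fin N) (Fin N) ℂ) : Prop :=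
  ∃ (σ τ : Equiv.Perm (Fin N)) (d₁ d₂ : Fin N → ℂ),
    (∀ i, ‖d₁ i‖ = 1) ∧ (∀ i, ‖d₂ i‖ = 1) ∧
    H = σ.permMatrix ℂ * Matrix.diagonal d₁ * K * Matrix.diagonal d₂ * τ.permMatrix ℂ

/-- The curve `t ↦ (H i j · exp (i t R i j))` of matrices with entries of fixed moduli. -/
def phaseCurve {N : ℕ} (H : Matrix (Fin N) (Fin N) ℂ) (R : Matrix (Fin N) (Fin N) ℝ) (t : ℝ) :
    Matrix (Fin N) (Fin N) ℂ :=
  Matrix.of fun i j => H i j * Complex.exp (Complex.I * t * R i j)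

/-- The real phase matrices `R` that solve the first order unitarity condition
`d/dt (H(t)ᴴ H(t)) = 0` at `t = 0`, where `H(t) = phaseCurve H R t`; the condition is written out
here, see `mem_defectSpace_iff`. -/
def defectSpace {N : ℕ} (H : Matrix (Fin N) (Fin N) ℂ) :
    Submodule ℝ (Matrix (Fin N) (Fin N) ℝ) where
  carrier := {R | ∀ i j, ∑ k, star (H k i) * H k j * ((R k j - R k i : ℝ) : ℂ) = 0}
  zero_mem' := by intro i j; simp
  add_mem' := by
    intro R S hR hS i j
    have h := congrArg₂ (· + ·) (hR i j) (hS i j)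
    simp only [← Finset.sum_add_distrib, add_zero] at h
    rw [← h]
    refine Finset.sum_congr rfl fun k _ => ?_
    simp only [Matrix.add_apply]
    push_cast
    ring
  smul_mem' := by
    intro c R hR i j
    have h := congrArg (fun z => (c : ℂ) * z) (hR i j)
    simp only [Finset.mul_sum, mul_zero] at h
    rw [← h]
    refine Finset.sum_congr rfl fun k _ => ?_
    simp only [Matrix.smul_apply, smul_eq_mul]
    push_cast
    ring

theorem mem_defectSpace_iff {N : ℕ} (H : Matrix (Fin N) (Fin N) ℂ)
    (R : Matrix (Fin N) (Fin N) ℝ) :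
    R ∈ defectSpace H ↔
      ∀ i j, HasDerivAt (fun t : ℝ => ((phaseCurve H R t)ᴴ * phaseCurve H R t) i j) 0 0 := by
  have key : ∀ i j, HasDerivAt
      (fun t : ℝ => ((phaseCurve H R t)ᴴ * phaseCurve H R t) i j)
      (Complex.I * ∑ k, star (H k i) * H k j * ((R k j - R k i : ℝ) : ℂ)) 0 := by
    intro i j
    have hf : (fun t : ℝ => ((phaseCurve H R t)ᴴ * phaseCurve H R t) i j) =
        fun t : ℝ => ∑ k, star (H k i) * H k j *
          Complex.exp (Complex.I * ((R k j - R k i : ℝ) : ℂ) * t) := by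
      funext t
      rw [Matrix.mul_apply]
      refine Finset.sum_congr rfl fun k _ => ?_
      have h1 : star (Complex.exp (Complex.I * t * R k i)) =
          Complex.exp (-(Complex.I * t * R k i)) := by
        change (starRingEnd ℂ) _ = _
        rw [← Complex.exp_conj]
        simp
      have h2 : Complex.exp (Complex.I * ((R k j - R k i : ℝ) : ℂ) * t) =
          Complex.exp (-(Complex.I * t * R k i)) * Complex.exp (Complex.I * t * R k j) := by
        rw [← Complex.exp_add]
        congr 1
        push_cast
        ring
      simp only [Matrix.conjTranspose_apply, phaseCurve, Matrix.of_apply, star_mul', h1, h2]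
      ring
    rw [hf, Finset.mul_sum]
    refine HasDerivAt.fun_sum fun k _ => ?_
    have h0 : HasDerivAt (fun t : ℝ => Complex.I * ((R k j - R k i : ℝ) : ℂ) * (t : ℂ))
        (Complex.I * ((R k j - R k i : ℝ) : ℂ)) 0 := by
      simpa using (Complex.ofRealCLM.hasDerivAt (x := (0 : ℝ))).const_mul
        (Complex.I * ((R k j - R k i : ℝ) : ℂ))
    have h1 := (h0.cexp).const_mul (star (H k i) * H k j)
    refine h1.congr_deriv ?_
    simp
    ring
  constructor
  · intro h i j
    have := key i j
    rwa [h i j, mul_zero] at this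
  · intro h i j
    have := (key i j).unique (h i j)
    simpa using this

/-- The defect `d(H) = r - (2N - 1)`, with `r` the dimension of the solution space. -/
def defect {N : ℕ} (H : Matrix (Fin N) (Fin N) ℂ) : ℤ :=
  (Module.finrank ℝ (defectSpace H) : ℤ) - (2 * (N : ℤ) - 1)

/-- For unimodular `H`, the matrix with first row and first column equal to `1` that is obtained
from `H` by multiplying rows and columns by phases. -/
def dephase {N : ℕ} [NeZero N] (H : Matrix (Fin N) (Fin N) ℂ) : Matrix (Fin N) (Fin N) ℂ :=
  Matrix.of fun i j => H i j * H 0 0 * star (H i 0) * star (H 0 j)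

/-- `O` is an orbit of Hadamard matrices with `p` continuous parameters.

It consists of the matrices in (at most) countably many continuous parametrized pieces
`Φ k : D k → O` with `D k ⊆ ℝ^p`.  Up to a nowhere dense set of parameter values (such as the
boundary of the parameter domain), `Φ k` is continuously differentiable and the `p` parameters are
independent modulo the trivial row and column phases, i.e. the dephased map is an immersion. -/
structure IsOrbit {N : ℕ} [NeZero N] (p : ℕ) (O : Set (Matrix (Fin N) (Fin N) ℂ)) : Prop where
  nonempty : O.Nonempty
  hadamard : ∀ H ∈ O, IsHadamard H
  param : ∃ (D U : ℕ → Set (Fin p → ℝ)) (Φ : ℕ → (Fin p → ℝ) → Matrix (Fin N) (Fin N) ℂ),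
    (∀ k, IsOpen (U k) ∧ U k ⊆ D k ∧ D k ⊆ closure (U k) ∧
      ContinuousOn (Φ k) (D k) ∧
      (∀ i j, ContDiffOn ℝ 1 (fun t => Φ k t i j) (U k)) ∧
      ∀ t ∈ U k, ∀ v : Fin p → ℝ,
        (∀ i j, fderiv ℝ (fun s => dephase (Φ k s) i j) t v = 0) → v = 0) ∧
    O = ⋃ k, Φ k '' D k

/-- A `p`-parameter orbit is affine if, after dephasing, the phases of the matrix elements are
linear functions of `p` independent parameters (relative to a fixed seed matrix `H₀`). -/
def IsAffineOrbit {N : ℕ} [NeZero N] (p : ℕ) (O : Set (Matrix (Fin N) (Fin N) ℂ)) : Prop :=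
  IsOrbit p O ∧
  ∃ (H₀ : Matrix (Fin N) (Fin N) ℂ) (R : (Fin p → ℝ) →ₗ[ℝ] Matrix (Fin N) (Fin N) ℝ)
    (D : Set (Fin p → ℝ)),
    Function.Injective R ∧ D.Nonempty ∧ D ⊆ closure (interior D) ∧
    dephase '' O = (fun t => phaseCurve H₀ (R t) 1) '' D

/-- Containment of orbits, up to equivalence of the matrices. -/
def IsSuborbit {N : ℕ} (O O' : Set (Matrix (Fin N) (Fin N) ℂ)) : Prop :=
  ∀ H ∈ O, ∃ K ∈ O', HEquiv H K

/-- Equivalence of orbits. -/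
def OrbitEquiv {N : ℕ} (O O' : Set (Matrix (Fin N) (Fin N) ℂ)) : Prop :=
  IsSuborbit O O' ∧ IsSuborbit O' O

/-- `d` is the generic defect of `O`: it is the smallest defect along `O`, and it is attained
exactly on a relatively open, dense subset of `O`. -/
def HasGenericDefect {N : ℕ} (O : Set (Matrix (Fin N) (Fin N) ℂ)) (d : ℤ) : Prop :=
  IsLeast (defect '' O) d ∧
  ∃ V : Set (Matrix (Fin N) (Fin N) ℂ), IsOpen V ∧
    O ∩ V = {H ∈ O | defect H = d} ∧ O ⊆ closure (O ∩ V)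

/-- The symmetric block circulant matrix with circulant blocks and parameters `x, y, u, w`. -/
def bcMatrix (x y u w : ℂ) : Matrix (Fin 9) (Fin 9) ℂ :=
  !![1, x, x, y, u, w, y, w, u;
     x, 1, x, w, y, u, u, y, w;
     x, x, 1, u, w, y, w, u, y;
     y, w, u, 1, x, x, y, u, w;
     u, y, w, x, 1, x, w, y, u;
     w, u, y, x, x, 1, u, w, y;
     y, u, w, y, w, u, 1, x, x;
     w, y, u, u, y, w, x, 1, x;
     u, w, y, w, u, y, x, x, 1]

/-- The set `BC₉⁽²⁾`: the matrices `bcMatrix x y u w` with unimodular `x, y, u, w` and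
`x + y + u + w = 1`. -/
def BC9 : Set (Matrix (Fin 9) (Fin 9) ℂ) :=
  {H | ∃ x y u w : ℂ, ‖x‖ = 1 ∧ ‖y‖ = 1 ∧ ‖u‖ = 1 ∧ ‖w‖ = 1 ∧ x + y + u + w = 1 ∧
    H = bcMatrix x y u w}

/-- The primitive third root of unity `exp (2πi/3)`. -/
def omega : ℂ := Complex.exp (2 * Real.pi * Complex.I / 3)

/-- The Fourier matrix of order three. -/
def F3 : Matrix (Fin 3) (Fin 3) ℂ := Matrix.of fun i j => omega ^ ((i : ℕ) * (j : ℕ))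

/-- The diagonals of `I`, `Δ₁ = diag (1, x₁, x₂)` and `Δ₂ = diag (1, x₃, x₄)`. -/
def f9Diag (x₁ x₂ x₃ x₄ : ℂ) : Matrix (Fin 3) (Fin 3) ℂ :=
  !![1, 1, 1; 1, x₁, x₂; 1, x₃, x₄]

/-- The block matrix
`[[F₃, Δ₁F₃, Δ₂F₃], [F₃, ωΔ₁F₃, ω²Δ₂F₃], [F₃, ω²Δ₁F₃, ωΔ₂F₃]]`:
its `(a, b)` block is `ω^(ab) Δ_b F₃`, with `Δ₀ = I`.  Row `3a + i` is row `i` of block row `a`. -/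
def f9Matrix (x₁ x₂ x₃ x₄ : ℂ) : Matrix (Fin 9) (Fin 9) ℂ :=
  Matrix.of fun r s : Fin (3 * 3) =>
    omega ^ ((r.divNat : ℕ) * (s.divNat : ℕ)) *
      (f9Diag x₁ x₂ x₃ x₄ s.divNat r.modNat * F3 r.modNat s.modNat)

/-- The Fourier orbit `F₉⁽⁴⁾`. -/
def F9 : Set (Matrix (Fin 9) (Fin 9) ℂ) :=
  {H | ∃ x₁ x₂ x₃ x₄ : ℂ, ‖x₁‖ = 1 ∧ ‖x₂‖ = 1 ∧ ‖x₃‖ = 1 ∧ ‖x₄‖ = 1 ∧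
    H = f9Matrix x₁ x₂ x₃ x₄}

/-- The tenth root of unity `exp (2πi/10)`. -/
def eps : ℂ := Complex.exp (2 * Real.pi * Complex.I / 10)

/-- The parameters `(x, y, u, w)` of `B₉⁽⁰⁾`. -/
def paramB : Fin 4 → ℂ := ![eps, eps ^ 3, eps ^ 7, eps ^ 9]

/-- The unimodular number `(1 + i √15) / 4`. -/
def tau : ℂ := (1 + Complex.I * (Real.sqrt 15 : ℂ)) / 4

/-- The parameters `(x, y, u, w)` of `W_{9A}`. -/
def paramW : Fin 4 → ℂ := ![tau, tau, star tau, star tau]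

/-- The matrix `bcMatrix` with the parameters `v`, permuted by `σ`. -/
def bcPerm (v : Fin 4 → ℂ) (σ : Equiv.Perm (Fin 4)) : Matrix (Fin 9) (Fin 9) ℂ :=
  bcMatrix (v (σ 0)) (v (σ 1)) (v (σ 2)) (v (σ 3))

end CHad

end

open scoped Matrix Topology

noncomputable section

namespace CHad

/-! ### Equivalence, dephasing and semicontinuity of the defect -/

section General

variable {N : ℕ}

/-! Lower bounds on the defect come from deformations. At an immersion point of a `p`-parameter
orbit, the logarithmic derivatives of the dephased family are `p` independent solutions of the
linearised unitarity equations with vanishing first row and column. Together with the `2N - 1`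
trivial row and column phases they give defect at least `p`, and semicontinuity of the rank carries
this to the remaining points (`IsOrbit.le_defect`). Hence one element of defect at most 2 excludes
containment in any orbit with more parameters, and a generic defect is established by a dense set of
elements of defect at most `p` (`hasGenericDefect_of_dense`).

Upper bounds come from harmonic analysis. The matrix H(x,y,u,w) is the circulant on (ℤ/3)² of a
function that is 1 at the origin and constant on the four punctured lines; if the values on these
lines sum to one, its Fourier transform is 3 times a function of the same kind. In the Fourier basis
the linearised equations decouple into one system for each character η, and each system splits into
an even and an odd part (`phaseFourier_even_odd`). Where certain determinants, polynomials in the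
parameters, do not vanish (`GenericPoint`), the component η = 0 leaves 3 real dimensions and each of
the four pairs ±η leaves 2 complex ones: 3 + 16 = 19 = 17 + 2. The condition is dense on the
parameter surface, because for a fixed coordinate the bad values of another are roots of finitely
many cubics. It holds at the two special matrices by polynomial division.

For the Fourier orbit a partial transform turns the equations into a transport of coefficients
around the cycle of the three column blocks. Coefficients with nontrivial holonomy vanish, which
leaves 21 = 17 + 4 dimensions (`blockFourier_relation`, `blockFourier_one_eq_zero`).

Non-affineness: if an equivalent orbit were affine, a Baire argument would fix the permutations in
the equivalences on an open set of parameters. There x, y, u, w would have phases that are linear,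
and jointly injective, in two parameters, while their sum stays 1. In a suitable direction two
different nonzero frequencies occur. The terms of each must cancel, so each needs at least two of
the four terms, and the whole sum would be 0 (`not_forall_eventually_sum_eq_one`). -/

theorem HEquiv.exists_apply {H K : Matrix (Fin N) (Fin N) ℂ} (h : HEquiv H K) :
    ∃ (σ τ : Equiv.Perm (Fin N)) (d₁ d₂ : Fin N → ℂ), (∀ i, ‖d₁ i‖ = 1) ∧ (∀ i, ‖d₂ i‖ = 1) ∧
      ∀ i j, H i j = d₁ i * K (σ i) (τ j) * d₂ j := by
  obtain ⟨σ, τ, d₁, d₂, h₁, h₂, rfl⟩ := h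
  refine ⟨σ, τ.symm, d₁ ∘ σ, d₂ ∘ τ.symm, fun i => h₁ _, fun i => h₂ _, fun i j => ?_⟩
  rw [Equiv.Perm.permMatrix, Equiv.Perm.permMatrix, PEquiv.mul_toMatrix_toPEquiv,
    Matrix.submatrix_apply, Matrix.mul_assoc, Matrix.mul_assoc, PEquiv.toMatrix_toPEquiv_mul,
    Matrix.submatrix_apply, Matrix.diagonal_mul, Matrix.mul_diagonal, mul_assoc]
  rfl

theorem star_mul_self_of_norm_one {z : ℂ} (h : ‖z‖ = 1) : star z * z = 1 := by
  have := Complex.conj_mul' z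
  rw [h] at this
  simpa using this

/-- Row phases cancel in each product of an entry with a conjugate from the same row, and column
phases factor out of the sum over rows. Reindexing the phase matrix is therefore an isomorphism of
the two solution spaces. -/
theorem finrank_defectSpace_eq {H K : Matrix (Fin N) (Fin N) ℂ} {σ τ : Equiv.Perm (Fin N)}
    {d₁ d₂ : Fin N → ℂ} (h₁ : ∀ i, ‖d₁ i‖ = 1) (h₂ : ∀ i, ‖d₂ i‖ = 1)
    (h : ∀ i j, H i j = d₁ i * K (σ i) (τ j) * d₂ j) :
    Module.finrank ℝ (defectSpace H) = Module.finrank ℝ (defectSpace K) := by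
  have key : (defectSpace K) =
      (defectSpace H).comap (Matrix.reindexLinearEquiv ℝ ℝ σ.symm τ.symm).toLinearMap := by
    ext R
    have hR : ∀ i j, ∑ k, star (H k i) * H k j *
        ((R (σ k) (τ j) - R (σ k) (τ i) : ℝ) : ℂ) =
        star (d₂ i) * d₂ j * ∑ k, star (K k (τ i)) * K k (τ j) *
          ((R k (τ j) - R k (τ i) : ℝ) : ℂ) := by
      intro i j
      rw [← Equiv.sum_comp σ fun k => star (K k (τ i)) * K k (τ j) *
        ((R k (τ j) - R k (τ i) : ℝ) : ℂ), Finset.mul_sum]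
      refine Finset.sum_congr rfl fun k _ => ?_
      rw [h, h, star_mul', star_mul']
      linear_combination (star (d₂ i) * d₂ j * star (K (σ k) (τ i)) * K (σ k) (τ j) *
        ((R (σ k) (τ j) - R (σ k) (τ i) : ℝ) : ℂ)) * star_mul_self_of_norm_one (h₁ k)
    have hne : ∀ i j, star (d₂ i) * d₂ j ≠ 0 := fun i j => by
      rw [← norm_ne_zero_iff]; simp [h₂]
    constructor
    · intro hK i j
      exact (hR i j).trans (by rw [hK, mul_zero])
    · intro hH i j
      have := (hR (τ.symm i) (τ.symm j)).symm.trans (hH _ _)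
      rw [mul_eq_zero, or_iff_right (hne _ _)] at this
      simpa only [Equiv.apply_symm_apply] using this
  rw [key]
  exact (LinearEquiv.ofSubmodule' (Matrix.reindexLinearEquiv ℝ ℝ σ.symm τ.symm)
    (defectSpace H)).finrank_eq.symm

theorem HEquiv.finrank_eq {H K : Matrix (Fin N) (Fin N) ℂ} (h : HEquiv H K) :
    Module.finrank ℝ (defectSpace H) = Module.finrank ℝ (defectSpace K) := by
  obtain ⟨σ, τ, d₁, d₂, h₁, h₂, h⟩ := h.exists_apply
  exact finrank_defectSpace_eq h₁ h₂ h

theorem HEquiv.defect_eq {H K : Matrix (Fin N) (Fin N) ℂ} (h : HEquiv H K) :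
    defect H = defect K := by
  rw [defect, defect, h.finrank_eq]

theorem isHadamard_iff {H : Matrix (Fin N) (Fin N) ℂ} :
    IsHadamard H ↔ (∀ i j, ‖H i j‖ = 1) ∧
      ∀ i j, ∑ k, star (H k i) * H k j = if i = j then (N : ℂ) else 0 := by
  rw [IsHadamard, ← Matrix.ext_iff]
  simp [Matrix.mul_apply, Matrix.one_apply]

theorem dephase_apply [NeZero N] (H : Matrix (Fin N) (Fin N) ℂ) (i j : Fin N) :
    dephase H i j = star (H i 0) * H i j * (H 0 0 * star (H 0 j)) := by
  simp only [dephase, Matrix.of_apply]; ring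

theorem IsHadamard.dephase [NeZero N] {H : Matrix (Fin N) (Fin N) ℂ} (h : IsHadamard H) :
    IsHadamard (dephase H) := by
  rw [isHadamard_iff] at h ⊢
  refine ⟨fun i j => by simp [dephase_apply, h.1], fun i j => ?_⟩
  have : ∑ k, star (CHad.dephase H k i) * CHad.dephase H k j =
      star (H 0 0 * star (H 0 i)) * (H 0 0 * star (H 0 j)) * ∑ k, star (H k i) * H k j := by
    rw [Finset.mul_sum]
    refine Finset.sum_congr rfl fun k _ => ?_
    simp only [dephase_apply, star_mul', star_star]
    linear_combination (star (H 0 0) * H 0 i * (H 0 0 * star (H 0 j)) * star (H k i) * H k j) *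
      star_mul_self_of_norm_one (h.1 k 0)
  rw [this, h.2]
  split_ifs with hij
  · subst hij
    simp only [star_mul', star_star]
    linear_combination (N : ℂ) * star (H 0 i) * H 0 i * star_mul_self_of_norm_one (h.1 0 0) +
      (N : ℂ) * star_mul_self_of_norm_one (h.1 0 i)
  · simp

theorem IsHadamard.finrank_dephase [NeZero N] {H : Matrix (Fin N) (Fin N) ℂ}
    (h : IsHadamard H) :
    Module.finrank ℝ (defectSpace (CHad.dephase H)) = Module.finrank ℝ (defectSpace H) :=
  finrank_defectSpace_eq (σ := 1) (τ := 1) (d₁ := fun i => star (H i 0))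
    (d₂ := fun j => H 0 0 * star (H 0 j)) (by simp [h.1]) (by simp [h.1])
    (fun i j => dephase_apply H i j)

theorem IsHadamard.dephase_zero_left [NeZero N] {H : Matrix (Fin N) (Fin N) ℂ}
    (h : IsHadamard H) (j : Fin N) : CHad.dephase H 0 j = 1 := by
  rw [dephase_apply]
  linear_combination star (H 0 j) * H 0 j * star_mul_self_of_norm_one (h.1 0 0) +
    star_mul_self_of_norm_one (h.1 0 j)

theorem IsHadamard.dephase_zero_right [NeZero N] {H : Matrix (Fin N) (Fin N) ℂ}
    (h : IsHadamard H) (i : Fin N) : CHad.dephase H i 0 = 1 := by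
  rw [dephase_apply]
  linear_combination star (H i 0) * H i 0 * star_mul_self_of_norm_one (h.1 0 0) +
    star_mul_self_of_norm_one (h.1 i 0)

/-- The linear map whose kernel is `defectSpace H`. -/
def defectMap (H : Matrix (Fin N) (Fin N) ℂ) :
    (Fin N → Fin N → ℝ) →L[ℝ] (Fin N → Fin N → ℂ) :=
  LinearMap.toContinuousLinearMap
  { toFun := fun R i j => ∑ k, star (H k i) * H k j * ((R k j - R k i : ℝ) : ℂ)
    map_add' := by
      intro R S
      ext i j
      simp only [Pi.add_apply, ← Finset.sum_add_distrib]
      refine Finset.sum_congr rfl fun k _ => ?_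
      push_cast
      ring
    map_smul' := by
      intro c R
      ext i j
      simp only [Pi.smul_apply, smul_eq_mul, RingHom.id_apply, Complex.real_smul, Finset.mul_sum]
      refine Finset.sum_congr rfl fun k _ => ?_
      push_cast
      ring }

theorem continuous_defectMap : Continuous (defectMap (N := N)) := by
  rw [continuous_clm_apply]
  intro R
  refine continuous_pi fun i => continuous_pi fun j => ?_
  change Continuous fun H : Matrix (Fin N) (Fin N) ℂ =>
    ∑ k, star (H k i) * H k j * ((R k j - R k i : ℝ) : ℂ)
  fun_prop

theorem finrank_defectSpace_add_rank (H : Matrix (Fin N) (Fin N) ℂ) :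
    Module.finrank ℝ (LinearMap.range (defectMap H).toLinearMap) +
      Module.finrank ℝ (defectSpace H) = N * N := by
  have h := LinearMap.finrank_range_add_finrank_ker (defectMap H).toLinearMap
  have h1 : Module.finrank ℝ (Fin N → Fin N → ℝ) = N * N := by
    simp [Module.finrank_pi_fintype]
  rw [h1] at h
  rw [← h]
  congr 1
  refine LinearEquiv.finrank_eq (LinearEquiv.ofEq _ _ ?_)
  ext R
  exact ⟨fun hR => funext fun i => funext fun j => hR i j,
    fun hR i j => congrFun (congrFun hR i) j⟩

/-- The rank of a continuously varying linear map is lower semicontinuous, so by rank-nullity its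
kernel cannot jump up nearby. -/
theorem isOpen_finrank_defectSpace_le (n : ℕ) :
    IsOpen {H : Matrix (Fin N) (Fin N) ℂ | Module.finrank ℝ (defectSpace H) ≤ n} := by
  have h := (isOpen_setOfPred_nat_le_rank (𝕜 := ℝ) (E := Fin N → Fin N → ℝ)
    (F := Fin N → Fin N → ℂ) (N * N - n)).preimage continuous_defectMap
  convert h using 1
  ext H
  have := finrank_defectSpace_add_rank H
  change _ ≤ n ↔ ((N * N - n : ℕ) : Cardinal) ≤ (defectMap H).toLinearMap.rank
  rw [LinearMap.rank, ← Module.finrank_eq_rank, Nat.cast_le]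
  omega

theorem isClosed_le_finrank_defectSpace (n : ℕ) :
    IsClosed {H : Matrix (Fin N) (Fin N) ℂ | n ≤ Module.finrank ℝ (defectSpace H)} := by
  rcases n with _ | n
  · simp
  · convert (isOpen_finrank_defectSpace_le (N := N) n).isClosed_compl using 1
    ext H
    simp

end General

/-! ### The number of parameters of an orbit bounds the defect from below -/

section Orbit

variable {N : ℕ} {p : ℕ}

/-- The logarithmic derivative of a differentiable family of unimodular matrices. -/
def logDeriv (M : (Fin p → ℝ) → Matrix (Fin N) (Fin N) ℂ) (t : Fin p → ℝ) :
    (Fin p → ℝ) →ₗ[ℝ] Matrix (Fin N) (Fin N) ℝ where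
  toFun v := Matrix.of fun i j => (star (M t i j) * fderiv ℝ (fun s => M s i j) t v).im
  map_add' v w := by
    ext i j
    simp only [map_add, Matrix.of_apply, Matrix.add_apply, mul_add, Complex.add_im]
  map_smul' c v := by
    ext i j
    simp only [map_smul, Matrix.of_apply, Matrix.smul_apply, smul_eq_mul, RingHom.id_apply,
      mul_smul_comm, Complex.smul_im]

/-- Differentiating `star z * z = 1` shows that `star z * z'` is purely imaginary, so its imaginary
part determines `z'`. -/
theorem fderiv_eq_logDeriv {M : (Fin p → ℝ) → Matrix (Fin N) (Fin N) ℂ} {t : Fin p → ℝ}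
    (hM : ∀ᶠ s in 𝓝 t, IsHadamard (M s))
    (hd : ∀ i j, DifferentiableAt ℝ (fun s => M s i j) t) (v : Fin p → ℝ) (i j : Fin N) :
    fderiv ℝ (fun s => M s i j) t v = Complex.I * M t i j * logDeriv M t v i j := by
  have h0 := (hd i j).hasFDerivAt.hasLineDerivAt v
  have h1 : HasLineDerivAt ℝ (fun s => star (M s i j) * M s i j) 0 t v := by
    refine ((hasFDerivAt_const (1 : ℂ) t).congr_of_eventuallyEq ?_).hasLineDerivAt v
    filter_upwards [hM] with s hs using star_mul_self_of_norm_one (hs.1 i j)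
  have h2 := (HasDerivAt.mul (HasDerivAt.star h0) h0).unique h1
  have h4 := star_mul_self_of_norm_one (hM.self_of_nhds.1 i j)
  simp only [logDeriv, LinearMap.coe_mk, AddHom.coe_mk, Matrix.of_apply]
  simp only [zero_smul, add_zero] at h2
  generalize fderiv ℝ (fun s => M s i j) t v = w at h2 ⊢
  have h5 : (starRingEnd ℂ) (star (M t i j) * w) = - (star (M t i j) * w) := by
    simp only [map_mul, Complex.star_def, Complex.conj_conj] at h2 ⊢
    linear_combination h2
  have h6 : star (M t i j) * w = Complex.I * ((star (M t i j) * w).im : ℂ) := by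
    generalize star (M t i j) * w = z at h5
    have := congrArg Complex.re h5
    simp only [Complex.conj_re, Complex.neg_re] at this
    apply Complex.ext
    · simp only [Complex.mul_re, Complex.I_re, Complex.ofReal_re, Complex.I_im, Complex.ofReal_im]
      linarith
    · simp
  linear_combination (M t i j) * h6 - w * h4

theorem logDeriv_mem_defectSpace {M : (Fin p → ℝ) → Matrix (Fin N) (Fin N) ℂ} {t : Fin p → ℝ}
    (hM : ∀ᶠ s in 𝓝 t, IsHadamard (M s))
    (hd : ∀ i j, DifferentiableAt ℝ (fun s => M s i j) t) (v : Fin p → ℝ) :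
    logDeriv M t v ∈ defectSpace (M t) := by
  intro i j
  have h0 := fun i j => (hd i j).hasFDerivAt.hasLineDerivAt v
  have h1 : HasLineDerivAt ℝ (fun s => ∑ k, star (M s k i) * M s k j) 0 t v := by
    refine ((hasFDerivAt_const (if i = j then (N : ℂ) else 0) t).congr_of_eventuallyEq
      ?_).hasLineDerivAt v
    filter_upwards [hM] with s hs using (isHadamard_iff.1 hs).2 i j
  have h2 := (HasDerivAt.fun_sum (u := Finset.univ) fun k _ =>
    HasDerivAt.mul (HasDerivAt.star (h0 k i)) (h0 k j)).unique h1
  have h4 : Complex.I * ∑ k, star (M t k i) * M t k j *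
      ((logDeriv M t v k j - logDeriv M t v k i : ℝ) : ℂ) = 0 := by
    rw [← h2, Finset.mul_sum]
    refine Finset.sum_congr rfl fun k _ => ?_
    simp only [zero_smul, add_zero]
    rw [fderiv_eq_logDeriv hM hd, fderiv_eq_logDeriv hM hd]
    simp only [star_mul', Complex.star_def, Complex.conj_I, Complex.conj_ofReal]
    push_cast
    ring
  simpa using h4

variable [NeZero N]

/-- The normalised first row and column make the `p` tangent directions independent of the row and
column phases, which solve the equations because distinct columns are orthogonal. -/
theorem le_finrank_defectSpace {M : (Fin p → ℝ) → Matrix (Fin N) (Fin N) ℂ} {t : Fin p → ℝ}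
    (hM : ∀ᶠ s in 𝓝 t, IsHadamard (M s)) (hr : ∀ᶠ s in 𝓝 t, ∀ j, M s 0 j = 1)
    (hc : ∀ᶠ s in 𝓝 t, ∀ i, M s i 0 = 1)
    (hd : ∀ i j, DifferentiableAt ℝ (fun s => M s i j) t)
    (hinj : ∀ v, (∀ i j, fderiv ℝ (fun s => M s i j) t v = 0) → v = 0) :
    p + (2 * N - 1) ≤ Module.finrank ℝ (defectSpace (M t)) := by
  have hr0 : ∀ v j, logDeriv M t v 0 j = 0 := by
    intro v j
    have : fderiv ℝ (fun s => M s 0 j) t = 0 :=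
      ((hasFDerivAt_const (1 : ℂ) t).congr_of_eventuallyEq
        (hr.mono fun s hs => hs j)).fderiv
    simp [logDeriv, this]
  have hc0 : ∀ v i, logDeriv M t v i 0 = 0 := by
    intro v i
    have : fderiv ℝ (fun s => M s i 0) t = 0 :=
      ((hasFDerivAt_const (1 : ℂ) t).congr_of_eventuallyEq
        (hc.mono fun s hs => hs i)).fderiv
    simp [logDeriv, this]
  -- A common row phase equals a common column phase; dropping the phase of column 0 removes this
  -- overlap and leaves `N + (N - 1)` trivial directions.
  let L : ((Fin p → ℝ) × (Fin N → ℝ) × ({j : Fin N // j ≠ 0} → ℝ)) →ₗ[ℝ]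
      Matrix (Fin N) (Fin N) ℝ :=
    { toFun := fun x => logDeriv M t x.1 +
        Matrix.of fun i j => x.2.1 i + if h : j ≠ 0 then x.2.2 ⟨j, h⟩ else 0
      map_add' := by
        intro x y
        ext i j
        simp only [Prod.fst_add, Prod.snd_add, map_add, Matrix.add_apply, Matrix.of_apply,
          Pi.add_apply]
        split_ifs <;> ring
      map_smul' := by
        intro c x
        ext i j
        simp only [Prod.smul_fst, Prod.smul_snd, map_smul, Matrix.add_apply, Matrix.of_apply,
          Pi.smul_apply, Matrix.smul_apply, RingHom.id_apply, smul_eq_mul]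
        split_ifs <;> ring }
  have hLa : ∀ x i j, L x i j = logDeriv M t x.1 i j +
      (x.2.1 i + if h : j ≠ 0 then x.2.2 ⟨j, h⟩ else 0) := fun _ _ _ => rfl
  have hL : ∀ x, L x ∈ defectSpace (M t) := by
    intro x
    refine (defectSpace (M t)).add_mem (logDeriv_mem_defectSpace hM hd x.1) ?_
    intro i j
    have h := (isHadamard_iff.1 hM.self_of_nhds).2 i j
    have h2 : ∀ k, star (M t k i) * M t k j * (((Matrix.of fun i j => x.2.1 i +
        if h : j ≠ 0 then x.2.2 ⟨j, h⟩ else 0) k j - (Matrix.of fun i j => x.2.1 i +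
        if h : j ≠ 0 then x.2.2 ⟨j, h⟩ else 0) k i : ℝ) : ℂ) = star (M t k i) * M t k j *
        (((if h : j ≠ 0 then x.2.2 ⟨j, h⟩ else 0) -
          (if h : i ≠ 0 then x.2.2 ⟨i, h⟩ else 0) : ℝ) : ℂ) := by
      intro k
      simp only [Matrix.of_apply]
      push_cast
      ring
    rw [Finset.sum_congr rfl fun k _ => h2 k, ← Finset.sum_mul, h]
    by_cases hij : i = j
    · subst hij
      rw [sub_self, Complex.ofReal_zero, mul_zero]
    · rw [if_neg hij, zero_mul]
  have hker : Function.Injective (L.codRestrict (defectSpace (M t)) hL) := by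
    rw [← LinearMap.ker_eq_bot, LinearMap.ker_codRestrict, LinearMap.ker_eq_bot']
    rintro ⟨v, a, b⟩ h
    have e : ∀ i j, L (v, a, b) i j = 0 := fun i j => by rw [h]; rfl
    -- Column 0 sees only the row phases, row 0 then only the column phases, and what remains is the
    -- derivative.
    have ha : a = 0 := by
      funext i
      have := e i 0
      simpa [hLa, hc0] using this
    have hb : b = 0 := by
      funext j
      have := e 0 j
      simpa [hLa, hr0, ha, j.2] using this
    have hv : v = 0 := by
      refine hinj v fun i j => ?_
      rw [fderiv_eq_logDeriv hM hd]
      have := e i j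
      have h0 : logDeriv M t v i j = 0 := by simpa [hLa, ha, hb] using this
      simp [h0]
    rw [ha, hb, hv]; rfl
  have := LinearMap.finrank_le_finrank_of_injective hker
  simp only [Module.finrank_prod, Module.finrank_fintype_fun_eq_card, Fintype.card_fin,
    Fintype.card_subtype_compl, Fintype.card_unique] at this
  have := NeZero.pos N
  omega

/-- Every element of an orbit with `p` parameters has defect at least `p`. -/
theorem IsOrbit.le_defect {O : Set (Matrix (Fin N) (Fin N) ℂ)} (hO : IsOrbit p O)
    {H : Matrix (Fin N) (Fin N) ℂ} (hH : H ∈ O) : (p : ℤ) ≤ defect H := by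
  obtain ⟨D, U, Φ, h, hOe⟩ := hO.param
  rw [hOe, Set.mem_iUnion] at hH
  obtain ⟨k, t, ht, rfl⟩ := hH
  obtain ⟨hUo, hUD, hDU, hcont, hC1, himm⟩ := h k
  have hHad : ∀ s ∈ D k, IsHadamard (Φ k s) := fun s hs => hO.hadamard _ (by
    rw [hOe]; exact Set.mem_iUnion.2 ⟨k, s, hs, rfl⟩)
  have key : p + (2 * N - 1) ≤ Module.finrank ℝ (defectSpace (Φ k t)) := by
    have hcl := (isClosed_le_finrank_defectSpace (N := N) (p + (2 * N - 1)))
    -- The immersion condition is available only on `U k`; the other points of `D k` are reached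
    -- because a lower bound on the kernel dimension is a closed condition.
    have hmem : Φ k t ∈ closure (Φ k '' U k) :=
      ((hcont t ht).mono hUD).mem_closure_image (hDU ht)
    refine (hcl.closure_subset_iff.2 ?_) hmem
    rintro _ ⟨s, hs, rfl⟩
    have hev : ∀ᶠ s in 𝓝 s, s ∈ U k := hUo.mem_nhds hs
    rw [Set.mem_ofPred_eq, ← (hHad s (hUD hs)).finrank_dephase]
    have hdif : ∀ i j, DifferentiableAt ℝ (fun t => Φ k t i j) s := fun i j =>
      ((hC1 i j).differentiableOn (by norm_num)).differentiableAt (hUo.mem_nhds hs)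
    refine le_finrank_defectSpace (M := fun t => dephase (Φ k t)) ?_ ?_ ?_ ?_ ?_
    · exact hev.mono fun r hr => (hHad r (hUD hr)).dephase
    · exact hev.mono fun r hr => (hHad r (hUD hr)).dephase_zero_left
    · exact hev.mono fun r hr => (hHad r (hUD hr)).dephase_zero_right
    · intro i j
      simp only [dephase_apply]
      exact (((hdif i 0).star).mul (hdif i j)).mul ((hdif 0 0).mul (hdif 0 j).star)
    · exact himm s hs
  have := NeZero.pos N
  rw [defect]
  omega

/-- A set of matrices with an element of defect less than `p` is not contained in an orbit with
`p` parameters. -/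
theorem IsOrbit.not_isSuborbit {O O' : Set (Matrix (Fin N) (Fin N) ℂ)} (hO : IsOrbit p O')
    {H : Matrix (Fin N) (Fin N) ℂ} (hH : H ∈ O) (hd : defect H < p) : ¬ IsSuborbit O O' := by
  intro h
  obtain ⟨K, hK, hHK⟩ := h H hH
  have := hO.le_defect hK
  rw [hHK.defect_eq] at hd
  omega

/-- Since the defect is at least `p` along the whole orbit, having defect `p` is the same as the
open condition of having defect at most `p`. -/
theorem hasGenericDefect_of_dense {O : Set (Matrix (Fin N) (Fin N) ℂ)} (hO : IsOrbit p O)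
    (hd : O ⊆ closure {H ∈ O | defect H ≤ p}) : HasGenericDefect O p := by
  have heq : ∀ H ∈ O, (defect H ≤ p ↔ defect H = p) := fun H hH =>
    ⟨fun h => le_antisymm h (hO.le_defect hH), fun h => h.le⟩
  have hV : ∀ H : Matrix (Fin N) (Fin N) ℂ,
      Module.finrank ℝ (defectSpace H) ≤ p + (2 * N - 1) ↔ defect H ≤ p := by
    intro H
    have := NeZero.pos N
    rw [defect]
    omega
  have hset : O ∩ {H | Module.finrank ℝ (defectSpace H) ≤ p + (2 * N - 1)} =
      {H ∈ O | defect H ≤ p} := by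
    ext H
    exact and_congr_right fun _ => hV H
  refine ⟨⟨?_, ?_⟩, _, isOpen_finrank_defectSpace_le (p + (2 * N - 1)), ?_, ?_⟩
  · obtain ⟨H, hH⟩ := hO.nonempty
    obtain ⟨K, hK, hd⟩ := closure_nonempty_iff.1 ⟨H, hd hH⟩
    exact ⟨K, hK, (heq K hK).1 hd⟩
  · rintro _ ⟨H, hH, rfl⟩
    exact hO.le_defect hH
  · rw [hset]
    ext H
    exact and_congr_right fun hH => heq H hH
  · rw [hset]
    exact hd

end Orbit

/-! ### Characters of ℤ/3 and of (ℤ/3)² -/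

section Characters

theorem omega_pow_three : omega ^ 3 = 1 := by
  rw [omega, ← Complex.exp_nat_mul, ← Complex.exp_two_pi_mul_I]
  congr 1
  push_cast
  ring

theorem isPrimitiveRoot_omega : IsPrimitiveRoot omega 3 := by
  have := Complex.isPrimitiveRoot_exp 3 (by norm_num)
  rwa [Nat.cast_ofNat] at this

theorem omega_sum : 1 + omega + omega ^ 2 = 0 := by
  have := isPrimitiveRoot_omega.geom_sum_eq_zero (by norm_num)
  simpa [Finset.sum_range_succ] using this

theorem norm_omega : ‖omega‖ = 1 :=
  isPrimitiveRoot_omega.norm'_eq_one (by norm_num)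

theorem omega_sub_sq_ne_zero : omega - omega ^ 2 ≠ 0 := by
  intro h
  have h4 : (3 : ℂ) = 0 := by
    linear_combination omega_sum + (omega - 2) * omega_pow_three - (omega - omega ^ 2) * h
  norm_num at h4

/-- The additive character `n ↦ ω ^ n` of `ℤ / 3`. -/
def cubeChar : AddChar (ZMod 3) ℂ := AddChar.zmodChar 3 omega_pow_three

theorem cubeChar_zero : cubeChar 0 = 1 := AddChar.map_zero_eq_one _

theorem cubeChar_one : cubeChar 1 = omega := by
  rw [cubeChar, AddChar.zmodChar_apply]; exact pow_one _

theorem cubeChar_two : cubeChar 2 = omega ^ 2 := by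
  rw [cubeChar, AddChar.zmodChar_apply]; rfl

theorem sum_zmod_three {M : Type*} [AddCommMonoid M] (f : ZMod 3 → M) :
    ∑ i, f i = f 0 + f 1 + f 2 := Fin.sum_univ_three f

theorem star_cubeChar (n : ZMod 3) : star (cubeChar n) = cubeChar (-n) := by
  have h : ‖cubeChar n‖ = 1 := by
    rw [cubeChar, AddChar.zmodChar_apply, norm_pow, norm_omega, one_pow]
  have h2 : cubeChar n * cubeChar (-n) = 1 := by
    rw [← AddChar.map_add_eq_mul, add_neg_cancel, cubeChar_zero]
  linear_combination cubeChar (-n) * star_mul_self_of_norm_one h - star (cubeChar n) * h2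

/-- The group `(ℤ / 3)²`. -/
abbrev Plane := ZMod 3 × ZMod 3

/-- The pairing `(a, g) ↦ ω ^ (a₁ g₁ + a₂ g₂)`. -/
def chr (a g : Plane) : ℂ := cubeChar (a.1 * g.1 + a.2 * g.2)

theorem chr_add_left (a b g : Plane) : chr (a + b) g = chr a g * chr b g := by
  rw [chr, chr, chr, ← AddChar.map_add_eq_mul]
  congr 1
  simp only [Prod.fst_add, Prod.snd_add]
  ring

theorem chr_add_right (a g h : Plane) : chr a (g + h) = chr a g * chr a h := by
  rw [chr, chr, chr, ← AddChar.map_add_eq_mul]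
  congr 1
  simp only [Prod.fst_add, Prod.snd_add]
  ring

theorem star_chr (a g : Plane) : star (chr a g) = chr (-a) g := by
  rw [chr, chr, star_cubeChar]
  congr 1
  simp only [Prod.fst_neg, Prod.snd_neg]
  ring

theorem chr_neg_right (a g : Plane) : chr a (-g) = chr (-a) g := by
  rw [chr, chr]
  congr 1
  simp only [Prod.fst_neg, Prod.snd_neg]
  ring

theorem chr_sub_right (a g h : Plane) : chr a (g - h) = chr a g * chr (-a) h := by
  rw [sub_eq_add_neg, chr_add_right, chr_neg_right]

theorem sum_cubeChar (n : ZMod 3) : ∑ m : ZMod 3, cubeChar (m * n) = if n = 0 then 3 else 0 := by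
  have h := omega_sum
  rw [sum_zmod_three]
  fin_cases n
  · change cubeChar (0 * 0) + cubeChar (1 * 0) + cubeChar (2 * 0) = 3
    rw [mul_zero, mul_zero, mul_zero, cubeChar_zero]
    norm_num
  · change cubeChar (0 * 1) + cubeChar (1 * 1) + cubeChar (2 * 1) = 0
    rw [mul_one, mul_one, mul_one, cubeChar_zero, cubeChar_one, cubeChar_two]
    exact h
  · change cubeChar (0 * 2) + cubeChar (1 * 2) + cubeChar (2 * 2) = 0
    rw [show (2 : ZMod 3) * 2 = 1 from rfl, zero_mul, one_mul, cubeChar_zero, cubeChar_one,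
      cubeChar_two]
    linear_combination h

theorem sum_chr (g : Plane) : ∑ a, chr a g = if g = 0 then 9 else 0 := by
  have : ∑ a, chr a g = (∑ m : ZMod 3, cubeChar (m * g.1)) * ∑ m : ZMod 3, cubeChar (m * g.2) := by
    rw [Finset.sum_mul_sum, Fintype.sum_prod_type]
    simp only [chr, AddChar.map_add_eq_mul]
  rw [this, sum_cubeChar, sum_cubeChar]
  by_cases h1 : g.1 = 0 <;> by_cases h2 : g.2 = 0 <;> simp [h1, h2, Prod.ext_iff]
  norm_num

end Characters

/-! ### Linearised unitarity of circulant matrices in the Fourier basis -/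

section Circulant

/-- The partial Fourier transform, along the sums `k + j`, of a phase matrix `R`. -/
def phaseFourier (R : Plane → Plane → ℝ) (η g : Plane) : ℂ :=
  ∑ j, chr η (g - j) * (R (j + g) j : ℂ)

/-- Reality of `R`: only one character of each pair `±η` needs to be treated, and the component `η =
0` is real. -/
theorem star_phaseFourier (R : Plane → Plane → ℝ) (η g : Plane) :
    star (phaseFourier R η g) = phaseFourier R (-η) g := by
  simp only [phaseFourier, star_sum, star_mul', star_chr]
  simp

/-- Fourier inversion on each diagonal `k - j = g`, where `g - j` runs through the whole group. -/
theorem eq_zero_of_phaseFourier {R : Plane → Plane → ℝ} (h : ∀ η g, phaseFourier R η g = 0)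
    (k j : Plane) : R k j = 0 := by
  have h1 : ∑ η, chr η (j - (k - j)) * phaseFourier R η (k - j) = 9 * (R k j : ℂ) := by
    simp only [phaseFourier, Finset.mul_sum]
    rw [Finset.sum_comm]
    have : ∀ i, ∑ η, chr η (j - (k - j)) * (chr η (k - j - i) * (R (i + (k - j)) i : ℂ)) =
        if i = j then 9 * (R k j : ℂ) else 0 := by
      intro i
      simp only [← mul_assoc, ← chr_add_right, ← Finset.sum_mul]
      rw [sum_chr]
      have : j - (k - j) + (k - j - i) = j - i := by abel
      rw [this]
      by_cases hij : i = j
      · subst hij; simp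
      · rw [if_neg hij, if_neg (sub_ne_zero.2 (Ne.symm hij)), zero_mul]
    rw [Finset.sum_congr rfl fun i _ => this i]
    simp
  simp only [h, mul_zero, Finset.sum_const_zero] at h1
  have := (mul_eq_zero.1 h1.symm).resolve_left (by norm_num)
  exact_mod_cast this

/-- The first order unitarity condition of a circulant matrix in the Fourier basis. -/
theorem phaseFourier_relation {f C : Plane → ℂ} {R : Plane → Plane → ℝ}
    (hR : ∀ i j, ∑ k, star (f (k - i)) * f (k - j) * ((R k j - R k i : ℝ) : ℂ) = 0)
    (hC : ∀ φ, ∑ g, chr φ g * f g = C φ) (hneg : ∀ φ, C (-φ) = C φ) (θ η : Plane) :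
    star (C (θ - η)) * ∑ g, chr (-θ) g * f g * phaseFourier R η g =
      C (θ + η) * ∑ g, chr θ g * star (f g) * phaseFourier R η g := by
  have hC1 : ∀ φ k, ∑ i, chr (-φ) i * star (f (k - i)) = chr (-φ) k * star (C φ) := by
    intro φ k
    rw [← Equiv.sum_comp (Equiv.subLeft k), ← hneg, ← hC, star_sum, Finset.mul_sum]
    refine Finset.sum_congr rfl fun g _ => ?_
    simp only [Equiv.subLeft_apply, sub_sub_cancel, chr_sub_right, star_mul', star_chr, neg_neg]
    ring
  have hC2 : ∀ φ k, ∑ j, chr φ j * f (k - j) = chr φ k * C φ := by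
    intro φ k
    rw [← Equiv.sum_comp (Equiv.subLeft k), ← hneg, ← hC, Finset.mul_sum]
    refine Finset.sum_congr rfl fun g _ => ?_
    simp only [Equiv.subLeft_apply, sub_sub_cancel, chr_sub_right]
    ring
  -- With `k = j + g` the sum `k + j` is `g + 2 j = g - j` modulo 3, the argument of the character
  -- in `phaseFourier`.
  have h3 : η + η = -η := by
    have : ∀ η : Plane, η + η = -η := by decide
    exact this η
  -- The equations are transformed in `i` and `j`. In the part with `R k j` the index `i` occurs
  -- only in a convolution with `star f`, which gives an eigenvalue times a character of `k`.
  have hL : ∑ i, ∑ j, ∑ k, chr (-(θ - η)) i * chr (θ + η) j *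
      (star (f (k - i)) * f (k - j) * (R k j : ℂ)) =
      star (C (θ - η)) * ∑ g, chr (-θ) g * f g * phaseFourier R η g := by
    have e1 : ∀ j, ∑ i, ∑ k, chr (-(θ - η)) i * chr (θ + η) j *
        (star (f (k - i)) * f (k - j) * (R k j : ℂ)) =
        star (C (θ - η)) * ∑ g, chr (-θ) g * f g * (chr η (g - j) * (R (j + g) j : ℂ)) := by
      intro j
      rw [Finset.sum_comm, ← Equiv.sum_comp (Equiv.addLeft j), Finset.mul_sum]
      refine Finset.sum_congr rfl fun g _ => ?_
      have := hC1 (θ - η) (j + g)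
      simp only [Equiv.coe_addLeft, add_sub_cancel_left]
      have e2 : ∑ i, chr (-(θ - η)) i * chr (θ + η) j * (star (f (j + g - i)) * f g *
          (R (j + g) j : ℂ)) = (∑ i, chr (-(θ - η)) i * star (f (j + g - i))) *
          (chr (θ + η) j * f g * (R (j + g) j : ℂ)) := by
        rw [Finset.sum_mul]
        exact Finset.sum_congr rfl fun i _ => by ring
      rw [e2, this]
      have e3 : chr (-(θ - η)) (j + g) * chr (θ + η) j = chr (-θ) g * chr η (g - j) := by
        rw [chr_add_right, chr_sub_right, ← h3, chr_add_left, chr_add_left,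
          show -(θ - η) = -θ + η by abel, chr_add_left, chr_add_left]
        have : chr (-θ) j * chr θ j = 1 := by
          rw [← chr_add_left, neg_add_cancel, chr]; simp
        linear_combination chr η j * chr (-θ) g * chr η g * chr η j * this
      linear_combination star (C (θ - η)) * f g * (R (j + g) j : ℂ) * e3
    rw [Finset.sum_comm, Finset.sum_congr rfl fun j _ => e1 j, ← Finset.mul_sum, Finset.sum_comm]
    simp only [phaseFourier, Finset.mul_sum]
  -- In the part with `R k i` the roles are exchanged: now the sum over `j` is the convolution.
  have hK : ∑ i, ∑ j, ∑ k, chr (-(θ - η)) i * chr (θ + η) j *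
      (star (f (k - i)) * f (k - j) * (R k i : ℂ)) =
      C (θ + η) * ∑ g, chr θ g * star (f g) * phaseFourier R η g := by
    have e1 : ∀ i, ∑ j, ∑ k, chr (-(θ - η)) i * chr (θ + η) j *
        (star (f (k - i)) * f (k - j) * (R k i : ℂ)) =
        C (θ + η) * ∑ g, chr θ g * star (f g) * (chr η (g - i) * (R (i + g) i : ℂ)) := by
      intro i
      rw [Finset.sum_comm, ← Equiv.sum_comp (Equiv.addLeft i), Finset.mul_sum]
      refine Finset.sum_congr rfl fun g _ => ?_
      have := hC2 (θ + η) (i + g)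
      simp only [Equiv.coe_addLeft, add_sub_cancel_left]
      have e2 : ∑ j, chr (-(θ - η)) i * chr (θ + η) j * (star (f g) * f (i + g - j) *
          (R (i + g) i : ℂ)) = (∑ j, chr (θ + η) j * f (i + g - j)) *
          (chr (-(θ - η)) i * star (f g) * (R (i + g) i : ℂ)) := by
        rw [Finset.sum_mul]
        exact Finset.sum_congr rfl fun i _ => by ring
      rw [e2, this]
      have e3 : chr (θ + η) (i + g) * chr (-(θ - η)) i = chr θ g * chr η (g - i) := by
        rw [chr_add_right, chr_sub_right, ← h3, chr_add_left, chr_add_left,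
          show -(θ - η) = -θ + η by abel, chr_add_left, chr_add_left]
        have : chr (-θ) i * chr θ i = 1 := by
          rw [← chr_add_left, neg_add_cancel, chr]; simp
        linear_combination chr η i * chr θ g * chr η g * chr η i * this
      linear_combination C (θ + η) * star (f g) * (R (i + g) i : ℂ) * e3
    rw [Finset.sum_congr rfl fun j _ => e1 j, ← Finset.mul_sum, Finset.sum_comm]
    simp only [phaseFourier, Finset.mul_sum]
  rw [← hL, ← hK, ← sub_eq_zero]
  simp only [← Finset.sum_sub_distrib]
  refine Finset.sum_eq_zero fun i _ => Finset.sum_eq_zero fun j _ => ?_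
  have := congrArg (fun z => chr (-(θ - η)) i * chr (θ + η) j * z) (hR i j)
  simp only [mul_zero, Finset.mul_sum] at this
  rw [← this]
  refine Finset.sum_congr rfl fun k _ => ?_
  push_cast
  ring

/-- Unimodularity of `c` moves the conjugated eigenvalue to the other side. As `c` is even, `θ` and
`-θ` then have the same multiplier, while the characters on the two sides are exchanged; this gives
the sign `+` for the sum of the two relations and `-` for the difference. -/
theorem phaseFourier_even_odd {f c : Plane → ℂ} {R : Plane → Plane → ℝ}
    (hR : ∀ i j, ∑ k, star (f (k - i)) * f (k - j) * ((R k j - R k i : ℝ) : ℂ) = 0)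
    (hC : ∀ φ, ∑ g, chr φ g * f g = 3 * c φ) (hneg : ∀ φ, c (-φ) = c φ)
    (hc : ∀ φ, ‖c φ‖ = 1) (θ η : Plane) :
    (∑ g, (chr θ g + chr (-θ) g) * f g * phaseFourier R η g =
      c (θ + η) * c (θ - η) * ∑ g, (chr θ g + chr (-θ) g) * star (f g) * phaseFourier R η g) ∧
    (∑ g, (chr θ g - chr (-θ) g) * f g * phaseFourier R η g =
      -(c (θ + η) * c (θ - η)) *
        ∑ g, (chr θ g - chr (-θ) g) * star (f g) * phaseFourier R η g) := by
  have h1 := phaseFourier_relation (C := fun φ => 3 * c φ) hR hC (by simp [hneg]) θ η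
  have h2 := phaseFourier_relation (C := fun φ => 3 * c φ) hR hC (by simp [hneg]) (-θ) η
  rw [show -θ - η = -(θ + η) by abel, show -θ + η = -(θ - η) by abel] at h2
  simp only [hneg, neg_neg, star_mul'] at h1 h2
  have h3 : star (3 : ℂ) = 3 := by simp
  rw [h3] at h1 h2
  have k1 := star_mul_self_of_norm_one (hc (θ - η))
  have k2 := star_mul_self_of_norm_one (hc (θ + η))
  simp only [add_mul, sub_mul, Finset.sum_add_distrib, Finset.sum_sub_distrib]
  generalize ∑ g, chr (-θ) g * f g * phaseFourier R η g = A at *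
  generalize ∑ g, chr θ g * f g * phaseFourier R η g = B at *
  generalize ∑ g, chr θ g * star (f g) * phaseFourier R η g = A' at *
  generalize ∑ g, chr (-θ) g * star (f g) * phaseFourier R η g = B' at *
  have h1' : A = c (θ + η) * c (θ - η) * A' := by
    linear_combination c (θ - η) / 3 * h1 - A * k1
  have h2' : B = c (θ + η) * c (θ - η) * B' := by
    linear_combination c (θ + η) / 3 * h2 - B * k2
  constructor
  · linear_combination h1' + h2'
  · linear_combination h2' - h1'

end Circulant

/-! ### The small linear systems and their determinants -/

section Algebra

variable {x₁ x₂ x₃ x₄ y₁ y₂ y₃ y₄ : ℂ}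

/-- After rescaling the unknowns by the `xᵢ` and changing the signs of two rows, the coefficient
matrix is skew-symmetric with entries `±(xᵢ² + xⱼ²)`. Its Pfaffian is, up to sign, twice the square
of the second elementary symmetric polynomial. -/
theorem antisymm_system {m₁ m₂ m₃ m₄ : ℂ}
    (h₁ : x₁ * y₁ = 1) (h₂ : x₂ * y₂ = 1) (h₃ : x₃ * y₃ = 1) (h₄ : x₄ * y₄ = 1)
    (hx : x₁ + x₂ + x₃ + x₄ = 1) (hy : y₁ + y₂ + y₃ + y₄ = 1)
    (he : x₁ * x₂ + x₁ * x₃ + x₁ * x₄ + x₂ * x₃ + x₂ * x₄ + x₃ * x₄ ≠ 0)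
    (e₁ : x₂ * m₂ + x₃ * m₃ + x₄ * m₄ = -x₁ ^ 2 * (y₂ * m₂ + y₃ * m₃ + y₄ * m₄))
    (e₂ : x₁ * m₁ + x₃ * m₃ - x₄ * m₄ = -x₂ ^ 2 * (y₁ * m₁ + y₃ * m₃ - y₄ * m₄))
    (e₃ : -x₁ * m₁ + x₂ * m₂ - x₄ * m₄ = -x₃ ^ 2 * (-y₁ * m₁ + y₂ * m₂ - y₄ * m₄))
    (e₄ : x₁ * m₁ + x₂ * m₂ - x₃ * m₃ = -x₄ ^ 2 * (y₁ * m₁ + y₂ * m₂ - y₃ * m₃)) :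
    m₁ = 0 ∧ m₂ = 0 ∧ m₃ = 0 ∧ m₄ = 0 := by
  set e := x₁ * x₂ + x₁ * x₃ + x₁ * x₄ + x₂ * x₃ + x₂ * x₄ + x₃ * x₄ with he_def
  -- The reciprocals also sum to one, so the third and fourth elementary symmetric polynomials
  -- agree.
  have h34 : x₁ * x₂ * x₃ + x₁ * x₂ * x₄ + x₁ * x₃ * x₄ + x₂ * x₃ * x₄ =
      x₁ * x₂ * x₃ * x₄ := by
    linear_combination x₁ * x₂ * x₃ * x₄ * hy - x₂ * x₃ * x₄ * h₁ - x₁ * x₃ * x₄ * h₂ -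
      x₁ * x₂ * x₄ * h₃ - x₁ * x₂ * x₃ * h₄
  -- The left side is twice the second elementary symmetric polynomial of the squares, i.e. `2 (e₂²
  -- - 2 e₁ e₃ + 2 e₄)`, with `e₁ = 1` and `e₃ = e₄`.
  have hp : (x₁ ^ 2 + x₂ ^ 2) * (x₃ ^ 2 + x₄ ^ 2) + (x₁ ^ 2 + x₃ ^ 2) * (x₂ ^ 2 + x₄ ^ 2) +
      (x₁ ^ 2 + x₄ ^ 2) * (x₂ ^ 2 + x₃ ^ 2) = 2 * e ^ 2 := by
    rw [he_def]
    linear_combination (-4) * (x₁ * x₂ * x₃ + x₁ * x₂ * x₄ + x₁ * x₃ * x₄ + x₂ * x₃ * x₄) * hx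
      - 4 * h34
  obtain ⟨n₁, rfl⟩ : ∃ n, m₁ = x₁ * n := ⟨y₁ * m₁, by linear_combination -m₁ * h₁⟩
  obtain ⟨n₂, rfl⟩ : ∃ n, m₂ = x₂ * n := ⟨y₂ * m₂, by linear_combination -m₂ * h₂⟩
  obtain ⟨n₃, rfl⟩ : ∃ n, m₃ = x₃ * n := ⟨y₃ * m₃, by linear_combination -m₃ * h₃⟩
  obtain ⟨n₄, rfl⟩ : ∃ n, m₄ = x₄ * n := ⟨y₄ * m₄, by linear_combination -m₄ * h₄⟩
  have f₁ : (x₁ ^ 2 + x₂ ^ 2) * n₂ + (x₁ ^ 2 + x₃ ^ 2) * n₃ + (x₁ ^ 2 + x₄ ^ 2) * n₄ = 0 := by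
    linear_combination e₁ - x₁ ^ 2 * (n₂ * h₂ + n₃ * h₃ + n₄ * h₄)
  have f₂ : (x₁ ^ 2 + x₂ ^ 2) * n₁ + (x₂ ^ 2 + x₃ ^ 2) * n₃ - (x₂ ^ 2 + x₄ ^ 2) * n₄ = 0 := by
    linear_combination e₂ - x₂ ^ 2 * (n₁ * h₁ + n₃ * h₃ - n₄ * h₄)
  have f₃ : -(x₁ ^ 2 + x₃ ^ 2) * n₁ + (x₂ ^ 2 + x₃ ^ 2) * n₂ - (x₃ ^ 2 + x₄ ^ 2) * n₄ = 0 := by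
    linear_combination e₃ - x₃ ^ 2 * (-n₁ * h₁ + n₂ * h₂ - n₄ * h₄)
  have f₄ : (x₁ ^ 2 + x₄ ^ 2) * n₁ + (x₂ ^ 2 + x₄ ^ 2) * n₂ - (x₃ ^ 2 + x₄ ^ 2) * n₃ = 0 := by
    linear_combination e₄ - x₄ ^ 2 * (n₁ * h₁ + n₂ * h₂ - n₃ * h₃)
  have hne : 2 * e ^ 2 ≠ 0 := by simpa using he
  have g₁ : n₁ = 0 := by
    refine (mul_eq_zero.1 ?_).resolve_left hne
    rw [← hp]
    linear_combination (x₃ ^ 2 + x₄ ^ 2) * f₂ - (x₂ ^ 2 + x₄ ^ 2) * f₃ + (x₂ ^ 2 + x₃ ^ 2) * f₄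
  have g₂ : n₂ = 0 := by
    refine (mul_eq_zero.1 ?_).resolve_left hne
    rw [← hp]
    linear_combination (x₃ ^ 2 + x₄ ^ 2) * f₁ + (x₁ ^ 2 + x₄ ^ 2) * f₃ + (x₁ ^ 2 + x₃ ^ 2) * f₄
  have g₃ : n₃ = 0 := by
    refine (mul_eq_zero.1 ?_).resolve_left hne
    rw [← hp]
    linear_combination (x₂ ^ 2 + x₄ ^ 2) * f₁ + (x₁ ^ 2 + x₄ ^ 2) * f₂ - (x₁ ^ 2 + x₂ ^ 2) * f₄
  have g₄ : n₄ = 0 := by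
    refine (mul_eq_zero.1 ?_).resolve_left hne
    rw [← hp]
    linear_combination (x₂ ^ 2 + x₃ ^ 2) * f₁ - (x₁ ^ 2 + x₃ ^ 2) * f₂ - (x₁ ^ 2 + x₂ ^ 2) * f₃
  simp [g₁, g₂, g₃, g₄]

/-- Each equation reduces to `(x - 1) (x + 1) (q - S) = 0`. If `S` differed from `q`, all four `x`
would be `-1`, and their sum could not be 1. -/
theorem even_system_trivial {q p₁ p₂ p₃ p₄ : ℂ}
    (h₁ : x₁ * y₁ = 1) (h₂ : x₂ * y₂ = 1) (h₃ : x₃ * y₃ = 1) (h₄ : x₄ * y₄ = 1)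
    (hx : x₁ + x₂ + x₃ + x₄ = 1)
    (n₁ : x₁ ≠ 1) (n₂ : x₂ ≠ 1) (n₃ : x₃ ≠ 1) (n₄ : x₄ ≠ 1)
    (e₀ : q + 2 * (x₁ * p₁ + x₂ * p₂ + x₃ * p₃ + x₄ * p₄) =
      1 * (q + 2 * (y₁ * p₁ + y₂ * p₂ + y₃ * p₃ + y₄ * p₄)))
    (e₁ : q + 3 * x₁ * p₁ - (x₁ * p₁ + x₂ * p₂ + x₃ * p₃ + x₄ * p₄) =
      x₁ ^ 2 * (q + 3 * y₁ * p₁ - (y₁ * p₁ + y₂ * p₂ + y₃ * p₃ + y₄ * p₄)))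
    (e₂ : q + 3 * x₂ * p₂ - (x₁ * p₁ + x₂ * p₂ + x₃ * p₃ + x₄ * p₄) =
      x₂ ^ 2 * (q + 3 * y₂ * p₂ - (y₁ * p₁ + y₂ * p₂ + y₃ * p₃ + y₄ * p₄)))
    (e₃ : q + 3 * x₃ * p₃ - (x₁ * p₁ + x₂ * p₂ + x₃ * p₃ + x₄ * p₄) =
      x₃ ^ 2 * (q + 3 * y₃ * p₃ - (y₁ * p₁ + y₂ * p₂ + y₃ * p₃ + y₄ * p₄)))
    (e₄ : q + 3 * x₄ * p₄ - (x₁ * p₁ + x₂ * p₂ + x₃ * p₃ + x₄ * p₄) =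
      x₄ ^ 2 * (q + 3 * y₄ * p₄ - (y₁ * p₁ + y₂ * p₂ + y₃ * p₃ + y₄ * p₄))) :
    x₁ * p₁ + x₂ * p₂ + x₃ * p₃ + x₄ * p₄ = q := by
  set S := x₁ * p₁ + x₂ * p₂ + x₃ * p₃ + x₄ * p₄
  set S' := y₁ * p₁ + y₂ * p₂ + y₃ * p₃ + y₄ * p₄
  have hS : S' = S := by linear_combination (-1 / 2 : ℂ) * e₀
  rw [hS] at e₁ e₂ e₃ e₄
  by_contra hne
  have hne' : q - S ≠ 0 := fun h => hne (by linear_combination -h)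
  have aux : ∀ {x y p : ℂ}, x * y = 1 → x ≠ 1 →
      q + 3 * x * p - S = x ^ 2 * (q + 3 * y * p - S) → x = -1 := by
    intro x y p hxy hx1 e
    have h := mul_eq_zero.1 (show (x - 1) * ((x + 1) * (q - S)) = 0 by
      linear_combination -e - 3 * x * p * hxy)
    have h := h.resolve_left (sub_ne_zero.2 hx1)
    have h := (mul_eq_zero.1 h).resolve_right hne'
    linear_combination h
  rw [aux h₁ n₁ e₁, aux h₂ n₂ e₂, aux h₃ n₃ e₃, aux h₄ n₄ e₄] at hx
  norm_num at hx

/-- All unknowns are governed by the single quantity `Y`; eliminating them leaves `Y` times a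
determinant, which factors as `s` times the expression in `hN`. -/
theorem even_system {p₁ p₂ p₃ p₄ : ℂ}
    (h₁ : x₁ * y₁ = 1) (h₂ : x₂ * y₂ = 1) (h₃ : x₃ * y₃ = 1) (h₄ : x₄ * y₄ = 1)
    (hx : x₁ + x₂ + x₃ + x₄ = 1) (hy : y₁ + y₂ + y₃ + y₄ = 1) (n₁ : x₁ ≠ 1)
    (hN : (x₂ * x₃ + x₂ * x₄ + x₃ * x₄) ^ 2 - (x₁ * (1 - x₁)) ^ 2 +
      3 * x₁ * (1 + x₁) * (x₂ * x₃ + x₂ * x₄ + x₃ * x₄) ≠ 0)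
    (e₀ : 2 * (x₁ * p₁ + x₂ * p₂ + x₃ * p₃ + x₄ * p₄) =
      x₁ ^ 2 * (2 * (y₁ * p₁ + y₂ * p₂ + y₃ * p₃ + y₄ * p₄)))
    (e₁ : 3 * x₁ * p₁ - (x₁ * p₁ + x₂ * p₂ + x₃ * p₃ + x₄ * p₄) =
      x₁ * (3 * y₁ * p₁ - (y₁ * p₁ + y₂ * p₂ + y₃ * p₃ + y₄ * p₄)))
    (e₂ : 3 * x₂ * p₂ - (x₁ * p₁ + x₂ * p₂ + x₃ * p₃ + x₄ * p₄) =
      x₃ * x₄ * (3 * y₂ * p₂ - (y₁ * p₁ + y₂ * p₂ + y₃ * p₃ + y₄ * p₄)))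
    (e₃ : 3 * x₃ * p₃ - (x₁ * p₁ + x₂ * p₂ + x₃ * p₃ + x₄ * p₄) =
      x₂ * x₄ * (3 * y₃ * p₃ - (y₁ * p₁ + y₂ * p₂ + y₃ * p₃ + y₄ * p₄)))
    (e₄ : 3 * x₄ * p₄ - (x₁ * p₁ + x₂ * p₂ + x₃ * p₃ + x₄ * p₄) =
      x₂ * x₃ * (3 * y₄ * p₄ - (y₁ * p₁ + y₂ * p₂ + y₃ * p₃ + y₄ * p₄))) :
    p₁ = 0 ∧ p₂ = 0 ∧ p₃ = 0 ∧ p₄ = 0 := by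
  obtain ⟨u₂, rfl⟩ : ∃ n, p₂ = x₂ * n := ⟨y₂ * p₂, by linear_combination -p₂ * h₂⟩
  obtain ⟨u₃, rfl⟩ : ∃ n, p₃ = x₃ * n := ⟨y₃ * p₃, by linear_combination -p₃ * h₃⟩
  obtain ⟨u₄, rfl⟩ : ∃ n, p₄ = x₄ * n := ⟨y₄ * p₄, by linear_combination -p₄ * h₄⟩
  set S := x₁ * p₁ + x₂ * (x₂ * u₂) + x₃ * (x₃ * u₃) + x₄ * (x₄ * u₄)
  set Y := y₁ * p₁ + y₂ * (x₂ * u₂) + y₃ * (x₃ * u₃) + y₄ * (x₄ * u₄) with hY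
  have n₁' : x₁ - 1 ≠ 0 := sub_ne_zero.2 n₁
  have hS : S = x₁ ^ 2 * Y := by linear_combination e₀ / 2
  rw [hS] at e₁ e₂ e₃ e₄
  have g₁ : 3 * p₁ = x₁ * Y := by
    have : (x₁ - 1) * (3 * p₁ - x₁ * Y) = 0 := by linear_combination e₁ + 3 * p₁ * h₁
    linear_combination (mul_eq_zero.1 this).resolve_left n₁'
  have g₂ : 3 * (x₂ ^ 2 - x₃ * x₄) * u₂ = (x₁ ^ 2 - x₃ * x₄) * Y := by
    linear_combination e₂ + 3 * x₃ * x₄ * u₂ * h₂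
  have g₃ : 3 * (x₃ ^ 2 - x₂ * x₄) * u₃ = (x₁ ^ 2 - x₂ * x₄) * Y := by
    linear_combination e₃ + 3 * x₂ * x₄ * u₃ * h₃
  have g₄ : 3 * (x₄ ^ 2 - x₂ * x₃) * u₄ = (x₁ ^ 2 - x₂ * x₃) * Y := by
    linear_combination e₄ + 3 * x₂ * x₃ * u₄ * h₄
  have g : 2 * Y = 3 * (u₂ + u₃ + u₄) := by
    linear_combination (-3) * hY + y₁ * g₁ + Y * h₁ + 3 * u₂ * h₂ + 3 * u₃ * h₃ + 3 * u₄ * h₄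
  set A₂ := x₂ ^ 2 - x₃ * x₄ with hA₂
  set A₃ := x₃ ^ 2 - x₂ * x₄ with hA₃
  set A₄ := x₄ ^ 2 - x₂ * x₃ with hA₄
  set s := x₂ * x₃ + x₂ * x₄ + x₃ * x₄ with hs
  have h34 : x₁ * s = (x₁ - 1) * (x₂ * x₃ * x₄) := by
    linear_combination x₁ * x₂ * x₃ * x₄ * hy - x₂ * x₃ * x₄ * h₁ - x₁ * x₃ * x₄ * h₂ -
      x₁ * x₂ * x₄ * h₃ - x₁ * x₂ * x₃ * h₄
  -- By `h34`, vanishing of `s` would force `x₁ = 1` or a zero coordinate.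
  have hs0 : s ≠ 0 := by
    intro h0
    rw [h0, mul_zero] at h34
    have h5 := (mul_eq_zero.1 h34.symm).resolve_left n₁'
    have : (1 : ℂ) = 0 := by
      linear_combination y₂ * y₃ * y₄ * h5 - x₃ * y₃ * x₄ * y₄ * h₂ - x₄ * y₄ * h₃ - h₄
    exact one_ne_zero this
  have hNs : (x₁ ^ 2 - x₃ * x₄) * A₃ * A₄ + (x₁ ^ 2 - x₂ * x₄) * A₂ * A₄ +
      (x₁ ^ 2 - x₂ * x₃) * A₂ * A₃ - 2 * A₂ * A₃ * A₄ =
      s * (s ^ 2 - (x₁ * (1 - x₁)) ^ 2 + 3 * x₁ * (1 + x₁) * s) := by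
    rw [hA₂, hA₃, hA₄]
    linear_combination s * (-x₁ ^ 2 * (1 - x₁ + (x₂ + x₃ + x₄)) - 3 * (x₂ * x₃ * x₄)) * hx -
      3 * s * h34
  have hN' : (x₁ ^ 2 - x₃ * x₄) * A₃ * A₄ + (x₁ ^ 2 - x₂ * x₄) * A₂ * A₄ +
      (x₁ ^ 2 - x₂ * x₃) * A₂ * A₃ - 2 * A₂ * A₃ * A₄ ≠ 0 := by
    rw [hNs]; exact mul_ne_zero hs0 hN
  have hY0 : Y = 0 := by
    refine (mul_eq_zero.1 ?_).resolve_left hN'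
    linear_combination -A₃ * A₄ * g₂ - A₂ * A₄ * g₃ - A₂ * A₃ * g₄ - A₂ * A₃ * A₄ * g
  rw [hY0] at g₁ g₂ g₃ g₄ g
  have hp₁ : p₁ = 0 := by linear_combination g₁ / 3
  have k₂ : A₂ = 0 ∨ u₂ = 0 := by simpa using g₂
  have k₃ : A₃ = 0 ∨ u₃ = 0 := by simpa using g₃
  have k₄ : A₄ = 0 ∨ u₄ = 0 := by simpa using g₄
  have hu : u₂ + u₃ + u₄ = 0 := by linear_combination -g / 3
  -- Every term of the determinant contains two of the `A`s, so at most one of them vanishes. Hence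
  -- at most one `u` could be nonzero, and `hu` excludes that too.
  have hfin : u₂ = 0 ∧ u₃ = 0 ∧ u₄ = 0 := by
    rcases k₂ with k₂ | k₂ <;> rcases k₃ with k₃ | k₃ <;> rcases k₄ with k₄ | k₄ <;>
      first
      | (exfalso; apply hN'; simp [k₂, k₃]; done)
      | (exfalso; apply hN'; simp [k₂, k₄]; done)
      | (exfalso; apply hN'; simp [k₃, k₄]; done)
      | (simp [k₂, k₃, k₄]; done)
      | simpa [k₂, k₃, k₄] using hu
  simp [hp₁, hfin]

/-- The three differences add up to zero; clearing the pair sums in front of them leaves `m` times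
the determinant in `hD`. Only the common value of the `pᵢ` stays free. -/
theorem odd_system {m p₂ p₃ p₄ : ℂ}
    (h₁ : x₁ * y₁ = 1) (hx : x₁ + x₂ + x₃ + x₄ = 1) (hy : y₁ + y₂ + y₃ + y₄ = 1)
    (h₂ : x₂ * y₂ = 1) (h₃ : x₃ * y₃ = 1) (h₄ : x₄ * y₄ = 1)
    (hD : (x₁ * (1 - x₁)) ^ 2 - x₁ * (1 - x₁) * (x₂ * x₃ + x₂ * x₄ + x₃ * x₄) +
      (x₂ * x₃ + x₂ * x₄ + x₃ * x₄) ^ 2 ≠ 0)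
    (e₂ : (x₃ + x₄) * (p₄ - p₃) = m * (x₁ + x₃ * x₄ * y₁))
    (e₃ : (x₂ + x₄) * (p₂ - p₄) = m * (x₁ + x₂ * x₄ * y₁))
    (e₄ : (x₂ + x₃) * (p₃ - p₂) = m * (x₁ + x₂ * x₃ * y₁)) :
    m = 0 ∧ p₃ = p₂ ∧ p₄ = p₂ := by
  obtain ⟨m, rfl⟩ : ∃ n, m = x₁ * n := ⟨y₁ * m, by linear_combination -m * h₁⟩
  have f₂ : (x₃ + x₄) * (p₄ - p₃) = m * (x₁ ^ 2 + x₃ * x₄) := by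
    linear_combination e₂ + m * x₃ * x₄ * h₁
  have f₃ : (x₂ + x₄) * (p₂ - p₄) = m * (x₁ ^ 2 + x₂ * x₄) := by
    linear_combination e₃ + m * x₂ * x₄ * h₁
  have f₄ : (x₂ + x₃) * (p₃ - p₂) = m * (x₁ ^ 2 + x₂ * x₃) := by
    linear_combination e₄ + m * x₂ * x₃ * h₁
  have h34 : x₁ * (x₂ * x₃ + x₂ * x₄ + x₃ * x₄) = (x₁ - 1) * (x₂ * x₃ * x₄) := by
    linear_combination x₁ * x₂ * x₃ * x₄ * hy - x₂ * x₃ * x₄ * h₁ - x₁ * x₃ * x₄ * h₂ -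
      x₁ * x₂ * x₄ * h₃ - x₁ * x₂ * x₃ * h₄
  have hD' : (x₁ ^ 2 + x₃ * x₄) * (x₂ + x₃) * (x₂ + x₄) +
      (x₁ ^ 2 + x₂ * x₄) * (x₂ + x₃) * (x₃ + x₄) +
      (x₁ ^ 2 + x₂ * x₃) * (x₂ + x₄) * (x₃ + x₄) ≠ 0 := by
    convert hD using 1
    linear_combination (x₁ ^ 2 * (1 - x₁ + (x₂ + x₃ + x₄)) + x₂ * x₃ * x₄) * hx + h34
  have hm : m = 0 := by
    refine (mul_eq_zero.1 ?_).resolve_left hD'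
    linear_combination -(x₂ + x₃) * (x₂ + x₄) * f₂ - (x₂ + x₃) * (x₃ + x₄) * f₃ -
      (x₂ + x₄) * (x₃ + x₄) * f₄
  subst hm
  -- Two vanishing pair sums would annihilate the determinant, so at least two of the differences
  -- are zero.
  rw [zero_mul, mul_eq_zero] at f₂ f₃ f₄
  refine ⟨by simp, ?_⟩
  rcases f₂ with f₂ | f₂ <;> rcases f₃ with f₃ | f₃ <;> rcases f₄ with f₄ | f₄
  all_goals first
    | (exfalso; apply hD'; simp [f₂, f₃]; done)
    | (exfalso; apply hD'; simp [f₂, f₄]; done)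
    | (exfalso; apply hD'; simp [f₃, f₄]; done)
    | exact ⟨by linear_combination f₄, by linear_combination -f₃⟩
    | exact ⟨by linear_combination -f₂ - f₃, by linear_combination -f₃⟩
    | exact ⟨by linear_combination f₄, by linear_combination f₂ + f₄⟩

end Algebra

/-! ### The matrices as circulants on (ℤ/3)², and their equations line by line -/

section BlockCirculant

/-- The function on `(ℤ / 3)²` whose circulant matrix is `bcMatrix`: it is `1` at the origin and
constant on the four punctured lines through the origin. -/
def bcFun (v : Fin 4 → ℂ) (g : Plane) : ℂ :=
  (![![1, v 0, v 0], ![v 1, v 2, v 3], ![v 1, v 3, v 2]] : Fin 3 → Fin 3 → ℂ) g.1 g.2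

/-- One third of the Fourier transform of `bcFun v`. -/
def bcDual (v : Fin 4 → ℂ) (g : Plane) : ℂ :=
  (![![1, v 1, v 1], ![v 0, v 3, v 2], ![v 0, v 2, v 3]] : Fin 3 → Fin 3 → ℂ) g.1 g.2

/-- Representatives of the lines through the origin. -/
def lineRep : Fin 4 → Plane := ![(0, 1), (1, 0), (1, 1), (1, 2)]

/-- Representatives of the lines of characters, orthogonal to `lineRep`. -/
def dualRep : Fin 4 → Plane := ![(1, 0), (0, 1), (1, 2), (1, 1)]

/-- The row `3 a + i` corresponds to `(a, i)`. -/
def planeEquiv : Fin 9 ≃ Plane := (finProdFinEquiv (m := 3) (n := 3)).symm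

theorem bcMatrix_apply (v : Fin 4 → ℂ) (k j : Fin 9) :
    bcMatrix (v 0) (v 1) (v 2) (v 3) k j = bcFun v (planeEquiv k - planeEquiv j) := by
  fin_cases k <;> fin_cases j <;> rfl

theorem forall_plane {p : Plane → Prop} (h00 : p (0, 0)) (h01 : p (0, 1)) (h02 : p (0, 2))
    (h10 : p (1, 0)) (h11 : p (1, 1)) (h12 : p (1, 2)) (h20 : p (2, 0)) (h21 : p (2, 1))
    (h22 : p (2, 2)) (g : Plane) : p g := by
  obtain ⟨a, b⟩ := g
  fin_cases a <;> fin_cases b <;> assumption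

theorem star_bcFun (v : Fin 4 → ℂ) (g : Plane) :
    star (bcFun v g) = bcFun (fun l => star (v l)) g := by
  revert g
  refine forall_plane ?_ ?_ ?_ ?_ ?_ ?_ ?_ ?_ ?_
  · exact star_one ℂ
  all_goals rfl

theorem bcDual_neg (v : Fin 4 → ℂ) (g : Plane) : bcDual v (-g) = bcDual v g := by
  revert g
  refine forall_plane ?_ ?_ ?_ ?_ ?_ ?_ ?_ ?_ ?_ <;> rfl

theorem norm_bcFun {v : Fin 4 → ℂ} (hv : ∀ l, ‖v l‖ = 1) (g : Plane) : ‖bcFun v g‖ = 1 := by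
  revert g
  refine forall_plane ?_ ?_ ?_ ?_ ?_ ?_ ?_ ?_ ?_
  · exact norm_one
  all_goals exact hv _

theorem norm_bcDual {v : Fin 4 → ℂ} (hv : ∀ l, ‖v l‖ = 1) (g : Plane) : ‖bcDual v g‖ = 1 := by
  revert g
  refine forall_plane ?_ ?_ ?_ ?_ ?_ ?_ ?_ ?_ ?_
  · exact norm_one
  all_goals exact hv _

theorem sum_plane (h : Plane → ℂ) : ∑ g, h g = h (0, 0) + h (0, 1) + h (0, 2) +
    (h (1, 0) + h (1, 1) + h (1, 2)) + (h (2, 0) + h (2, 1) + h (2, 2)) := by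
  rw [Fintype.sum_prod_type, sum_zmod_three, sum_zmod_three, sum_zmod_three, sum_zmod_three]

theorem zmod_three_arith : (2 : ZMod 3) * 2 = 1 ∧ (1 : ZMod 3) + 1 = 2 ∧ (1 : ZMod 3) + 2 = 0 ∧
    (2 : ZMod 3) + 1 = 0 ∧ (2 : ZMod 3) + 2 = 1 ∧ (-1 : ZMod 3) = 2 ∧ (-2 : ZMod 3) = 1 :=
  ⟨rfl, rfl, rfl, rfl, rfl, rfl, rfl⟩

theorem chr_sum (a : Plane) (h : Plane → ℂ) : ∑ g, chr a g * h g =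
    h (0, 0) + cubeChar a.2 * h (0, 1) + cubeChar (a.2 * 2) * h (0, 2) +
    (cubeChar a.1 * h (1, 0) + cubeChar (a.1 + a.2) * h (1, 1) +
      cubeChar (a.1 + a.2 * 2) * h (1, 2)) +
    (cubeChar (a.1 * 2) * h (2, 0) + cubeChar (a.1 * 2 + a.2) * h (2, 1) +
      cubeChar (a.1 * 2 + a.2 * 2) * h (2, 2)) := by
  rw [sum_plane]
  simp only [chr, mul_zero, mul_one, zero_add, add_zero, cubeChar_zero, one_mul]

/-- A nonzero character is trivial on one line `l` and sums to `-1` on every other punctured line,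
so the transform is `1 + 3 v l - ∑ v = 3 v l`. -/
theorem chr_sum_bcFun {v : Fin 4 → ℂ} (hs : v 0 + v 1 + v 2 + v 3 = 1) (φ : Plane) :
    ∑ g, chr φ g * bcFun v g = 3 * bcDual v φ := by
  obtain ⟨z1, z2, z3, z4, z5, z6, z7⟩ := zmod_three_arith
  have h := omega_sum
  revert φ
  refine forall_plane ?_ ?_ ?_ ?_ ?_ ?_ ?_ ?_ ?_ <;> rw [chr_sum] <;>
    simp only [z1, z2, z3, z4, z5, zero_mul, zero_add, add_zero, one_mul,
      cubeChar_zero, cubeChar_one, cubeChar_two, bcFun, bcDual]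
  · change 1 + v 0 + v 0 + (v 1 + v 2 + v 3) + (v 1 + v 3 + v 2) = 3 * 1
    linear_combination 2 * hs
  · change 1 + omega * v 0 + omega ^ 2 * v 0 + (v 1 + omega * v 2 + omega ^ 2 * v 3) +
      (v 1 + omega * v 3 + omega ^ 2 * v 2) = 3 * v 1
    linear_combination (v 0 + v 2 + v 3) * h - hs
  · change 1 + omega ^ 2 * v 0 + omega * v 0 + (v 1 + omega ^ 2 * v 2 + omega * v 3) +
      (v 1 + omega ^ 2 * v 3 + omega * v 2) = 3 * v 1
    linear_combination (v 0 + v 2 + v 3) * h - hs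
  · change 1 + v 0 + v 0 + (omega * v 1 + omega * v 2 + omega * v 3) +
      (omega ^ 2 * v 1 + omega ^ 2 * v 3 + omega ^ 2 * v 2) = 3 * v 0
    linear_combination (v 1 + v 2 + v 3) * h - hs
  · change 1 + omega * v 0 + omega ^ 2 * v 0 + (omega * v 1 + omega ^ 2 * v 2 + v 3) +
      (omega ^ 2 * v 1 + v 3 + omega * v 2) = 3 * v 3
    linear_combination (v 0 + v 1 + v 2) * h - hs
  · change 1 + omega ^ 2 * v 0 + omega * v 0 + (omega * v 1 + v 2 + omega ^ 2 * v 3) +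
      (omega ^ 2 * v 1 + omega * v 3 + v 2) = 3 * v 2
    linear_combination (v 0 + v 1 + v 3) * h - hs
  · change 1 + v 0 + v 0 + (omega ^ 2 * v 1 + omega ^ 2 * v 2 + omega ^ 2 * v 3) +
      (omega * v 1 + omega * v 3 + omega * v 2) = 3 * v 0
    linear_combination (v 1 + v 2 + v 3) * h - hs
  · change 1 + omega * v 0 + omega ^ 2 * v 0 + (omega ^ 2 * v 1 + v 2 + omega * v 3) +
      (omega * v 1 + omega ^ 2 * v 3 + v 2) = 3 * v 2
    linear_combination (v 0 + v 1 + v 3) * h - hs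
  · change 1 + omega ^ 2 * v 0 + omega * v 0 + (omega ^ 2 * v 1 + omega * v 2 + v 3) +
      (omega * v 1 + v 3 + omega ^ 2 * v 2) = 3 * v 3
    linear_combination (v 0 + v 1 + v 2) * h - hs

/-- The even part of `q` on a line. -/
def evenPart (q : Plane → ℂ) (l : Fin 4) : ℂ := q (lineRep l) + q (-lineRep l)

/-- The odd part of `q` on a line. -/
def oddPart (q : Plane → ℂ) (l : Fin 4) : ℂ := q (lineRep l) - q (-lineRep l)

theorem evenPart_eq (q : Plane → ℂ) : evenPart q 0 = q (0, 1) + q (0, 2) ∧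
    evenPart q 1 = q (1, 0) + q (2, 0) ∧ evenPart q 2 = q (1, 1) + q (2, 2) ∧
    evenPart q 3 = q (1, 2) + q (2, 1) := ⟨rfl, rfl, rfl, rfl⟩

theorem oddPart_eq (q : Plane → ℂ) : oddPart q 0 = q (0, 1) - q (0, 2) ∧
    oddPart q 1 = q (1, 0) - q (2, 0) ∧ oddPart q 2 = q (1, 1) - q (2, 2) ∧
    oddPart q 3 = q (1, 2) - q (2, 1) := ⟨rfl, rfl, rfl, rfl⟩

theorem bcFun_values (v : Fin 4 → ℂ) : bcFun v (0, 0) = 1 ∧ bcFun v (0, 1) = v 0 ∧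
    bcFun v (0, 2) = v 0 ∧ bcFun v (1, 0) = v 1 ∧ bcFun v (1, 1) = v 2 ∧ bcFun v (1, 2) = v 3 ∧
    bcFun v (2, 0) = v 1 ∧ bcFun v (2, 1) = v 3 ∧ bcFun v (2, 2) = v 2 :=
  ⟨rfl, rfl, rfl, rfl, rfl, rfl, rfl, rfl, rfl⟩

theorem chr_even_sum_zero (v : Fin 4 → ℂ) (q : Plane → ℂ) :
    ∑ g, (chr 0 g + chr (-0) g) * bcFun v g * q g = 2 * q 0 + 2 * (v 0 * evenPart q 0 +
      v 1 * evenPart q 1 + v 2 * evenPart q 2 + v 3 * evenPart q 3) := by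
  obtain ⟨p0, p1, p2, p3⟩ := evenPart_eq q
  obtain ⟨b1, b2, b3, b4, b5, b6, b7, b8, b9⟩ := bcFun_values v
  simp only [add_mul, mul_assoc, Finset.sum_add_distrib, chr_sum, neg_zero, Prod.fst_zero,
    Prod.snd_zero, zero_mul, add_zero, cubeChar_zero, p0, p1, p2, p3,
    b1, b2, b3, b4, b5, b6, b7, b8, b9]
  change _ = 2 * q (0, 0) + _
  ring

/-- The symmetrised character is `2` on line `l` and `ω + ω² = -1` on the other three punctured
lines; `3 v l` compensates for including `l` in the subtracted sum. -/
theorem chr_even_sum (v : Fin 4 → ℂ) (q : Plane → ℂ) (l : Fin 4) :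
    ∑ g, (chr (dualRep l) g + chr (-dualRep l) g) * bcFun v g * q g =
      2 * q 0 + 3 * v l * evenPart q l - (v 0 * evenPart q 0 +
      v 1 * evenPart q 1 + v 2 * evenPart q 2 + v 3 * evenPart q 3) := by
  obtain ⟨p0, p1, p2, p3⟩ := evenPart_eq q
  obtain ⟨b1, b2, b3, b4, b5, b6, b7, b8, b9⟩ := bcFun_values v
  obtain ⟨z1, z2, z3, z4, z5, z6, z7⟩ := zmod_three_arith
  have h := omega_sum
  simp only [add_mul, mul_assoc, Finset.sum_add_distrib, chr_sum, Prod.fst_neg, Prod.snd_neg,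
    b1, b2, b3, b4, b5, b6, b7, b8, b9]
  change _ = 2 * q (0, 0) + _ - _
  fin_cases l
  all_goals simp only [dualRep, Fin.zero_eta, Fin.mk_one, Fin.reduceFinMk, Matrix.cons_val,
    z1, z2, z3, z4, z5, z6, z7, neg_zero, zero_mul, zero_add, add_zero, one_mul,
      cubeChar_zero, cubeChar_one, cubeChar_two, p0, p1, p2, p3]
  · linear_combination (v 1 * (q (1, 0) + q (2, 0)) + v 2 * (q (1, 1) + q (2, 2)) +
      v 3 * (q (1, 2) + q (2, 1))) * h
  · linear_combination (v 0 * (q (0, 1) + q (0, 2)) + v 2 * (q (1, 1) + q (2, 2)) +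
      v 3 * (q (1, 2) + q (2, 1))) * h
  · linear_combination (v 0 * (q (0, 1) + q (0, 2)) + v 1 * (q (1, 0) + q (2, 0)) +
      v 3 * (q (1, 2) + q (2, 1))) * h
  · linear_combination (v 0 * (q (0, 1) + q (0, 2)) + v 1 * (q (1, 0) + q (2, 0)) +
      v 2 * (q (1, 1) + q (2, 2))) * h

/-- The sign matrix of the symplectic form on the four lines. -/
def oddForm (v m : Fin 4 → ℂ) : Fin 4 → ℂ :=
  ![v 1 * m 1 + v 2 * m 2 + v 3 * m 3, v 0 * m 0 + v 2 * m 2 - v 3 * m 3,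
    -v 0 * m 0 + v 1 * m 1 - v 3 * m 3, v 0 * m 0 + v 1 * m 1 - v 2 * m 2]

theorem chr_odd_sum (v : Fin 4 → ℂ) (q : Plane → ℂ) (l : Fin 4) :
    ∑ g, (chr (dualRep l) g - chr (-dualRep l) g) * bcFun v g * q g =
      (omega - omega ^ 2) * oddForm v (oddPart q) l := by
  obtain ⟨p0, p1, p2, p3⟩ := oddPart_eq q
  obtain ⟨b1, b2, b3, b4, b5, b6, b7, b8, b9⟩ := bcFun_values v
  obtain ⟨z1, z2, z3, z4, z5, z6, z7⟩ := zmod_three_arith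
  simp only [sub_mul, mul_assoc, Finset.sum_sub_distrib, chr_sum, Prod.fst_neg, Prod.snd_neg,
    b1, b2, b3, b4, b5, b6, b7, b8, b9]
  fin_cases l
  all_goals
    simp only [dualRep, oddForm, Fin.zero_eta, Fin.mk_one, Fin.reduceFinMk, Matrix.cons_val,
      z1, z2, z3, z4, z5, z6, z7, neg_zero, zero_mul, zero_add, add_zero, one_mul,
      cubeChar_zero, cubeChar_one, cubeChar_two, p0, p1, p2, p3]
    ring

theorem bc_relations {v : Fin 4 → ℂ} {R : Plane → Plane → ℝ} (hv : ∀ l, ‖v l‖ = 1)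
    (hs : v 0 + v 1 + v 2 + v 3 = 1)
    (hR : ∀ i j, ∑ k, star (bcFun v (k - i)) * bcFun v (k - j) * ((R k j - R k i : ℝ) : ℂ) = 0)
    (η : Plane) {q : Plane → ℂ} (hq : phaseFourier R η = q) {p m : Fin 4 → ℂ}
    (hp : evenPart q = p) (hm : oddPart q = m) {y : Fin 4 → ℂ} (hy : (fun l => star (v l)) = y) :
    (2 * q 0 + 2 * (v 0 * p 0 + v 1 * p 1 + v 2 * p 2 + v 3 * p 3) =
      bcDual v (0 + η) * bcDual v (0 - η) *
        (2 * q 0 + 2 * (y 0 * p 0 + y 1 * p 1 + y 2 * p 2 + y 3 * p 3))) ∧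
    (∀ l, 2 * q 0 + 3 * v l * p l - (v 0 * p 0 + v 1 * p 1 + v 2 * p 2 + v 3 * p 3) =
      bcDual v (dualRep l + η) * bcDual v (dualRep l - η) * (2 * q 0 + 3 * y l * p l -
        (y 0 * p 0 + y 1 * p 1 + y 2 * p 2 + y 3 * p 3))) ∧
    (∀ l, oddForm v m l = -(bcDual v (dualRep l + η) * bcDual v (dualRep l - η)) *
      oddForm y m l) := by
  have h := fun θ => phaseFourier_even_odd hR (chr_sum_bcFun hs) (bcDual_neg v) (norm_bcDual hv) θ η
  simp only [star_bcFun] at h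
  subst hq hp hm hy
  refine ⟨?_, fun l => ?_, fun l => ?_⟩
  · have := (h 0).1
    rwa [chr_even_sum_zero, chr_even_sum_zero] at this
  · have := (h (dualRep l)).1
    rwa [chr_even_sum, chr_even_sum] at this
  · have := (h (dualRep l)).2
    rw [chr_odd_sum, chr_odd_sum] at this
    refine mul_left_cancel₀ omega_sub_sq_ne_zero ?_
    linear_combination this

end BlockCirculant

/-! ### Vanishing of the nontrivial Fourier components at generic points -/

section Bound

/-- The second elementary symmetric polynomial of four numbers. -/
def esymmTwo (v : Fin 4 → ℂ) : ℂ :=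
  v 0 * v 1 + v 0 * v 2 + v 0 * v 3 + v 1 * v 2 + v 1 * v 3 + v 2 * v 3

/-- The condition, on a coordinate `x` and the second elementary symmetric polynomial `x (1 - x) + b`
of a point with `x + y + u + w = 1`, that makes the nontrivial Fourier components of a first order
deformation of `bcMatrix` trivial. -/
def GenericCoord (x b : ℂ) : Prop :=
  (x * (1 - x)) ^ 2 - x * (1 - x) * b + b ^ 2 ≠ 0 ∧
    b ^ 2 - (x * (1 - x)) ^ 2 + 3 * x * (1 + x) * b ≠ 0

/-- A sufficient condition for `bcMatrix` to have defect two. -/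
def GenericPoint (v : Fin 4 → ℂ) : Prop :=
  esymmTwo v ≠ 0 ∧ ∀ l, v l ≠ 1 ∧ GenericCoord (v l) (esymmTwo v - v l * (1 - v l))

/-- The hypothesis on `m₂` fixes the one free parameter that `odd_system` leaves; `x₁` is the
distinguished coordinate, belonging to the line on which the character is trivial. -/
theorem line_systems {x₁ x₂ x₃ x₄ y₁ y₂ y₃ y₄ : ℂ}
    (h₁ : x₁ * y₁ = 1) (h₂ : x₂ * y₂ = 1) (h₃ : x₃ * y₃ = 1) (h₄ : x₄ * y₄ = 1)
    (hx : x₁ + x₂ + x₃ + x₄ = 1) (hy : y₁ + y₂ + y₃ + y₄ = 1) (n₁ : x₁ ≠ 1) {e : ℂ}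
    (he : e - x₁ * (1 - x₁) = x₂ * x₃ + x₂ * x₄ + x₃ * x₄)
    (hg : GenericCoord x₁ (e - x₁ * (1 - x₁))) {p₁ p₂ p₃ p₄ : ℂ}
    (e₀ : 2 * (x₁ * p₁ + x₂ * p₂ + x₃ * p₃ + x₄ * p₄) =
      x₁ ^ 2 * (2 * (y₁ * p₁ + y₂ * p₂ + y₃ * p₃ + y₄ * p₄)))
    (e₁ : 3 * x₁ * p₁ - (x₁ * p₁ + x₂ * p₂ + x₃ * p₃ + x₄ * p₄) =
      x₁ * (3 * y₁ * p₁ - (y₁ * p₁ + y₂ * p₂ + y₃ * p₃ + y₄ * p₄)))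
    (e₂ : 3 * x₂ * p₂ - (x₁ * p₁ + x₂ * p₂ + x₃ * p₃ + x₄ * p₄) =
      x₃ * x₄ * (3 * y₂ * p₂ - (y₁ * p₁ + y₂ * p₂ + y₃ * p₃ + y₄ * p₄)))
    (e₃ : 3 * x₃ * p₃ - (x₁ * p₁ + x₂ * p₂ + x₃ * p₃ + x₄ * p₄) =
      x₂ * x₄ * (3 * y₃ * p₃ - (y₁ * p₁ + y₂ * p₂ + y₃ * p₃ + y₄ * p₄)))
    (e₄ : 3 * x₄ * p₄ - (x₁ * p₁ + x₂ * p₂ + x₃ * p₃ + x₄ * p₄) =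
      x₂ * x₃ * (3 * y₄ * p₄ - (y₁ * p₁ + y₂ * p₂ + y₃ * p₃ + y₄ * p₄)))
    {m m₂ m₃ m₄ : ℂ} (hm : m₂ = 0)
    (f₂ : (x₃ + x₄) * (m₄ - m₃) = m * (x₁ + x₃ * x₄ * y₁))
    (f₃ : (x₂ + x₄) * (m₂ - m₄) = m * (x₁ + x₂ * x₄ * y₁))
    (f₄ : (x₂ + x₃) * (m₃ - m₂) = m * (x₁ + x₂ * x₃ * y₁)) :
    (p₁ = 0 ∧ p₂ = 0 ∧ p₃ = 0 ∧ p₄ = 0) ∧ (m = 0 ∧ m₃ = 0 ∧ m₄ = 0) := by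
  rw [he] at hg
  refine ⟨even_system h₁ h₂ h₃ h₄ hx hy n₁ hg.2 e₀ e₁ e₂ e₃ e₄, ?_⟩
  have := odd_system h₁ hx hy h₂ h₃ h₄ hg.1 f₂ f₃ f₄
  rwa [hm] at this

/-- The line whose odd part is used as a coordinate in the component of `dualRep l`. -/
def oddLine : Fin 4 → Fin 4 := ![1, 0, 0, 0]

variable {v : Fin 4 → ℂ} {R : Plane → Plane → ℝ}

theorem oddForm_values (v m : Fin 4 → ℂ) :
    oddForm v m 0 = v 1 * m 1 + v 2 * m 2 + v 3 * m 3 ∧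
    oddForm v m 1 = v 0 * m 0 + v 2 * m 2 - v 3 * m 3 ∧
    oddForm v m 2 = -v 0 * m 0 + v 1 * m 1 - v 3 * m 3 ∧
    oddForm v m 3 = v 0 * m 0 + v 1 * m 1 - v 2 * m 2 := ⟨rfl, rfl, rfl, rfl⟩

/-- A component at a nonzero character is determined by two complex numbers, its value at the origin
and one odd coordinate; the four cases differ by relabelling and signs. -/
theorem phaseFourier_dualRep_eq_zero (hv : ∀ l, ‖v l‖ = 1)
    (hs : v 0 + v 1 + v 2 + v 3 = 1) (hg : GenericPoint v)
    (hR : ∀ i j, ∑ k, star (bcFun v (k - i)) * bcFun v (k - j) * ((R k j - R k i : ℝ) : ℂ) = 0)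
    (l : Fin 4) (h0 : phaseFourier R (dualRep l) 0 = 0)
    (h1 : oddPart (phaseFourier R (dualRep l)) (oddLine l) = 0) :
    evenPart (phaseFourier R (dualRep l)) = 0 ∧ oddPart (phaseFourier R (dualRep l)) = 0 := by
  obtain ⟨y, hy⟩ : ∃ y : Fin 4 → ℂ, (fun l => star (v l)) = y := ⟨_, rfl⟩
  obtain ⟨q, hq⟩ : ∃ q, phaseFourier R (dualRep l) = q := ⟨_, rfl⟩
  obtain ⟨p, hp⟩ : ∃ p, evenPart q = p := ⟨_, rfl⟩
  obtain ⟨m, hm⟩ : ∃ m, oddPart q = m := ⟨_, rfl⟩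
  have hvy : ∀ l, v l * y l = 1 := fun l => by
    rw [← hy, mul_comm]; exact star_mul_self_of_norm_one (hv l)
  have hys : y 0 + y 1 + y 2 + y 3 = 1 := by
    have := congrArg star hs
    simpa [← hy] using this
  obtain ⟨r0, re, ro⟩ := bc_relations hv hs hR (dualRep l) hq hp hm hy
  obtain ⟨o0, o1, o2, o3⟩ := oddForm_values v m
  obtain ⟨w0, w1, w2, w3⟩ := oddForm_values y m
  rw [hq] at h0 h1 ⊢
  rw [hm] at h1 ⊢
  rw [hp]
  rw [h0] at r0 re
  have re0 := re 0
  have re1 := re 1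
  have re2 := re 2
  have re3 := re 3
  have ro0 := ro 0
  have ro1 := ro 1
  have ro2 := ro 2
  have ro3 := ro 3
  simp only [mul_zero, zero_add] at r0 re0 re1 re2 re3
  rw [o0, w0] at ro0
  rw [o1, w1] at ro1
  rw [o2, w2] at ro2
  rw [o3, w3] at ro3
  have hl := hg.2 l
  clear re ro
  have fin4 : ∀ f : Fin 4 → ℂ, f 0 = 0 → f 1 = 0 → f 2 = 0 → f 3 = 0 → f = 0 := by
    intro f a b c d
    funext i
    fin_cases i <;> assumption
  -- For `k ≠ l` the characters `dualRep k ± dualRep l` lie on the two remaining dual lines, so the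
  -- multiplier is the product of the other two parameters. For `k = l` one of them is `0` and the
  -- multiplier is `v l`; at `θ = 0` it is `v l` squared.
  fin_cases l
  · change m 1 = 0 at h1
    change 2 * _ = v 0 * v 0 * (2 * _) at r0
    change _ = v 0 * 1 * _ at re0
    change _ = v 3 * v 2 * _ at re1
    change _ = v 3 * v 1 * _ at re2
    change _ = v 2 * v 1 * _ at re3
    change _ = -(v 3 * v 2) * _ at ro1
    change _ = -(v 3 * v 1) * _ at ro2
    change _ = -(v 2 * v 1) * _ at ro3
    obtain ⟨⟨a1, a2, a3, a4⟩, b1, b2, b3⟩ := line_systems (hvy 0) (hvy 1) (hvy 2) (hvy 3)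
      (by linear_combination hs) (by linear_combination hys) hl.1
      (by rw [esymmTwo]; linear_combination v 0 * hs) hl.2
      (p₁ := p 0) (p₂ := p 1) (p₃ := p 2) (p₄ := p 3)
      (by linear_combination r0) (by linear_combination re0) (by linear_combination re1)
      (by linear_combination re2) (by linear_combination re3)
      (m := m 0) (m₂ := m 1) (m₃ := m 2) (m₄ := m 3) h1
      (by linear_combination -ro1 + v 3 * m 2 * hvy 2 - v 2 * m 3 * hvy 3)
      (by linear_combination ro2 - v 3 * m 1 * hvy 1 + v 1 * m 3 * hvy 3)
      (by linear_combination -ro3 + v 2 * m 1 * hvy 1 - v 1 * m 2 * hvy 2)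
    exact ⟨fin4 _ a1 a2 a3 a4, fin4 _ b1 h1 b2 b3⟩
  · change m 0 = 0 at h1
    change 2 * _ = v 1 * v 1 * (2 * _) at r0
    change _ = v 3 * v 2 * _ at re0
    change _ = v 1 * 1 * _ at re1
    change _ = v 0 * v 3 * _ at re2
    change _ = v 2 * v 0 * _ at re3
    change _ = -(v 3 * v 2) * _ at ro0
    change _ = -(v 0 * v 3) * _ at ro2
    change _ = -(v 2 * v 0) * _ at ro3
    obtain ⟨⟨a1, a2, a3, a4⟩, b1, b2, b3⟩ := line_systems (hvy 1) (hvy 0) (hvy 2) (hvy 3)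
      (by linear_combination hs) (by linear_combination hys) hl.1
      (by rw [esymmTwo]; linear_combination v 1 * hs) hl.2
      (p₁ := p 1) (p₂ := p 0) (p₃ := p 2) (p₄ := p 3)
      (by linear_combination r0) (by linear_combination re1) (by linear_combination re0)
      (by linear_combination re2) (by linear_combination re3)
      -- Changing representatives of lines absorbs the signs of `oddForm` and brings the equations
      -- into the cyclic form required by `line_systems`.
      (m := m 1) (m₂ := m 0) (m₃ := m 2) (m₄ := -m 3) h1
      (by linear_combination -ro0 + v 3 * m 2 * hvy 2 + v 2 * m 3 * hvy 3)
      (by linear_combination -ro2 - v 3 * m 0 * hvy 0 - v 0 * m 3 * hvy 3)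
      (by linear_combination -ro3 + v 2 * m 0 * hvy 0 - v 0 * m 2 * hvy 2)
    exact ⟨fin4 _ a2 a1 a3 a4, fin4 _ h1 b1 b2 (neg_eq_zero.1 b3)⟩
  · change m 0 = 0 at h1
    change 2 * _ = v 2 * v 2 * (2 * _) at r0
    change _ = v 3 * v 1 * _ at re0
    change _ = v 0 * v 3 * _ at re1
    change _ = v 2 * 1 * _ at re2
    change _ = v 0 * v 1 * _ at re3
    change _ = -(v 3 * v 1) * _ at ro0
    change _ = -(v 0 * v 3) * _ at ro1
    change _ = -(v 0 * v 1) * _ at ro3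
    obtain ⟨⟨a1, a2, a3, a4⟩, b1, b2, b3⟩ := line_systems (hvy 2) (hvy 0) (hvy 1) (hvy 3)
      (by linear_combination hs) (by linear_combination hys) hl.1
      (by rw [esymmTwo]; linear_combination v 2 * hs) hl.2
      (p₁ := p 2) (p₂ := p 0) (p₃ := p 1) (p₄ := p 3)
      (by linear_combination r0) (by linear_combination re2) (by linear_combination re0)
      (by linear_combination re1) (by linear_combination re3)
      (m := m 2) (m₂ := -m 0) (m₃ := m 1) (m₄ := -m 3) (neg_eq_zero.2 h1)
      (by linear_combination -ro0 + v 3 * m 1 * hvy 1 + v 1 * m 3 * hvy 3)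
      (by linear_combination -ro1 + v 3 * m 0 * hvy 0 - v 0 * m 3 * hvy 3)
      (by linear_combination ro3 - v 1 * m 0 * hvy 0 - v 0 * m 1 * hvy 1)
    exact ⟨fin4 _ a2 a3 a1 a4, fin4 _ h1 b2 b1 (neg_eq_zero.1 b3)⟩
  · change m 0 = 0 at h1
    change 2 * _ = v 3 * v 3 * (2 * _) at r0
    change _ = v 2 * v 1 * _ at re0
    change _ = v 2 * v 0 * _ at re1
    change _ = v 0 * v 1 * _ at re2
    change _ = v 3 * 1 * _ at re3
    change _ = -(v 2 * v 1) * _ at ro0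
    change _ = -(v 2 * v 0) * _ at ro1
    change _ = -(v 0 * v 1) * _ at ro2
    obtain ⟨⟨a1, a2, a3, a4⟩, b1, b2, b3⟩ := line_systems (hvy 3) (hvy 0) (hvy 1) (hvy 2)
      (by linear_combination hs) (by linear_combination hys) hl.1
      (by rw [esymmTwo]; linear_combination v 3 * hs) hl.2
      (p₁ := p 3) (p₂ := p 0) (p₃ := p 1) (p₄ := p 2)
      (by linear_combination r0) (by linear_combination re3) (by linear_combination re0)
      (by linear_combination re1) (by linear_combination re2)
      (m := m 3) (m₂ := m 0) (m₃ := m 1) (m₄ := -m 2) h1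
      (by linear_combination -ro0 + v 2 * m 1 * hvy 1 + v 1 * m 2 * hvy 2)
      (by linear_combination ro1 - v 2 * m 0 * hvy 0 - v 0 * m 2 * hvy 2)
      (by linear_combination ro2 + v 1 * m 0 * hvy 0 - v 0 * m 1 * hvy 1)
    exact ⟨fin4 _ a2 a3 a4 a1, fin4 _ h1 b2 (neg_eq_zero.1 b3) b1⟩

end Bound

/-! ### Defect at most two at generic points -/

section BlockCirculantDefect

variable {v : Fin 4 → ℂ}

/-- At `η = 0` the multipliers are the squares of the parameters: the odd system is the
nondegenerate skew one, and the even system leaves a single complex relation. -/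
theorem phaseFourier_zero_relations {R : Plane → Plane → ℝ} (hv : ∀ l, ‖v l‖ = 1)
    (hs : v 0 + v 1 + v 2 + v 3 = 1) (hg : GenericPoint v)
    (hR : ∀ i j, ∑ k, star (bcFun v (k - i)) * bcFun v (k - j) * ((R k j - R k i : ℝ) : ℂ) = 0) :
    (v 0 * evenPart (phaseFourier R 0) 0 + v 1 * evenPart (phaseFourier R 0) 1 +
      v 2 * evenPart (phaseFourier R 0) 2 + v 3 * evenPart (phaseFourier R 0) 3 =
        2 * phaseFourier R 0 0) ∧ oddPart (phaseFourier R 0) = 0 := by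
  obtain ⟨y, hy⟩ : ∃ y : Fin 4 → ℂ, (fun l => star (v l)) = y := ⟨_, rfl⟩
  obtain ⟨q, hq⟩ : ∃ q, phaseFourier R 0 = q := ⟨_, rfl⟩
  obtain ⟨p, hp⟩ : ∃ p, evenPart q = p := ⟨_, rfl⟩
  obtain ⟨m, hm⟩ : ∃ m, oddPart q = m := ⟨_, rfl⟩
  have hvy : ∀ l, v l * y l = 1 := fun l => by
    rw [← hy, mul_comm]; exact star_mul_self_of_norm_one (hv l)
  have hys : y 0 + y 1 + y 2 + y 3 = 1 := by
    have := congrArg star hs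
    simpa [← hy] using this
  obtain ⟨r0, re, ro⟩ := bc_relations hv hs hR 0 hq hp hm hy
  obtain ⟨o0, o1, o2, o3⟩ := oddForm_values v m
  obtain ⟨w0, w1, w2, w3⟩ := oddForm_values y m
  rw [hq, hp, hm]
  have hd : ∀ l, bcDual v (dualRep l) = v l := by
    intro l
    fin_cases l <;> rfl
  have h0 : bcDual v 0 = 1 := rfl
  simp only [add_zero, sub_zero, hd, h0] at r0 re ro
  constructor
  · refine even_system_trivial (hvy 0) (hvy 1) (hvy 2) (hvy 3) hs (hg.2 0).1 (hg.2 1).1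
      (hg.2 2).1 (hg.2 3).1 ?_ ?_ ?_ ?_ ?_
    · linear_combination r0
    · linear_combination re 0
    · linear_combination re 1
    · linear_combination re 2
    · linear_combination re 3
  · have ro0 := ro 0
    have ro1 := ro 1
    have ro2 := ro 2
    have ro3 := ro 3
    rw [o0, w0] at ro0
    rw [o1, w1] at ro1
    rw [o2, w2] at ro2
    rw [o3, w3] at ro3
    obtain ⟨a0, a1, a2, a3⟩ := antisymm_system (hvy 0) (hvy 1) (hvy 2) (hvy 3) hs hys hg.1
      (m₁ := m 0) (m₂ := m 1) (m₃ := m 2) (m₄ := m 3)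
      (by linear_combination ro0) (by linear_combination ro1) (by linear_combination ro2)
      (by linear_combination ro3)
    funext i
    fin_cases i <;> assumption

/-- The Fourier coefficients of a phase matrix of order nine, as linear maps. -/
def bcFourier (η g : Plane) : Matrix (Fin 9) (Fin 9) ℝ →ₗ[ℝ] ℂ where
  toFun R := phaseFourier (fun k j => R (planeEquiv.symm k) (planeEquiv.symm j)) η g
  map_add' R S := by
    simp only [phaseFourier, Matrix.add_apply, Complex.ofReal_add, mul_add,
      Finset.sum_add_distrib]
  map_smul' c R := by
    simp only [phaseFourier, Matrix.smul_apply, smul_eq_mul, Complex.ofReal_mul,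
      RingHom.id_apply, Complex.real_smul, Finset.mul_sum]
    exact Finset.sum_congr rfl fun i _ => by ring

/-- Coordinates on the defect space of a generic `bcMatrix`. -/
def bcCoords (l : Fin 4) : Matrix (Fin 9) (Fin 9) ℝ →ₗ[ℝ]
    (Fin 3 → ℝ) × (Fin 4 → ℂ) × (Fin 4 → ℂ) :=
  (LinearMap.pi fun i => Complex.reLm ∘ₗ (bcFourier 0 (lineRep (l.succAbove i)) +
    bcFourier 0 (-lineRep (l.succAbove i)))).prod
  ((LinearMap.pi fun k => bcFourier (dualRep k) 0).prod
    (LinearMap.pi fun k => bcFourier (dualRep k) (lineRep (oddLine k)) -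
      bcFourier (dualRep k) (-lineRep (oddLine k))))

theorem plane_cases : ∀ g : Plane, g = 0 ∨ ∃ l, g = lineRep l ∨ g = -lineRep l := by decide

theorem dual_cases : ∀ g : Plane, g = 0 ∨ ∃ l, g = dualRep l ∨ g = -dualRep l := by decide

theorem eq_zero_of_parts {q : Plane → ℂ} (h0 : q 0 = 0) (he : evenPart q = 0)
    (ho : oddPart q = 0) (g : Plane) : q g = 0 := by
  rcases plane_cases g with rfl | ⟨l, hl⟩
  · exact h0
  · have h1 : q (lineRep l) + q (-lineRep l) = 0 := congrFun he l
    have h2 : q (lineRep l) - q (-lineRep l) = 0 := congrFun ho l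
    rcases hl with rfl | rfl
    · linear_combination (h1 + h2) / 2
    · linear_combination (h1 - h2) / 2

/-- `bcCoords` is injective on the solution space, and its target has real dimension `3 + 8 + 8`. -/
theorem finrank_defectSpace_bcMatrix_le (hv : ∀ l, ‖v l‖ = 1)
    (hs : v 0 + v 1 + v 2 + v 3 = 1) (hg : GenericPoint v) :
    Module.finrank ℝ (defectSpace (bcMatrix (v 0) (v 1) (v 2) (v 3))) ≤ 19 := by
  -- Real parameters different from 1 would all be `-1`, with sum `-4`. At `η = 0`, where the
  -- unknowns are real, the imaginary part of the even relation recovers the even part on this line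
  -- from the other three.
  obtain ⟨l, hl⟩ : ∃ l, (v l).im ≠ 0 := by
    by_contra! h
    have hval : ∀ l, v l = -1 := by
      intro l
      have h1 : v l = ((v l).re : ℂ) := Complex.ext rfl (h l)
      have h2 := hv l
      rw [h1, Complex.norm_real, Real.norm_eq_abs, abs_eq zero_le_one] at h2
      rcases h2 with h2 | h2
      · exact absurd (by rw [h1, h2]; simp) (hg.2 l).1
      · rw [h1, h2]; simp
    rw [hval, hval, hval, hval] at hs
    norm_num at hs
  have hinj : Function.Injective
      ((bcCoords l).domRestrict (defectSpace (bcMatrix (v 0) (v 1) (v 2) (v 3)))) := by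
    rw [← LinearMap.ker_eq_bot, LinearMap.ker_eq_bot']
    rintro ⟨R, hRmem⟩ h
    set R' : Plane → Plane → ℝ := fun k j => R (planeEquiv.symm k) (planeEquiv.symm j) with hR'
    have hR : ∀ i j, ∑ k, star (bcFun v (k - i)) * bcFun v (k - j) *
        ((R' k j - R' k i : ℝ) : ℂ) = 0 := by
      intro i j
      rw [← hRmem (planeEquiv.symm i) (planeEquiv.symm j), ← Equiv.sum_comp planeEquiv]
      refine Finset.sum_congr rfl fun k _ => ?_
      simp only [bcMatrix_apply, Equiv.apply_symm_apply, hR', Equiv.symm_apply_apply]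
    have h1 : ∀ i, (evenPart (phaseFourier R' 0) (l.succAbove i)).re = 0 := fun i =>
      congrFun (congrArg Prod.fst h) i
    have h2 : ∀ k, phaseFourier R' (dualRep k) 0 = 0 := fun k =>
      congrFun (congrArg (fun x => x.2.1) h) k
    have h3 : ∀ k, oddPart (phaseFourier R' (dualRep k)) (oddLine k) = 0 := fun k =>
      congrFun (congrArg (fun x => x.2.2) h) k
    have hreal : ∀ g, (phaseFourier R' 0 g).im = 0 := by
      intro g
      have := star_phaseFourier R' 0 g
      rw [neg_zero] at this
      exact Complex.conj_eq_iff_im.1 this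
    have key0 : ∀ g, phaseFourier R' 0 g = 0 := by
      obtain ⟨ha, hb⟩ := phaseFourier_zero_relations hv hs hg hR
      have him : ∀ k, (evenPart (phaseFourier R' 0) k).im = 0 := by
        intro k
        rw [evenPart, Complex.add_im, hreal, hreal, add_zero]
      have hz : ∀ i, evenPart (phaseFourier R' 0) (l.succAbove i) = 0 := fun i =>
        Complex.ext (h1 i) (him _)
      have hsum : ∑ k, v k * evenPart (phaseFourier R' 0) k = 2 * phaseFourier R' 0 0 := by
        rw [← ha, Fin.sum_univ_four]
      rw [Fin.sum_univ_succAbove _ l] at hsum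
      simp only [hz, mul_zero, Finset.sum_const_zero, add_zero] at hsum
      have hl0 : evenPart (phaseFourier R' 0) l = 0 := by
        refine Complex.ext ?_ (him l)
        have := congrArg Complex.im hsum
        simp only [Complex.mul_im, him, hreal, mul_zero, zero_add] at this
        simpa [hl] using this
      refine eq_zero_of_parts ?_ ?_ hb
      · rw [hl0, mul_zero] at hsum
        simpa using hsum.symm
      · funext k
        rcases Fin.eq_self_or_eq_succAbove l k with rfl | ⟨i, rfl⟩
        · exact hl0
        · exact hz i
    have key : ∀ k g, phaseFourier R' (dualRep k) g = 0 := by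
      intro k
      obtain ⟨ha, hb⟩ := phaseFourier_dualRep_eq_zero hv hs hg hR k (h2 k) (h3 k)
      exact eq_zero_of_parts (h2 k) ha hb
    have hall : ∀ η g, phaseFourier R' η g = 0 := by
      intro η g
      rcases dual_cases η with rfl | ⟨k, rfl | rfl⟩
      · exact key0 g
      · exact key k g
      · rw [← star_phaseFourier, key, star_zero]
    have hzero := eq_zero_of_phaseFourier hall
    refine Subtype.ext ?_
    ext k j
    have := hzero (planeEquiv k) (planeEquiv j)
    simpa [hR'] using this
  have := LinearMap.finrank_le_finrank_of_injective hinj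
  simpa [Module.finrank_prod, Module.finrank_pi_fintype, Complex.finrank_real_complex] using this

theorem defect_bcMatrix_le (hv : ∀ l, ‖v l‖ = 1)
    (hs : v 0 + v 1 + v 2 + v 3 = 1) (hg : GenericPoint v) :
    defect (bcMatrix (v 0) (v 1) (v 2) (v 3)) ≤ 2 := by
  have := finrank_defectSpace_bcMatrix_le hv hs hg
  rw [defect]
  omega

end BlockCirculantDefect

/-! ### The Hadamard property, and splitting a number into two unimodular ones -/

section BlockCirculantOrbit

/-- For `d` on line `l` the sum is `v l + y l + y l * v l` plus all `y i * v j` with distinct `i, j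
≠ l`. Since both sums are one, the latter equal `(1 - y l) (1 - v l) - 3`, and everything cancels.
-/
theorem bcFun_autocorrelation {v y : Fin 4 → ℂ} (hvy : ∀ l, y l * v l = 1)
    (hs : v 0 + v 1 + v 2 + v 3 = 1) (hy : y 0 + y 1 + y 2 + y 3 = 1) (d : Plane) (hd : d ≠ 0) :
    ∑ g, bcFun y g * bcFun v (g + d) = 0 := by
  revert hd
  rw [sum_plane]
  revert d
  refine forall_plane (fun h => absurd rfl h) ?_ ?_ ?_ ?_ ?_ ?_ ?_ ?_ <;> intro _
  · change 1 * v 0 + y 0 * v 0 + y 0 * 1 + (y 1 * v 2 + y 2 * v 3 +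
      y 3 * v 1) + (y 1 * v 3 + y 3 * v 2 + y 2 * v 1) = 0
    linear_combination (y 1 + y 2 + y 3) * hs + (1 - v 0) * hy + 2 * hvy 0 -
      hvy 1 - hvy 2 - hvy 3
  · change 1 * v 0 + y 0 * 1 + y 0 * v 0 + (y 1 * v 3 + y 2 * v 1 +
      y 3 * v 2) + (y 1 * v 2 + y 3 * v 1 + y 2 * v 3) = 0
    linear_combination (y 1 + y 2 + y 3) * hs + (1 - v 0) * hy + 2 * hvy 0 -
      hvy 1 - hvy 2 - hvy 3
  · change 1 * v 1 + y 0 * v 2 + y 0 * v 3 + (y 1 * v 1 + y 2 * v 3 +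
      y 3 * v 2) + (y 1 * 1 + y 3 * v 0 + y 2 * v 0) = 0
    linear_combination (y 0 + y 2 + y 3) * hs + (1 - v 1) * hy + 2 * hvy 1 -
      hvy 0 - hvy 2 - hvy 3
  · change 1 * v 2 + y 0 * v 3 + y 0 * v 1 + (y 1 * v 3 + y 2 * v 2 +
      y 3 * v 1) + (y 1 * v 0 + y 3 * v 0 + y 2 * 1) = 0
    linear_combination (y 0 + y 1 + y 3) * hs + (1 - v 2) * hy + 2 * hvy 2 -
      hvy 0 - hvy 1 - hvy 3
  · change 1 * v 3 + y 0 * v 1 + y 0 * v 2 + (y 1 * v 2 + y 2 * v 1 +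
      y 3 * v 3) + (y 1 * v 0 + y 3 * 1 + y 2 * v 0) = 0
    linear_combination (y 0 + y 1 + y 2) * hs + (1 - v 3) * hy + 2 * hvy 3 -
      hvy 0 - hvy 1 - hvy 2
  · change 1 * v 1 + y 0 * v 3 + y 0 * v 2 + (y 1 * 1 + y 2 * v 0 +
      y 3 * v 0) + (y 1 * v 1 + y 3 * v 2 + y 2 * v 3) = 0
    linear_combination (y 0 + y 2 + y 3) * hs + (1 - v 1) * hy + 2 * hvy 1 -
      hvy 0 - hvy 2 - hvy 3
  · change 1 * v 3 + y 0 * v 2 + y 0 * v 1 + (y 1 * v 0 + y 2 * v 0 +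
      y 3 * 1) + (y 1 * v 2 + y 3 * v 3 + y 2 * v 1) = 0
    linear_combination (y 0 + y 1 + y 2) * hs + (1 - v 3) * hy + 2 * hvy 3 -
      hvy 0 - hvy 1 - hvy 2
  · change 1 * v 2 + y 0 * v 1 + y 0 * v 3 + (y 1 * v 0 + y 2 * 1 +
      y 3 * v 0) + (y 1 * v 3 + y 3 * v 1 + y 2 * v 2) = 0
    linear_combination (y 0 + y 1 + y 3) * hs + (1 - v 2) * hy + 2 * hvy 2 -
      hvy 0 - hvy 1 - hvy 3

theorem isHadamard_bcMatrix {v : Fin 4 → ℂ} (hv : ∀ l, ‖v l‖ = 1)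
    (hs : v 0 + v 1 + v 2 + v 3 = 1) : IsHadamard (bcMatrix (v 0) (v 1) (v 2) (v 3)) := by
  rw [isHadamard_iff]
  refine ⟨fun i j => by rw [bcMatrix_apply]; exact norm_bcFun hv _, fun i j => ?_⟩
  simp only [bcMatrix_apply]
  rw [← Equiv.sum_comp planeEquiv.symm, ← Equiv.sum_comp (Equiv.addRight (planeEquiv i))]
  simp only [Equiv.coe_addRight, Equiv.apply_symm_apply, add_sub_cancel_right, add_sub_assoc]
  split_ifs with hij
  · subst hij
    simp only [sub_self, add_zero, star_mul_self_of_norm_one (norm_bcFun hv _), Finset.sum_const,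
      Finset.card_univ, nsmul_eq_mul, mul_one]
    rfl
  · simp only [star_bcFun]
    refine bcFun_autocorrelation (fun l => star_mul_self_of_norm_one (hv l)) hs ?_ _ ?_
    · simpa using congrArg star hs
    · rw [sub_ne_zero]
      exact fun h => hij (planeEquiv.injective h)

theorem mem_BC9_iff {H : Matrix (Fin 9) (Fin 9) ℂ} : H ∈ BC9 ↔ ∃ v : Fin 4 → ℂ,
    (∀ l, ‖v l‖ = 1) ∧ v 0 + v 1 + v 2 + v 3 = 1 ∧ H = bcMatrix (v 0) (v 1) (v 2) (v 3) := by
  constructor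
  · rintro ⟨x, y, u, w, hx, hy, hu, hw, hs, rfl⟩
    refine ⟨![x, y, u, w], ?_, hs, rfl⟩
    intro l
    fin_cases l <;> assumption
  · rintro ⟨v, hv, hs, rfl⟩
    exact ⟨_, _, _, _, hv 0, hv 1, hv 2, hv 3, hs, rfl⟩

theorem bcPerm_mem_BC9 {v : Fin 4 → ℂ} (hv : ∀ l, ‖v l‖ = 1)
    (hs : v 0 + v 1 + v 2 + v 3 = 1) (σ : Equiv.Perm (Fin 4)) : bcPerm v σ ∈ BC9 := by
  refine ⟨_, _, _, _, hv _, hv _, hv _, hv _, ?_, rfl⟩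
  rw [← Fin.sum_univ_four fun l => v (σ l), Equiv.sum_comp σ v, Fin.sum_univ_four, hs]

theorem isHadamard_of_mem_BC9 {H : Matrix (Fin 9) (Fin 9) ℂ} (hH : H ∈ BC9) : IsHadamard H := by
  obtain ⟨v, hv, hs, rfl⟩ := mem_BC9_iff.1 hH
  exact isHadamard_bcMatrix hv hs

/-- A unimodular number `u` such that `s - u` is unimodular, for `0 < ‖s‖ < 2`. -/
def unitSplit (s : ℂ) : ℂ :=
  s / 2 + Complex.I * s * (Real.sqrt (1 / (s.re ^ 2 + s.im ^ 2) - 1 / 4) : ℝ)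

/-- The numbers that are sums of two linearly independent unimodular numbers. -/
def splitDomain : Set ℂ := {s | s ≠ 0 ∧ ‖s‖ < 2}

theorem isOpen_splitDomain : IsOpen splitDomain :=
  isOpen_ne.inter (isOpen_lt continuous_norm continuous_const)

theorem norm_sq_eq (s : ℂ) : ‖s‖ ^ 2 = s.re ^ 2 + s.im ^ 2 := by
  rw [Complex.sq_norm, Complex.normSq_apply]; ring

theorem splitDomain_pos {s : ℂ} (hs : s ∈ splitDomain) :
    0 < s.re ^ 2 + s.im ^ 2 ∧ 0 < 1 / (s.re ^ 2 + s.im ^ 2) - 1 / 4 := by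
  have h0 : 0 < ‖s‖ := norm_pos_iff.2 hs.1
  have h1 : 0 < s.re ^ 2 + s.im ^ 2 := by rw [← norm_sq_eq]; positivity
  refine ⟨h1, sub_pos.2 ?_⟩
  apply one_div_lt_one_div_of_lt h1
  rw [← norm_sq_eq]
  nlinarith [hs.2]

theorem norm_eq_one_iff_sq {z : ℂ} : ‖z‖ = 1 ↔ z.re ^ 2 + z.im ^ 2 = 1 := by
  rw [← norm_sq_eq, pow_eq_one_iff_of_nonneg (norm_nonneg z) two_ne_zero]

theorem norm_unitSplit {s : ℂ} (hs : s ∈ splitDomain) :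
    ‖unitSplit s‖ = 1 ∧ ‖s - unitSplit s‖ = 1 := by
  obtain ⟨h1, h2⟩ := splitDomain_pos hs
  have h3 := Real.sq_sqrt h2.le
  rw [norm_eq_one_iff_sq, norm_eq_one_iff_sq, unitSplit]
  generalize Real.sqrt (1 / (s.re ^ 2 + s.im ^ 2) - 1 / 4) = k at h3
  have h4 : (s.re ^ 2 + s.im ^ 2) * k ^ 2 = 1 - (s.re ^ 2 + s.im ^ 2) / 4 := by
    rw [h3]
    field_simp
  have hre : (s / 2 + Complex.I * s * (k : ℂ)).re = s.re / 2 - s.im * k := by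
    simp; ring
  have him : (s / 2 + Complex.I * s * (k : ℂ)).im = s.im / 2 + s.re * k := by simp
  rw [Complex.sub_re, Complex.sub_im, hre, him]
  constructor <;> linear_combination h4

theorem contDiffOn_unitSplit : ContDiffOn ℝ 1 unitSplit splitDomain := by
  intro s hs
  obtain ⟨h1, h2⟩ := splitDomain_pos hs
  refine ContDiffAt.contDiffWithinAt ?_
  have hre : ContDiffAt ℝ 1 Complex.re s := Complex.reCLM.contDiff.contDiffAt
  have him : ContDiffAt ℝ 1 Complex.im s := Complex.imCLM.contDiff.contDiffAt
  have hn : ContDiffAt ℝ 1 (fun s : ℂ => s.re ^ 2 + s.im ^ 2) s := (hre.pow 2).add (him.pow 2)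
  have hk : ContDiffAt ℝ 1 (fun s : ℂ => Real.sqrt (1 / (s.re ^ 2 + s.im ^ 2) - 1 / 4)) s :=
    ((contDiffAt_const.div hn h1.ne').sub contDiffAt_const).sqrt h2.ne'
  have hk' : ContDiffAt ℝ 1
      (fun s : ℂ => (Real.sqrt (1 / (s.re ^ 2 + s.im ^ 2) - 1 / 4) : ℂ)) s :=
    Complex.ofRealCLM.contDiff.contDiffAt.comp s hk
  exact (contDiffAt_id.div_const 2).add ((contDiffAt_const.mul contDiffAt_id).mul hk')

theorem add_mem_splitDomain {u w : ℂ} (hu : ‖u‖ = 1) (hw : ‖w‖ = 1) (h1 : u ≠ w) (h2 : u ≠ -w) :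
    u + w ∈ splitDomain := by
  refine ⟨fun h => h2 (eq_neg_of_add_eq_zero_left h), ?_⟩
  refine lt_of_le_of_ne ((norm_add_le u w).trans (by rw [hu, hw]; norm_num)) fun h => h1 ?_
  have h3 : SameRay ℝ u w := by
    rw [sameRay_iff_norm_add, hu, hw, h]
    norm_num
  exact h3.eq_of_norm_eq (by rw [hu, hw])

/-- Two unimodular numbers with nonzero sum `s` have product `s / star s`, so they are the roots of
a quadratic determined by `s`; completing the square gives `unitSplit s` and its partner. -/
theorem eq_unitSplit {u w : ℂ} (hu : ‖u‖ = 1) (hw : ‖w‖ = 1) (h1 : u ≠ w) (h2 : u ≠ -w) :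
    u = unitSplit (u + w) ∨ w = unitSplit (u + w) := by
  have hs := add_mem_splitDomain hu hw h1 h2
  obtain ⟨hp1, hp2⟩ := splitDomain_pos hs
  have h3 := Real.sq_sqrt hp2.le
  rw [unitSplit]
  set k := Real.sqrt (1 / ((u + w).re ^ 2 + (u + w).im ^ 2) - 1 / 4)
  have h4 : ((u + w).re ^ 2 + (u + w).im ^ 2) * k ^ 2 =
      1 - ((u + w).re ^ 2 + (u + w).im ^ 2) / 4 := by
    rw [h3]
    field_simp
  have hu' := star_mul_self_of_norm_one hu
  have hw' := star_mul_self_of_norm_one hw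
  have hn : (((u + w).re ^ 2 + (u + w).im ^ 2 : ℝ) : ℂ) = star (u + w) * (u + w) := by
    have := Complex.normSq_eq_conj_mul_self (z := u + w)
    rw [Complex.normSq_apply] at this
    rw [← sq, ← sq] at this
    exact this
  have h5 := congrArg (fun r : ℝ => (r : ℂ)) h4
  rw [Complex.ofReal_mul, Complex.ofReal_sub, Complex.ofReal_div, hn, Complex.ofReal_pow,
    star_add] at h5
  push_cast at h5
  have h6 : star (u + w) ≠ 0 := star_ne_zero.2 hs.1
  have h7 : (u - (u + w) / 2) ^ 2 = (Complex.I * (u + w) * k) ^ 2 := by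
    refine mul_left_cancel₀ h6 ?_
    rw [star_add, mul_pow, mul_pow, Complex.I_sq]
    linear_combination (u + w) * h5 - w * hu' - u * hw'
  rcases sq_eq_sq_iff_eq_or_eq_neg.1 h7 with h | h
  · left; linear_combination h
  · right; linear_combination -h

end BlockCirculantOrbit

/-! ### Perturbing a quadruple to one generic at a given coordinate -/

section Density

/-- Unimodular numbers with sum one. -/
structure UnitSum (x y u w : ℂ) : Prop where
  fst : ‖x‖ = 1
  snd : ‖y‖ = 1
  trd : ‖u‖ = 1
  fth : ‖w‖ = 1
  sum_eq : x + y + u + w = 1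

theorem unitSplit_near {u w : ℂ} (hu : ‖u‖ = 1) (hw : ‖w‖ = 1) (h1 : u ≠ w) (h2 : u ≠ -w)
    {ε : ℝ} (hε : 0 < ε) : ∃ δ > 0, ∀ s, ‖s - (u + w)‖ < δ →
      ∃ u' w', ‖u'‖ = 1 ∧ ‖w'‖ = 1 ∧ u' + w' = s ∧ ‖u' - u‖ < ε ∧ ‖w' - w‖ < ε := by
  wlog h : u = unitSplit (u + w) generalizing u w
  · have h' := (eq_unitSplit hu hw h1 h2).resolve_left h
    obtain ⟨δ, hδ, H⟩ := this hw hu h1.symm (fun h => h2 (by rw [h, neg_neg]))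
      (by rwa [add_comm u w] at h')
    refine ⟨δ, hδ, fun s hs => ?_⟩
    obtain ⟨u', w', a, b, c, d, e⟩ := H s (by rwa [add_comm u w] at hs)
    exact ⟨w', u', b, a, by rw [add_comm, c], e, d⟩
  have hs := add_mem_splitDomain hu hw h1 h2
  have hc : ContinuousAt unitSplit (u + w) :=
    contDiffOn_unitSplit.continuousOn.continuousAt (isOpen_splitDomain.mem_nhds hs)
  have hev1 := Metric.continuousAt_iff'.1 hc ε hε
  have hev2 := Metric.continuousAt_iff'.1 (continuousAt_id.sub hc) ε hε
  obtain ⟨δ, hδ, H⟩ := Metric.eventually_nhds_iff.1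
    ((hev1.and hev2).and (isOpen_splitDomain.mem_nhds hs))
  refine ⟨δ, hδ, fun s hsd => ?_⟩
  obtain ⟨⟨a, b⟩, c⟩ := H (by rwa [dist_eq_norm])
  obtain ⟨n1, n2⟩ := norm_unitSplit c
  refine ⟨unitSplit s, s - unitSplit s, n1, n2, by ring, ?_, ?_⟩
  · rwa [dist_eq_norm, ← h] at a
  · rw [dist_eq_norm] at b
    simp only [Pi.sub_apply, id] at b
    rwa [← h, add_sub_cancel_left] at b

/-- Where `u ≠ ±w`, the pair can be chosen continuously in its sum, so `x` and `y` are free local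
coordinates. -/
theorem UnitSum.move {x y u w : ℂ} (h : UnitSum x y u w) (h1 : u ≠ w) (h2 : u ≠ -w)
    {ε : ℝ} (hε : 0 < ε) : ∃ δ > 0, ∀ x' y', ‖x'‖ = 1 → ‖y'‖ = 1 → ‖x' - x‖ < δ → ‖y' - y‖ < δ →
      ∃ u' w', UnitSum x' y' u' w' ∧ ‖u' - u‖ < ε ∧ ‖w' - w‖ < ε := by
  obtain ⟨δ, hδ, H⟩ := unitSplit_near h.trd h.fth h1 h2 hε
  refine ⟨δ / 2, half_pos hδ, fun x' y' hx' hy' hx hy => ?_⟩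
  obtain ⟨u', w', a, b, c, d, e⟩ := H (1 - x' - y') (by
    have : 1 - x' - y' - (u + w) = (x - x') + (y - y') := by linear_combination -h.sum_eq
    rw [this]
    refine (norm_add_le _ _).trans_lt ?_
    rw [norm_sub_rev x, norm_sub_rev y]
    linarith)
  exact ⟨u', w', ⟨hx', hy', a, b, by linear_combination c⟩, d, e⟩

theorem infinite_unit_near {z : ℂ} (hz : ‖z‖ = 1) {δ : ℝ} (hδ : 0 < δ) :
    {z' : ℂ | ‖z'‖ = 1 ∧ ‖z' - z‖ < δ}.Infinite := by
  have hc : ContinuousAt (fun θ : ℝ => z * Complex.exp (θ * Complex.I)) 0 := by fun_prop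
  obtain ⟨η, hη, H⟩ := Metric.continuousAt_iff.1 hc δ hδ
  refine ((Set.Ioo_infinite (lt_min hη one_pos)).image
    (f := fun θ : ℝ => z * Complex.exp (θ * Complex.I)) ?_).mono ?_
  · intro a ha b hb hab
    have hz0 : z ≠ 0 := by rw [← norm_ne_zero_iff, hz]; exact one_ne_zero
    have h := congrArg Complex.im (mul_left_cancel₀ hz0 hab)
    rw [Complex.exp_ofReal_mul_I_im, Complex.exp_ofReal_mul_I_im] at h
    have hpi := Real.pi_gt_three
    have ha1 := ha.2.trans_le (min_le_right _ _)
    have hb1 := hb.2.trans_le (min_le_right _ _)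
    exact Real.injOn_sin ⟨by linarith [ha.1], by linarith⟩ ⟨by linarith [hb.1], by linarith⟩ h
  · rintro _ ⟨θ, hθ, rfl⟩
    refine ⟨by simp [hz, Complex.norm_exp_ofReal_mul_I], ?_⟩
    have := H (x := θ) (by
      rw [Real.dist_eq, sub_zero, abs_of_pos hθ.1]; exact hθ.2.trans_le (min_le_left _ _))
    simpa [dist_eq_norm] using this

theorem exists_unit_near {z : ℂ} (hz : ‖z‖ = 1) {δ : ℝ} (hδ : 0 < δ) {F : Set ℂ} (hF : F.Finite) :
    ∃ z', ‖z'‖ = 1 ∧ ‖z' - z‖ < δ ∧ z' ∉ F := by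
  obtain ⟨z', h1, h2⟩ := (infinite_unit_near hz hδ).exists_notMem_finite hF
  exact ⟨z', h1.1, h1.2, h2⟩

theorem finite_roots_quadratic (p q : ℂ) : {z : ℂ | z ^ 2 + p * z + q = 0}.Finite := by
  have h : (Polynomial.X ^ 2 + Polynomial.C p * Polynomial.X + Polynomial.C q :
      Polynomial ℂ).Monic := by monicity!
  refine (Polynomial.finite_setOfPred_isRoot h.ne_zero).subset fun z hz => ?_
  simpa [Polynomial.IsRoot] using hz

theorem finite_roots_cubic (p q r : ℂ) : {z : ℂ | z ^ 3 + p * z ^ 2 + q * z + r = 0}.Finite := by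
  have h : (Polynomial.X ^ 3 + Polynomial.C p * Polynomial.X ^ 2 + Polynomial.C q * Polynomial.X +
      Polynomial.C r : Polynomial ℂ).Monic := by monicity!
  refine (Polynomial.finite_setOfPred_isRoot h.ne_zero).subset fun z hz => ?_
  simpa [Polynomial.IsRoot] using hz

/-- Conjugating the sum shows that the reciprocals sum to one, which equates the third and fourth
elementary symmetric polynomials. -/
theorem UnitSum.esymm_relation {x y u w : ℂ} (h : UnitSum x y u w) :
    x * (y * u + y * w + u * w) = (x - 1) * (y * u * w) := by
  have hc := congrArg star h.sum_eq
  simp only [star_add, star_one] at hc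
  linear_combination x * y * u * w * hc - y * u * w * star_mul_self_of_norm_one h.fst -
    x * u * w * star_mul_self_of_norm_one h.snd - x * y * w * star_mul_self_of_norm_one h.trd -
    x * y * u * star_mul_self_of_norm_one h.fth

/-- The genericity condition at the coordinate `x`. -/
def GenericAt (x y u w : ℂ) : Prop :=
  x ≠ 1 ∧ x * (1 - x) + (y * u + y * w + u * w) ≠ 0 ∧ GenericCoord x (y * u + y * w + u * w)

theorem finite_bad_values (x : ℂ) : {b : ℂ | ¬ (x * (1 - x) + b ≠ 0 ∧ GenericCoord x b)}.Finite := by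
  refine ((Set.finite_singleton (-(x * (1 - x)))).union
    ((finite_roots_quadratic (-(x * (1 - x))) ((x * (1 - x)) ^ 2)).union
    (finite_roots_quadratic (3 * x * (1 + x)) (-(x * (1 - x)) ^ 2)))).subset fun b hb => ?_
  by_contra hb'
  simp only [Set.mem_union, Set.mem_singleton_iff, Set.mem_ofPred_eq, not_or] at hb'
  obtain ⟨h1, h2, h3⟩ := hb'
  refine hb ⟨fun h => h1 (by linear_combination h), fun h => h2 (by linear_combination h),
    fun h => h3 (by linear_combination h)⟩

/-- Keep `x` and move `y`. Only finitely many `b = y u + y w + u w` are bad, and `x` and `b`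
determine all symmetric functions of `y, u, w`, so each bad `b` confines `y` to the roots of one
cubic. -/
theorem UnitSum.exists_genericAt_of_ne {x y u w : ℂ} (h : UnitSum x y u w) (hx : x ≠ 1)
    (h1 : u ≠ w) (h2 : u ≠ -w) {ε : ℝ} (hε : 0 < ε) :
    ∃ x' y' u' w', UnitSum x' y' u' w' ∧ GenericAt x' y' u' w' ∧
      ‖x' - x‖ < ε ∧ ‖y' - y‖ < ε ∧ ‖u' - u‖ < ε ∧ ‖w' - w‖ < ε := by
  obtain ⟨δ, hδ, H⟩ := h.move h1 h2 hε
  have hF : (⋃ b ∈ {b : ℂ | ¬ (x * (1 - x) + b ≠ 0 ∧ GenericCoord x b)},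
      {z : ℂ | z ^ 3 + (-(1 - x)) * z ^ 2 + b * z + (-(x * b / (x - 1))) = 0}).Finite :=
    (finite_bad_values x).biUnion fun b _ => finite_roots_cubic _ _ _
  obtain ⟨y', hy1, hy2, hy3⟩ := exists_unit_near h.snd (lt_min hδ hε) hF
  obtain ⟨u', w', h', hu, hw⟩ := H x y' h.fst hy1 (by simpa using hδ)
    (hy2.trans_le (min_le_left _ _))
  refine ⟨x, y', u', w', h', ⟨hx, ?_⟩, by simpa using hε, hy2.trans_le (min_le_right _ _), hu, hw⟩
  by_contra hbad
  refine hy3 (Set.mem_biUnion hbad ?_)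
  have hx1 : x - 1 ≠ 0 := sub_ne_zero.2 hx
  have h3 : x * (y' * u' + y' * w' + u' * w') / (x - 1) = y' * u' * w' := by
    rw [h'.esymm_relation, mul_div_cancel_left₀ _ hx1]
  rw [Set.mem_ofPred_eq, h3]
  linear_combination (-y' ^ 2) * (-h'.sum_eq)

theorem GenericAt.swap_left {x y u w : ℂ} (h : GenericAt x u y w) : GenericAt x y u w := by
  rw [GenericAt, show u * y + u * w + y * w = y * u + y * w + u * w by ring] at h
  exact h

theorem UnitSum.exists_genericAt_of_not_parallel {x y u w : ℂ} (h : UnitSum x y u w) (hx : x ≠ 1)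
    (h1 : ¬ ((u = w ∨ u = -w) ∧ (y = w ∨ y = -w))) {ε : ℝ} (hε : 0 < ε) :
    ∃ x' y' u' w', UnitSum x' y' u' w' ∧ GenericAt x' y' u' w' ∧
      ‖x' - x‖ < ε ∧ ‖y' - y‖ < ε ∧ ‖u' - u‖ < ε ∧ ‖w' - w‖ < ε := by
  by_cases h2 : u = w ∨ u = -w
  · have h3 : ¬ (y = w ∨ y = -w) := fun h3 => h1 ⟨h2, h3⟩
    rw [not_or] at h3
    obtain ⟨x', u', y', w', a, b, c, d, e, f⟩ := UnitSum.exists_genericAt_of_ne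
      (x := x) (y := u) (u := y) (w := w)
      ⟨h.fst, h.trd, h.snd, h.fth, by linear_combination h.sum_eq⟩ hx h3.1 h3.2 hε
    exact ⟨x', y', u', w', ⟨a.fst, a.trd, a.snd, a.fth, by linear_combination a.sum_eq⟩,
      b.swap_left, c, e, d, f⟩
  · rw [not_or] at h2
    exact h.exists_genericAt_of_ne hx h2.1 h2.2 hε

theorem norm_two_mul {z : ℂ} (hz : ‖z‖ = 1) : ‖(2 : ℂ) * z‖ = 2 := by simp [hz]

/-- The sum would be an even integer times a unimodular number, and so could not have modulus one.
-/
theorem UnitSum.not_all_parallel {x y u w : ℂ} (h : UnitSum x y u w) (hx : x = w ∨ x = -w)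
    (hy : y = w ∨ y = -w) (hu : u = w ∨ u = -w) : False := by
  have hs := h.sum_eq
  have hw := h.fth
  have key : ∃ n : ℝ, (n = 4 ∨ n = 2 ∨ n = 0 ∨ n = -2) ∧ (n : ℂ) * w = 1 := by
    rcases hx with rfl | rfl <;> rcases hy with rfl | rfl <;> rcases hu with rfl | rfl
    · exact ⟨4, by norm_num, by push_cast; linear_combination hs⟩
    · exact ⟨2, by norm_num, by push_cast; linear_combination hs⟩
    · exact ⟨2, by norm_num, by push_cast; linear_combination hs⟩
    · exact ⟨0, by norm_num, by push_cast; linear_combination hs⟩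
    · exact ⟨2, by norm_num, by push_cast; linear_combination hs⟩
    · exact ⟨0, by norm_num, by push_cast; linear_combination hs⟩
    · exact ⟨0, by norm_num, by push_cast; linear_combination hs⟩
    · exact ⟨-2, by norm_num, by push_cast; linear_combination hs⟩
  obtain ⟨n, hn, h1⟩ := key
  have h2 := congrArg norm h1
  rw [norm_mul, hw, mul_one, norm_one, Complex.norm_real, Real.norm_eq_abs] at h2
  rcases hn with rfl | rfl | rfl | rfl <;> norm_num at h2

/-- If `y, u, w` are all parallel, then `x` is not parallel to `w`. The pair `(x, w)` can follow a
small move of `y` off the line of `u`, after which the non-parallel case applies. -/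
theorem UnitSum.exists_genericAt_of_ne_one {x y u w : ℂ} (h : UnitSum x y u w) (hx : x ≠ 1)
    {ε : ℝ} (hε : 0 < ε) : ∃ x' y' u' w', UnitSum x' y' u' w' ∧ GenericAt x' y' u' w' ∧
      ‖x' - x‖ < ε ∧ ‖y' - y‖ < ε ∧ ‖u' - u‖ < ε ∧ ‖w' - w‖ < ε := by
  by_cases hp : (u = w ∨ u = -w) ∧ (y = w ∨ y = -w)
  · have h2 : ¬ (x = w ∨ x = -w) := fun h2 => h.not_all_parallel h2 hp.2 hp.1
    rw [not_or] at h2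
    have hx0 : 0 < ‖x - 1‖ := norm_pos_iff.2 (sub_ne_zero.2 hx)
    have hm : UnitSum y u x w := ⟨h.snd, h.trd, h.fst, h.fth, by linear_combination h.sum_eq⟩
    obtain ⟨δ, hδ, H⟩ := hm.move h2.1 h2.2 (lt_min (half_pos hε) hx0)
    obtain ⟨y', hy1, hy2, hy3⟩ := exists_unit_near h.snd (lt_min hδ (half_pos hε))
      (Set.toFinite {u, -u})
    obtain ⟨x', w', h', hx', hw'⟩ := H y' u hy1 h.trd (hy2.trans_le (min_le_left _ _))
      (by simpa using hδ)
    have hx'1 : x' ≠ 1 := by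
      rintro rfl
      have := hx'.trans_le (min_le_right _ _)
      rw [norm_sub_rev] at this
      exact lt_irrefl _ this
    simp only [Set.mem_insert_iff, Set.mem_singleton_iff] at hy3
    obtain ⟨x₂, w₂, u₂, y₂, a, b, c, d, e, f⟩ := UnitSum.exists_genericAt_of_not_parallel
      (x := x') (y := w') (u := y') (w := u)
      ⟨h'.trd, h'.fth, h'.fst, h'.snd, by linear_combination h'.sum_eq⟩ hx'1
      (fun hh => hy3 hh.1) (half_pos hε)
    have tri : ∀ {a b c : ℂ}, ‖a - b‖ < ε / 2 → ‖b - c‖ < ε / 2 → ‖a - c‖ < ε := by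
      intro a b c h1 h2
      have := norm_sub_le_norm_sub_add_norm_sub a b c
      linarith
    exact ⟨x₂, u₂, y₂, w₂, ⟨a.fst, a.trd, a.fth, a.snd, by linear_combination a.sum_eq⟩,
      by
        rw [GenericAt, show w₂ * u₂ + w₂ * y₂ + u₂ * y₂ = u₂ * y₂ + u₂ * w₂ + y₂ * w₂ by ring] at b
        exact b,
      tri c (hx'.trans_le (min_le_left _ _)), tri e (hy2.trans_le (min_le_right _ _)),
      f.trans (half_lt_self hε), tri d (hw'.trans_le (min_le_left _ _))⟩
  · exact h.exists_genericAt_of_not_parallel hx hp hε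

theorem UnitSum.exists_genericAt {x y u w : ℂ} (h : UnitSum x y u w)
    {ε : ℝ} (hε : 0 < ε) : ∃ x' y' u' w', UnitSum x' y' u' w' ∧ GenericAt x' y' u' w' ∧
      ‖x' - x‖ < ε ∧ ‖y' - y‖ < ε ∧ ‖u' - u‖ < ε ∧ ‖w' - w‖ < ε := by
  by_cases hx : x = 1
  · subst hx
    -- At `x = 1` the other three unimodular numbers sum to zero, so `u ≠ ±w`, and `x` can first be
    -- moved away from 1.
    have hs : y + u + w = 0 := by linear_combination h.sum_eq
    have h1 : u ≠ w := by
      rintro rfl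
      have : y = -(2 * u) := by linear_combination hs
      have h2 := h.snd
      rw [this, norm_neg, norm_two_mul h.trd] at h2
      norm_num at h2
    have h2 : u ≠ -w := by
      rintro rfl
      have : y = 0 := by linear_combination hs
      have h2 := h.snd
      rw [this, norm_zero] at h2
      norm_num at h2
    obtain ⟨δ, hδ, H⟩ := h.move h1 h2 (half_pos hε)
    obtain ⟨x', hx1, hx2, hx3⟩ := exists_unit_near h.fst (lt_min hδ (half_pos hε))
      (Set.toFinite {(1 : ℂ)})
    obtain ⟨u', w', h', hu, hw⟩ := H x' y hx1 h.snd (hx2.trans_le (min_le_left _ _))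
      (by simpa using hδ)
    obtain ⟨x₂, y₂, u₂, w₂, a, b, c, d, e, f⟩ := h'.exists_genericAt_of_ne_one hx3 (half_pos hε)
    have tri : ∀ {a b c : ℂ}, ‖a - b‖ < ε / 2 → ‖b - c‖ < ε / 2 → ‖a - c‖ < ε := by
      intro a b c h1 h2
      have := norm_sub_le_norm_sub_add_norm_sub a b c
      linarith
    exact ⟨x₂, y₂, u₂, w₂, a, b, tri c (hx2.trans_le (min_le_right _ _)),
      d.trans (half_lt_self hε), tri e hu, tri f hw⟩
  · exact h.exists_genericAt_of_ne_one hx hε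

end Density

/-! ### Density of the generic points and of defect at most two -/

section GenericDefect

/-- The unimodular quadruples of sum one. -/
def unitSums : Set (Fin 4 → ℂ) := {v | (∀ l, ‖v l‖ = 1) ∧ v 0 + v 1 + v 2 + v 3 = 1}

theorem subset_closure_inter {X : Type*} [TopologicalSpace X] {A U V : Set X} (hU : IsOpen U)
    (h1 : A ⊆ closure (A ∩ U)) (h2 : A ⊆ closure (A ∩ V)) : A ⊆ closure (A ∩ (U ∩ V)) := by
  intro x hx
  rw [mem_closure_iff]
  intro N hN hxN
  obtain ⟨y, hyN, hyA, hyU⟩ := mem_closure_iff.1 (h1 hx) N hN hxN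
  obtain ⟨z, ⟨hzN, hzU⟩, hzA, hzV⟩ := mem_closure_iff.1 (h2 hyA) (N ∩ U) (hN.inter hU) ⟨hyN, hyU⟩
  exact ⟨z, hzN, hzA, hzU, hzV⟩

/-- The quadruples that are generic at the coordinate `l`. -/
def genericSet (l : Fin 4) : Set (Fin 4 → ℂ) :=
  {v | v l ≠ 1 ∧ esymmTwo v ≠ 0 ∧ GenericCoord (v l) (esymmTwo v - v l * (1 - v l))}

theorem continuous_esymmTwo : Continuous esymmTwo := by
  unfold esymmTwo
  fun_prop

theorem isOpen_genericSet (l : Fin 4) : IsOpen (genericSet l) := by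
  have h := continuous_esymmTwo
  refine ((continuous_apply l).isOpen_preimage _ isOpen_ne).inter
    ((h.isOpen_preimage _ isOpen_ne).inter (IsOpen.inter ?_ ?_))
  · exact isOpen_ne.preimage (by fun_prop : Continuous fun v : Fin 4 → ℂ =>
      (v l * (1 - v l)) ^ 2 - v l * (1 - v l) * (esymmTwo v - v l * (1 - v l)) +
        (esymmTwo v - v l * (1 - v l)) ^ 2)
  · exact isOpen_ne.preimage (by fun_prop : Continuous fun v : Fin 4 → ℂ =>
      (esymmTwo v - v l * (1 - v l)) ^ 2 - (v l * (1 - v l)) ^ 2 +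
        3 * v l * (1 + v l) * (esymmTwo v - v l * (1 - v l)))

theorem unitSums_subset_closure_of_near (l : Fin 4)
    (h : ∀ v ∈ unitSums, ∀ ε > 0, ∃ v' ∈ unitSums, v' ∈ genericSet l ∧ ∀ i, ‖v' i - v i‖ < ε) :
    unitSums ⊆ closure (unitSums ∩ genericSet l) := by
  intro v hv
  rw [Metric.mem_closure_iff]
  intro ε hε
  obtain ⟨v', h1, h2, h3⟩ := h v hv ε hε
  refine ⟨v', ⟨h1, h2⟩, ?_⟩
  rw [dist_comm, dist_pi_lt_iff hε]
  intro i
  rw [dist_eq_norm]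
  exact h3 i

theorem GenericAt.mem_genericSet {v : Fin 4 → ℂ} {l : Fin 4} {x y u w : ℂ}
    (h : GenericAt x y u w) (hs : x + y + u + w = 1) (hl : v l = x)
    (he : esymmTwo v = x * (y + u + w) + (y * u + y * w + u * w)) : v ∈ genericSet l := by
  have h1 : esymmTwo v = x * (1 - x) + (y * u + y * w + u * w) := by
    rw [he]; linear_combination x * hs
  rw [genericSet, Set.mem_ofPred_eq, h1, hl, add_sub_cancel_left]
  exact h

theorem unitSums_subset_closure (l : Fin 4) : unitSums ⊆ closure (unitSums ∩ genericSet l) := by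
  refine unitSums_subset_closure_of_near l fun v hv ε hε => ?_
  obtain ⟨hv, hs⟩ := hv
  have mk : ∀ {a b c d : ℂ}, UnitSum a b c d → ![a, b, c, d] ∈ unitSums := by
    intro a b c d h
    refine ⟨fun i => ?_, h.sum_eq⟩
    fin_cases i
    exacts [h.fst, h.snd, h.trd, h.fth]
  have near : ∀ {a b c d : ℂ}, ‖a - v 0‖ < ε → ‖b - v 1‖ < ε → ‖c - v 2‖ < ε → ‖d - v 3‖ < ε →
      ∀ i, ‖![a, b, c, d] i - v i‖ < ε := by
    intro a b c d h0 h1 h2 h3 i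
    fin_cases i <;> assumption
  have es : ∀ {a b c d : ℂ}, esymmTwo ![a, b, c, d] =
      a * b + a * c + a * d + b * c + b * d + c * d := fun {_ _ _ _} => rfl
  fin_cases l
  · obtain ⟨x, y, u, w, h, hg, a, b, c, d⟩ := UnitSum.exists_genericAt
      ⟨hv 0, hv 1, hv 2, hv 3, hs⟩ hε
    exact ⟨![x, y, u, w], mk h, hg.mem_genericSet h.sum_eq rfl (by rw [es]; ring), near a b c d⟩
  · obtain ⟨x, y, u, w, h, hg, a, b, c, d⟩ := UnitSum.exists_genericAt
      ⟨hv 1, hv 0, hv 2, hv 3, by linear_combination hs⟩ hε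
    exact ⟨![y, x, u, w], mk ⟨h.snd, h.fst, h.trd, h.fth, by linear_combination h.sum_eq⟩,
      hg.mem_genericSet h.sum_eq rfl (by rw [es]; ring), near b a c d⟩
  · obtain ⟨x, y, u, w, h, hg, a, b, c, d⟩ := UnitSum.exists_genericAt
      ⟨hv 2, hv 0, hv 1, hv 3, by linear_combination hs⟩ hε
    exact ⟨![y, u, x, w], mk ⟨h.snd, h.trd, h.fst, h.fth, by linear_combination h.sum_eq⟩,
      hg.mem_genericSet h.sum_eq rfl (by rw [es]; ring), near b c a d⟩
  · obtain ⟨x, y, u, w, h, hg, a, b, c, d⟩ := UnitSum.exists_genericAt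
      ⟨hv 3, hv 0, hv 1, hv 2, by linear_combination hs⟩ hε
    exact ⟨![y, u, w, x], mk ⟨h.snd, h.trd, h.fth, h.fst, by linear_combination h.sum_eq⟩,
      hg.mem_genericSet h.sum_eq rfl (by rw [es]; ring), near b c d a⟩

theorem unitSums_subset_closure_genericPoint :
    unitSums ⊆ closure (unitSums ∩ {v | GenericPoint v}) := by
  have h := subset_closure_inter (isOpen_genericSet 0) (unitSums_subset_closure 0)
    (subset_closure_inter (isOpen_genericSet 1) (unitSums_subset_closure 1)
    (subset_closure_inter (isOpen_genericSet 2) (unitSums_subset_closure 2)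
      (unitSums_subset_closure 3)))
  refine h.trans (closure_mono (Set.inter_subset_inter_right _ ?_))
  rintro v ⟨h0, h1, h2, h3⟩
  refine ⟨h0.2.1, fun l => ?_⟩
  fin_cases l
  exacts [⟨h0.1, h0.2.2⟩, ⟨h1.1, h1.2.2⟩, ⟨h2.1, h2.2.2⟩, ⟨h3.1, h3.2.2⟩]

theorem bcMatrix_entry (i j : Fin 9) :
    (∀ v : Fin 4 → ℂ, bcMatrix (v 0) (v 1) (v 2) (v 3) i j = 1) ∨
      ∃ l, ∀ v : Fin 4 → ℂ, bcMatrix (v 0) (v 1) (v 2) (v 3) i j = v l := by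
  simp only [bcMatrix_apply]
  generalize planeEquiv i - planeEquiv j = g
  revert g
  refine forall_plane (Or.inl fun _ => rfl) ?_ ?_ ?_ ?_ ?_ ?_ ?_ ?_
  exacts [Or.inr ⟨0, fun _ => rfl⟩, Or.inr ⟨0, fun _ => rfl⟩, Or.inr ⟨1, fun _ => rfl⟩,
    Or.inr ⟨2, fun _ => rfl⟩, Or.inr ⟨3, fun _ => rfl⟩, Or.inr ⟨1, fun _ => rfl⟩,
    Or.inr ⟨3, fun _ => rfl⟩, Or.inr ⟨2, fun _ => rfl⟩]

theorem continuous_bcMatrix :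
    Continuous fun v : Fin 4 → ℂ => bcMatrix (v 0) (v 1) (v 2) (v 3) := by
  refine continuous_pi fun i => continuous_pi fun j => ?_
  rcases bcMatrix_entry i j with h | ⟨l, h⟩
  · simp only [h]; exact continuous_const
  · simp only [h]; exact continuous_apply l

theorem BC9_subset_closure : BC9 ⊆ closure {H ∈ BC9 | defect H ≤ 2} := by
  intro H hH
  obtain ⟨v, hv, hs, rfl⟩ := mem_BC9_iff.1 hH
  refine map_mem_closure (f := fun v : Fin 4 → ℂ => bcMatrix (v 0) (v 1) (v 2) (v 3))
    continuous_bcMatrix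
    (unitSums_subset_closure_genericPoint (⟨hv, hs⟩ : v ∈ unitSums)) ?_
  rintro v' ⟨⟨hv', hs'⟩, hg⟩
  exact ⟨mem_BC9_iff.2 ⟨v', hv', hs', rfl⟩, defect_bcMatrix_le hv' hs' hg⟩

end GenericDefect

/-! ### Charts and the two-parameter orbit -/

section Charts

/-- The sum of the last two coordinates in a chart of `BC9`. -/
def chartSum (t : Fin 2 → ℝ) : ℂ :=
  1 - Complex.exp (t 0 * Complex.I) - Complex.exp (t 1 * Complex.I)

/-- The domain of a chart of `BC9`. -/
def chartDomain : Set (Fin 2 → ℝ) := {t | chartSum t ∈ splitDomain}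

/-- Local parametrization of the unimodular quadruples with sum one. -/
def chartPoint (t : Fin 2 → ℝ) : Fin 4 → ℂ :=
  ![Complex.exp (t 0 * Complex.I), Complex.exp (t 1 * Complex.I), unitSplit (chartSum t),
    chartSum t - unitSplit (chartSum t)]

theorem contDiff_chartSum : ContDiff ℝ 1 chartSum := by
  unfold chartSum
  have h : ∀ k : Fin 2, ContDiff ℝ 1 fun t : Fin 2 → ℝ => (t k : ℂ) := fun k =>
    Complex.ofRealCLM.contDiff.comp (contDiff_apply ℝ ℝ k)
  exact (contDiff_const.sub ((h 0).mul contDiff_const).cexp).sub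
    ((h 1).mul contDiff_const).cexp

theorem isOpen_chartDomain : IsOpen chartDomain :=
  isOpen_splitDomain.preimage contDiff_chartSum.continuous

theorem contDiffOn_chartPoint (l : Fin 4) :
    ContDiffOn ℝ 1 (fun t => chartPoint t l) chartDomain := by
  have h : ∀ k : Fin 2, ContDiff ℝ 1 fun t : Fin 2 → ℝ => (t k : ℂ) := fun k =>
    Complex.ofRealCLM.contDiff.comp (contDiff_apply ℝ ℝ k)
  have hu : ContDiffOn ℝ 1 (fun t => unitSplit (chartSum t)) chartDomain :=
    contDiffOn_unitSplit.comp contDiff_chartSum.contDiffOn fun _ ht => ht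
  fin_cases l
  · exact ((h 0).mul contDiff_const).cexp.contDiffOn
  · exact ((h 1).mul contDiff_const).cexp.contDiffOn
  · exact hu
  · exact contDiff_chartSum.contDiffOn.sub hu

theorem chartPoint_mem {t : Fin 2 → ℝ} (ht : t ∈ chartDomain) : chartPoint t ∈ unitSums := by
  obtain ⟨h1, h2⟩ := norm_unitSplit ht
  refine ⟨fun l => ?_, ?_⟩
  · fin_cases l
    · exact Complex.norm_exp_ofReal_mul_I _
    · exact Complex.norm_exp_ofReal_mul_I _
    · exact h1
    · exact h2
  · change Complex.exp (t 0 * Complex.I) + Complex.exp (t 1 * Complex.I) + unitSplit (chartSum t) +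
      (chartSum t - unitSplit (chartSum t)) = 1
    rw [chartSum]
    ring

theorem exists_chartPoint {v : Fin 4 → ℂ} (hv : v ∈ unitSums) :
    ∃ t ∈ chartDomain, ∃ σ : Equiv.Perm (Fin 4), v = fun l => chartPoint t (σ l) := by
  obtain ⟨hn, hs⟩ := hv
  -- A non-parallel pair provides the two coordinates that the chart solves for.
  have hpair : ∃ a b, v a ≠ v b ∧ v a ≠ -v b := by
    by_contra! h
    have h' : ∀ a b, v a = v b ∨ v a = -v b := fun a b => or_iff_not_imp_left.2 (h a b)
    exact UnitSum.not_all_parallel ⟨hn 0, hn 1, hn 2, hn 3, hs⟩ (h' 0 3) (h' 1 3) (h' 2 3)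
  obtain ⟨a, b, hab, hab'⟩ := hpair
  wlog h : v a = unitSplit (v a + v b) generalizing a b
  · refine this b a hab.symm (fun h => hab' (by rw [h, neg_neg])) ?_
    rw [add_comm]
    exact (eq_unitSplit (hn a) (hn b) hab hab').resolve_left h
  have hperm : ∀ a b : Fin 4, a ≠ b → ∃ τ : Equiv.Perm (Fin 4), τ 2 = a ∧ τ 3 = b := by decide
  obtain ⟨τ, hτ2, hτ3⟩ := hperm a b fun h => hab (by rw [h])
  obtain ⟨α, hα⟩ := (Complex.norm_eq_one_iff _).1 (hn (τ 0))
  obtain ⟨β, hβ⟩ := (Complex.norm_eq_one_iff _).1 (hn (τ 1))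
  have hsum : v (τ 0) + v (τ 1) + v (τ 2) + v (τ 3) = 1 := by
    rw [← Fin.sum_univ_four fun l => v (τ l), Equiv.sum_comp τ v, Fin.sum_univ_four, hs]
  have hc : chartSum ![α, β] = v a + v b := by
    change 1 - Complex.exp (α * Complex.I) - Complex.exp (β * Complex.I) = _
    rw [hα, hβ, ← hτ2, ← hτ3]
    linear_combination -hsum
  refine ⟨![α, β], ?_, τ.symm, ?_⟩
  · change chartSum ![α, β] ∈ splitDomain
    rw [hc]
    exact add_mem_splitDomain (hn a) (hn b) hab hab'
  · have key : ∀ l, chartPoint ![α, β] l = v (τ l) := by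
      intro l
      fin_cases l
      · exact hα
      · exact hβ
      · change unitSplit (chartSum ![α, β]) = v (τ 2)
        rw [hc, ← h, hτ2]
      · change chartSum ![α, β] - unitSplit (chartSum ![α, β]) = v (τ 3)
        rw [hc, ← h, hτ3, add_sub_cancel_left]
    funext l
    rw [key, Equiv.apply_symm_apply]

/-- If row `i` and column `j` correspond to opposite points of a line, then `i`, `-j` and `i - j`
all lie on its punctured part modulo 3. The entry and the two phases divided out all equal `v l`, so
one conjugate is left. -/
theorem exists_dephase_bcMatrix (l : Fin 4) : ∃ i j, ∀ v : Fin 4 → ℂ, (∀ l, ‖v l‖ = 1) →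
    dephase (bcMatrix (v 0) (v 1) (v 2) (v 3)) i j = star (v l) := by
  have key : ∀ (v : Fin 4 → ℂ) (l : Fin 4) (i j : Fin 9), ‖v l‖ = 1 →
      bcMatrix (v 0) (v 1) (v 2) (v 3) 0 0 = 1 → bcMatrix (v 0) (v 1) (v 2) (v 3) i 0 = v l →
      bcMatrix (v 0) (v 1) (v 2) (v 3) 0 j = v l → bcMatrix (v 0) (v 1) (v 2) (v 3) i j = v l →
      dephase (bcMatrix (v 0) (v 1) (v 2) (v 3)) i j = star (v l) := by
    intro v l i j hz h1 h2 h3 h4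
    rw [dephase_apply, h1, h2, h3, h4]
    linear_combination star (v l) * star_mul_self_of_norm_one hz
  fin_cases l
  · exact ⟨1, 2, fun v hv => key v 0 _ _ (hv 0) rfl rfl rfl rfl⟩
  · exact ⟨3, 6, fun v hv => key v 1 _ _ (hv 1) rfl rfl rfl rfl⟩
  · exact ⟨4, 8, fun v hv => key v 2 _ _ (hv 2) rfl rfl rfl rfl⟩
  · exact ⟨5, 7, fun v hv => key v 3 _ _ (hv 3) rfl rfl rfl rfl⟩

theorem differentiable_exp_coord {p : ℕ} (k : Fin p) :
    Differentiable ℝ fun s : Fin p → ℝ => Complex.exp (s k * Complex.I) := by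
  intro t
  have h : DifferentiableAt ℝ (fun s : Fin p → ℝ => ((s k : ℝ) : ℂ)) t :=
    Complex.ofRealCLM.differentiableAt.comp t (differentiableAt_apply k t)
  exact (h.mul_const _).cexp

theorem eq_zero_of_fderiv_exp {p : ℕ} {t v : Fin p → ℝ} {k : Fin p}
    (h : fderiv ℝ (fun s : Fin p → ℝ => Complex.exp (s k * Complex.I)) t v = 0) : v k = 0 := by
  have h0 : HasLineDerivAt ℝ (fun s : Fin p → ℝ => Complex.exp (s k * Complex.I))
      (Complex.exp (t k * Complex.I) * (v k * Complex.I)) t v := by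
    have h1 : HasDerivAt (fun r : ℝ => (((t + r • v) k : ℝ) : ℂ)) (v k : ℂ) 0 := by
      have : HasDerivAt (fun r : ℝ => t k + r * v k) (v k) 0 := by
        simpa using ((hasDerivAt_id (0 : ℝ)).mul_const (v k)).const_add (t k)
      exact this.ofReal_comp
    have h2 := (h1.mul_const Complex.I).cexp
    simp only [zero_smul, add_zero] at h2
    exact h2
  have h3 := h0.unique ((differentiable_exp_coord k t).hasFDerivAt.hasLineDerivAt v)
  rw [h] at h3
  simpa using h3

theorem eq_zero_of_fderiv_star_exp {p : ℕ} {t v : Fin p → ℝ} {k : Fin p}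
    (h : fderiv ℝ (fun s : Fin p → ℝ => star (Complex.exp (s k * Complex.I))) t v = 0) :
    v k = 0 := by
  rw [fderiv_star] at h
  exact eq_zero_of_fderiv_exp (by simpa using h)

theorem isOrbit_BC9 : IsOrbit 2 BC9 := by
  -- One chart for each choice of which coordinates are free; the finite family is indexed by the
  -- naturals with repetitions.
  obtain ⟨e, he⟩ := exists_surjective_nat (Equiv.Perm (Fin 4))
  refine ⟨?_, fun H hH => isHadamard_of_mem_BC9 hH, fun _ => chartDomain, fun _ => chartDomain,
    fun k t => bcPerm (chartPoint t) (e k), fun k => ⟨isOpen_chartDomain, le_rfl, subset_closure,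
      ?_, ?_, ?_⟩, ?_⟩
  · refine ⟨_, 1, 1, omega, omega ^ 2, norm_one, norm_one, norm_omega, ?_, ?_, rfl⟩
    · rw [norm_pow, norm_omega, one_pow]
    · linear_combination omega_sum
  · refine continuous_bcMatrix.comp_continuousOn (f := fun t l => chartPoint t (e k l)) ?_
    exact continuousOn_pi.2 fun l => (contDiffOn_chartPoint _).continuousOn
  · intro i j
    rcases bcMatrix_entry i j with h | ⟨l, h⟩
    · exact contDiffOn_const.congr fun t _ => h fun l => chartPoint t (e k l)
    · exact (contDiffOn_chartPoint (e k l)).congr fun t _ => h fun l => chartPoint t (e k l)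
  · intro t ht v hv
    -- Some dephased entry is the conjugate of `exp (i t_m)`, so its derivative detects the `m`-th
    -- component of `v`.
    have key : ∀ m : Fin 2, ∀ l : Fin 4,
        (∀ s, chartPoint s l = Complex.exp (s m * Complex.I)) → v m = 0 := by
      intro m l hl
      obtain ⟨i, j, hij⟩ := exists_dephase_bcMatrix ((e k).symm l)
      refine eq_zero_of_fderiv_star_exp (t := t) ?_
      rw [← hv i j]
      congr 1
      refine Filter.EventuallyEq.fderiv_eq ?_
      filter_upwards [isOpen_chartDomain.mem_nhds ht] with s hs
      refine Eq.symm ((hij (fun l => chartPoint s (e k l))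
        (fun l => (chartPoint_mem hs).1 _)).trans ?_)
      rw [Equiv.apply_symm_apply, hl]
    funext m
    fin_cases m
    · exact key 0 0 fun _ => rfl
    · exact key 1 1 fun _ => rfl
  · ext H
    simp only [Set.mem_iUnion, Set.mem_image]
    constructor
    · intro hH
      obtain ⟨v, hv, hs, rfl⟩ := mem_BC9_iff.1 hH
      obtain ⟨t, ht, σ, rfl⟩ := exists_chartPoint ⟨hv, hs⟩
      obtain ⟨k, rfl⟩ := he σ
      exact ⟨k, t, ht, rfl⟩
    · rintro ⟨k, t, ht, rfl⟩
      exact bcPerm_mem_BC9 (chartPoint_mem ht).1 (chartPoint_mem ht).2 _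

theorem hasGenericDefect_BC9 : HasGenericDefect BC9 2 :=
  hasGenericDefect_of_dense isOrbit_BC9 BC9_subset_closure

end Charts

/-! ### The generic conditions at the two special matrices -/

section SpecialPoints

theorem esymmTwo_perm (v : Fin 4 → ℂ) (σ : Equiv.Perm (Fin 4)) :
    esymmTwo (fun l => v (σ l)) = esymmTwo v := by
  have key : ∀ v : Fin 4 → ℂ, esymmTwo v = ((∑ l, v l) ^ 2 - ∑ l, v l ^ 2) / 2 := by
    intro v
    rw [Fin.sum_univ_four, Fin.sum_univ_four, esymmTwo]
    ring
  rw [key, key, Equiv.sum_comp σ v, Equiv.sum_comp σ fun l => v l ^ 2]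

theorem GenericPoint.perm {v : Fin 4 → ℂ} (h : GenericPoint v) (σ : Equiv.Perm (Fin 4)) :
    GenericPoint fun l => v (σ l) := by
  rw [GenericPoint, esymmTwo_perm]
  exact ⟨h.1, fun l => h.2 (σ l)⟩

theorem defect_bcPerm {v : Fin 4 → ℂ} (hv : ∀ l, ‖v l‖ = 1) (hs : v 0 + v 1 + v 2 + v 3 = 1)
    (hg : GenericPoint v) (σ : Equiv.Perm (Fin 4)) : bcPerm v σ ∈ BC9 ∧
      ∀ H : Matrix (Fin 9) (Fin 9) ℂ, HEquiv H (bcPerm v σ) → defect H = 2 := by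
  have hmem := bcPerm_mem_BC9 hv hs σ
  refine ⟨hmem, fun H hH => ?_⟩
  have hs' : v (σ 0) + v (σ 1) + v (σ 2) + v (σ 3) = 1 := by
    rw [← Fin.sum_univ_four fun l => v (σ l), Equiv.sum_comp σ v, Fin.sum_univ_four, hs]
  rw [hH.defect_eq]
  exact le_antisymm (defect_bcMatrix_le (v := fun l => v (σ l)) (fun l => hv _) hs' (hg.perm σ))
    (isOrbit_BC9.le_defect hmem)

theorem isPrimitiveRoot_eps : IsPrimitiveRoot eps 10 := by
  have := Complex.isPrimitiveRoot_exp 10 (by norm_num)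
  rwa [Nat.cast_ofNat] at this

theorem norm_eps : ‖eps‖ = 1 := isPrimitiveRoot_eps.norm'_eq_one (by norm_num)

theorem eps_pow_five : eps ^ 5 = -1 := by
  have h : eps ^ 5 = Complex.exp (Real.pi * Complex.I) := by
    rw [eps, ← Complex.exp_nat_mul]
    congr 1
    push_cast
    ring
  rw [h, Complex.exp_pi_mul_I]

theorem eps_root : eps ^ 4 - eps ^ 3 + eps ^ 2 - eps + 1 = 0 := by
  have h1 : eps + 1 ≠ 0 := by
    intro h
    refine isPrimitiveRoot_eps.pow_ne_one_of_pos_of_lt (l := 2) (by norm_num) (by norm_num) ?_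
    linear_combination (eps - 1) * h
  refine (mul_eq_zero.1 ?_).resolve_left h1
  linear_combination eps_pow_five

theorem paramB_root (l : Fin 4) :
    paramB l ^ 4 - paramB l ^ 3 + paramB l ^ 2 - paramB l + 1 = 0 := by
  have h := eps_root
  fin_cases l
  · exact h
  · change (eps ^ 3) ^ 4 - (eps ^ 3) ^ 3 + (eps ^ 3) ^ 2 - eps ^ 3 + 1 = 0
    linear_combination (1 + eps - eps ^ 3 - eps ^ 4 - eps ^ 5 + eps ^ 7 + eps ^ 8) * h
  · change (eps ^ 7) ^ 4 - (eps ^ 7) ^ 3 + (eps ^ 7) ^ 2 - eps ^ 7 + 1 = 0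
    linear_combination (1 + eps - eps ^ 5 - eps ^ 6 - eps ^ 7 - eps ^ 8 + eps ^ 10 + eps ^ 11 +
      eps ^ 12 + eps ^ 13 + eps ^ 14 - eps ^ 16 - eps ^ 17 - eps ^ 18 - eps ^ 19 + eps ^ 23 +
      eps ^ 24) * h
  · change (eps ^ 9) ^ 4 - (eps ^ 9) ^ 3 + (eps ^ 9) ^ 2 - eps ^ 9 + 1 = 0
    linear_combination (1 + eps - eps ^ 5 - eps ^ 6 - eps ^ 9 + eps ^ 11 + eps ^ 14 - eps ^ 16 +
      eps ^ 18 + eps ^ 21 - eps ^ 23 - eps ^ 26 - eps ^ 27 + eps ^ 31 + eps ^ 32) * h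

/-- The parameters are the roots of the tenth cyclotomic polynomial, whose quadratic coefficient is
their second symmetric function 1. The multipliers in the combinations are Bézout certificates of
coprimality with it. -/
theorem genericPoint_paramB : GenericPoint paramB := by
  have he : esymmTwo paramB = 1 := by
    change eps * eps ^ 3 + eps * eps ^ 7 + eps * eps ^ 9 + eps ^ 3 * eps ^ 7 + eps ^ 3 * eps ^ 9 +
      eps ^ 7 * eps ^ 9 = 1
    linear_combination (-1 - eps + eps ^ 4 + 2 * eps ^ 5 + eps ^ 6 + eps ^ 8 + eps ^ 11 +
      eps ^ 12) * eps_root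
  rw [GenericPoint, he]
  refine ⟨one_ne_zero, fun l => ?_⟩
  have hz := paramB_root l
  generalize paramB l = z at hz
  refine ⟨fun h => ?_, fun h => ?_, fun h => ?_⟩
  · rw [h] at hz
    norm_num at hz
  · have : (1 : ℂ) = 0 := by
      linear_combination (-5 - 3 * z ^ 2 + 3 * z ^ 3) * h -
        (-6 + 9 * z - 18 * z ^ 2 + 9 * z ^ 3) * hz
    exact one_ne_zero this
  · have : (5 : ℂ) = 0 := by
      linear_combination (1 - 2 * z + z ^ 2 - z ^ 3) * h -
        (-4 - 5 * z - 3 * z ^ 3) * hz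
    norm_num at this

theorem norm_paramB (l : Fin 4) : ‖paramB l‖ = 1 := by
  fin_cases l
  · exact norm_eps
  all_goals exact (norm_pow _ _).trans (by rw [norm_eps, one_pow])

theorem sum_paramB : paramB 0 + paramB 1 + paramB 2 + paramB 3 = 1 := by
  change eps + eps ^ 3 + eps ^ 7 + eps ^ 9 = 1
  linear_combination (eps ^ 2 + eps ^ 4) * eps_pow_five - eps_root

theorem tau_star : tau + star tau = 1 / 2 ∧ tau * star tau = 1 := by
  have h15 : ((Real.sqrt 15 : ℝ) : ℂ) ^ 2 = 15 := by
    rw [← Complex.ofReal_pow, Real.sq_sqrt (by norm_num)]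
    norm_num
  have hst : star tau = (1 - Complex.I * (Real.sqrt 15 : ℂ)) / 4 := by
    rw [tau, Complex.star_def, map_div₀, map_add, map_mul, Complex.conj_I, Complex.conj_ofReal,
      map_one, map_ofNat]
    ring
  rw [hst, tau]
  constructor
  · ring
  · linear_combination (1 / 16 : ℂ) * h15 - (1 / 16 : ℂ) * (Real.sqrt 15 : ℂ) ^ 2 * Complex.I_sq

theorem norm_tau : ‖tau‖ = 1 := by
  have h := congrArg norm tau_star.2
  rw [norm_mul, norm_star, norm_one] at h
  nlinarith [norm_nonneg tau]

theorem norm_paramW (l : Fin 4) : ‖paramW l‖ = 1 := by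
  fin_cases l
  · exact norm_tau
  · exact norm_tau
  · exact (norm_star _).trans norm_tau
  · exact (norm_star _).trans norm_tau

theorem sum_paramW : paramW 0 + paramW 1 + paramW 2 + paramW 3 = 1 := by
  change tau + tau + star tau + star tau = 1
  linear_combination 2 * tau_star.1

theorem paramW_root (l : Fin 4) : 2 * paramW l ^ 2 - paramW l + 2 = 0 := by
  obtain ⟨h1, h2⟩ := tau_star
  have ht : 2 * tau ^ 2 - tau + 2 = 0 := by linear_combination 2 * tau * h1 - 2 * h2
  have hs : 2 * star tau ^ 2 - star tau + 2 = 0 := by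
    linear_combination 2 * star tau * h1 - 2 * h2
  fin_cases l
  exacts [ht, ht, hs, hs]

/-- Both parameter values are roots of `2 z ^ 2 - z + 2`. Division by it leaves a nonzero constant
for the first determinant, and for the second a linear remainder whose root 1/4 is not one of the
two. -/
theorem genericPoint_paramW : GenericPoint paramW := by
  have he : esymmTwo paramW = 9 / 4 := by
    change tau * tau + tau * star tau + tau * star tau + tau * star tau + tau * star tau +
      star tau * star tau = 9 / 4
    linear_combination (tau + star tau + 1 / 2) * tau_star.1 + 2 * tau_star.2
  rw [GenericPoint, he]
  refine ⟨by norm_num, fun l => ?_⟩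
  have hz := paramW_root l
  generalize paramW l = z at hz
  refine ⟨fun h => ?_, fun h => ?_, fun h => ?_⟩
  · rw [h] at hz
    norm_num at hz
  · have : (9 / 16 : ℂ) = 0 := by
      linear_combination h - (9 / 4 - 9 / 4 * z + 3 / 2 * z ^ 2) * hz
    norm_num at this
  · have h1 : z = 1 / 4 := by
      linear_combination (4 / 15 : ℂ) * (h - (3 + 3 / 4 * z + 3 / 2 * z ^ 2) * hz)
    rw [h1] at hz
    norm_num at hz

end SpecialPoints

/-! ### Linearised unitarity of the Fourier family -/

section Fourier

/-- The entries of `f9Matrix`, indexed by `(ℤ / 3)²`. -/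
def f9Fun (δ : ZMod 3 → ZMod 3 → ℂ) (k l : Plane) : ℂ :=
  cubeChar (k.1 * l.1) * (δ l.1 k.2 * cubeChar (k.2 * l.2))

/-- The diagonals of `f9Diag`, indexed by `ℤ / 3`. -/
def f9Delta (x₁ x₂ x₃ x₄ : ℂ) : ZMod 3 → ZMod 3 → ℂ := f9Diag x₁ x₂ x₃ x₄

theorem omega_pow_mul (a b : ZMod 3) :
    omega ^ (ZMod.val a * ZMod.val b) = cubeChar (a * b) := by
  have h := AddChar.zmodChar_apply' (C := ℂ) (n := 3) omega_pow_three (a.val * b.val)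
  rw [Nat.cast_mul, ZMod.natCast_zmod_val, ZMod.natCast_zmod_val] at h
  exact h.symm

theorem f9Matrix_apply (x₁ x₂ x₃ x₄ : ℂ) (r s : Fin 9) : f9Matrix x₁ x₂ x₃ x₄ r s =
    f9Fun (f9Delta x₁ x₂ x₃ x₄) (planeEquiv r) (planeEquiv s) := by
  rw [f9Fun, ← omega_pow_mul, ← omega_pow_mul]
  rfl

theorem norm_cubeChar (n : ZMod 3) : ‖cubeChar n‖ = 1 := by
  rw [cubeChar, AddChar.zmodChar_apply, norm_pow, norm_omega, one_pow]

theorem norm_f9Delta {x₁ x₂ x₃ x₄ : ℂ} (h₁ : ‖x₁‖ = 1) (h₂ : ‖x₂‖ = 1) (h₃ : ‖x₃‖ = 1)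
    (h₄ : ‖x₄‖ = 1) (b i : ZMod 3) : ‖f9Delta x₁ x₂ x₃ x₄ b i‖ = 1 := by
  fin_cases b <;> fin_cases i
  exacts [norm_one, norm_one, norm_one, norm_one, h₁, h₂, norm_one, h₃, h₄]

variable {δ : ZMod 3 → ZMod 3 → ℂ}

theorem star_f9Fun_mul (a i : ZMod 3) (k l : Plane) :
    star (f9Fun δ (a, i) k) * f9Fun δ (a, i) l =
      cubeChar (a * (l.1 - k.1)) * (star (δ k.1 i) * δ l.1 i * cubeChar (i * (l.2 - k.2))) := by
  simp only [f9Fun, star_mul', star_cubeChar]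
  rw [mul_sub, sub_eq_add_neg, AddChar.map_add_eq_mul, mul_sub, sub_eq_add_neg,
    AddChar.map_add_eq_mul]
  ring

theorem norm_f9Fun (hδ : ∀ b i, ‖δ b i‖ = 1) (k l : Plane) : ‖f9Fun δ k l‖ = 1 := by
  rw [f9Fun, norm_mul, norm_mul, norm_cubeChar, norm_cubeChar, hδ, mul_one, mul_one]

theorem sum_star_f9Fun_mul (hδ : ∀ b i, ‖δ b i‖ = 1) (k l : Plane) :
    ∑ m, star (f9Fun δ m k) * f9Fun δ m l = if k = l then 9 else 0 := by
  rw [Fintype.sum_prod_type]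
  simp only [star_f9Fun_mul, ← Finset.mul_sum]
  rw [← Finset.sum_mul, sum_cubeChar]
  by_cases h1 : k.1 = l.1
  · have h : ∀ i, star (δ k.1 i) * δ k.1 i = 1 := fun i => star_mul_self_of_norm_one (hδ _ _)
    simp only [← h1, h, one_mul]
    rw [sum_cubeChar]
    by_cases h2 : k.2 = l.2
    · rw [if_pos (sub_self _), if_pos (by rw [h2, sub_self]), if_pos (Prod.ext h1 h2)]
      norm_num
    · have h3 : k ≠ l := fun h => h2 (by rw [h])
      rw [if_neg (fun h => h2 (sub_eq_zero.1 h).symm), if_neg h3, mul_zero]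
  · rw [if_neg (fun h => h1 (sub_eq_zero.1 h).symm), if_neg (fun h => h1 (by rw [h])), zero_mul]

theorem eq_zero_of_sum_cubeChar {F : ZMod 3 → ℂ} (h : ∀ n, ∑ j, cubeChar (n * j) * F j = 0)
    (j : ZMod 3) : F j = 0 := by
  have h1 : ∑ n, cubeChar (-(n * j)) * ∑ i, cubeChar (n * i) * F i = 3 * F j := by
    simp only [Finset.mul_sum]
    rw [Finset.sum_comm]
    have e : ∀ i, ∑ n, cubeChar (-(n * j)) * (cubeChar (n * i) * F i) =
        (if i - j = 0 then 3 else 0) * F i := by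
      intro i
      rw [← sum_cubeChar, Finset.sum_mul]
      refine Finset.sum_congr rfl fun n _ => ?_
      rw [show n * (i - j) = -(n * j) + n * i by ring, AddChar.map_add_eq_mul]
      ring
    simp only [e, sub_eq_zero]
    simp
  simp only [h, mul_zero, Finset.sum_const_zero] at h1
  simpa using h1.symm

/-- `G` does not involve `j`, so orthogonality in `j` selects `i = q`; in the companion sum,
orthogonality in `j'` selects `i = p`. The difference of these row indices produces the shift in
`blockFourier_relation`. -/
theorem sum_sum_cubeChar_left (G : ZMod 3 → ZMod 3 → ℂ) (p q : ZMod 3) :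
    ∑ j, ∑ j', cubeChar (q * j) * cubeChar (-(p * j')) * ∑ i, cubeChar (i * (j' - j)) * G i j' =
      3 * ∑ j', cubeChar (-((p - q) * j')) * G q j' := by
  rw [Finset.sum_comm, Finset.mul_sum]
  refine Finset.sum_congr rfl fun j' _ => ?_
  simp only [Finset.mul_sum]
  rw [Finset.sum_comm]
  have e : ∀ i, ∑ j, cubeChar (q * j) * cubeChar (-(p * j')) * (cubeChar (i * (j' - j)) * G i j') =
      (if q - i = 0 then 3 else 0) * (cubeChar (-(p * j')) * cubeChar (i * j') * G i j') := by
    intro i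
    rw [← sum_cubeChar, Finset.sum_mul]
    refine Finset.sum_congr rfl fun j _ => ?_
    rw [show i * (j' - j) = i * j' + -(i * j) by ring, AddChar.map_add_eq_mul,
      show j * (q - i) = q * j + -(i * j) by ring, AddChar.map_add_eq_mul]
    ring
  simp only [e, sub_eq_zero]
  simp only [ite_mul, zero_mul, Finset.sum_ite_eq, Finset.mem_univ, if_true]
  rw [← AddChar.map_add_eq_mul, show -(p * j') + q * j' = -((p - q) * j') by ring]

theorem sum_sum_cubeChar_right (G : ZMod 3 → ZMod 3 → ℂ) (p q : ZMod 3) :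
    ∑ j, ∑ j', cubeChar (q * j) * cubeChar (-(p * j')) * ∑ i, cubeChar (i * (j' - j)) * G i j =
      3 * ∑ j, cubeChar (-((p - q) * j)) * G p j := by
  rw [Finset.mul_sum]
  refine Finset.sum_congr rfl fun j _ => ?_
  simp only [Finset.mul_sum]
  rw [Finset.sum_comm]
  have e : ∀ i, ∑ j', cubeChar (q * j) * cubeChar (-(p * j')) * (cubeChar (i * (j' - j)) * G i j) =
      (if p - i = 0 then 3 else 0) * (cubeChar (q * j) * cubeChar (-(i * j)) * G i j) := by
    intro i
    have hi : p - i = 0 ↔ i - p = 0 := by rw [sub_eq_zero, sub_eq_zero, eq_comm]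
    simp only [hi]
    rw [← sum_cubeChar, Finset.sum_mul]
    refine Finset.sum_congr rfl fun j' _ => ?_
    rw [show i * (j' - j) = i * j' + -(i * j) by ring, AddChar.map_add_eq_mul,
      show j' * (i - p) = i * j' + -(p * j') by ring, AddChar.map_add_eq_mul]
    ring
  simp only [e, sub_eq_zero]
  simp only [ite_mul, zero_mul, Finset.sum_ite_eq, Finset.mem_univ, if_true]
  rw [← AddChar.map_add_eq_mul, show q * j + -(p * j) = -((p - q) * j) by ring]

/-- Fourier coefficients of a phase matrix, in the block row index and the column index. -/
def blockFourier (R : Plane → Plane → ℝ) (c b q n : ZMod 3) : ℂ :=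
  ∑ j, cubeChar (-(n * j)) * ∑ a, cubeChar (a * c) * (R (a, q) (b, j) : ℂ)

theorem star_blockFourier (R : Plane → Plane → ℝ) (c b q n : ZMod 3) :
    star (blockFourier R c b q n) = blockFourier R (-c) b q (-n) := by
  simp only [blockFourier, star_sum, star_mul', star_cubeChar, mul_neg, neg_mul, neg_neg]
  simp

theorem eq_zero_of_blockFourier {R : Plane → Plane → ℝ}
    (h : ∀ c b q n, blockFourier R c b q n = 0) (k l : Plane) : R k l = 0 := by
  obtain ⟨a, q⟩ := k
  obtain ⟨b, j⟩ := l
  have h1 : ∀ c, ∑ a, cubeChar (a * c) * (R (a, q) (b, j) : ℂ) = 0 := by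
    intro c
    refine eq_zero_of_sum_cubeChar
      (F := fun j => ∑ a, cubeChar (a * c) * (R (a, q) (b, j) : ℂ)) (fun n => ?_) j
    have := h c b q (-n)
    simpa only [blockFourier, neg_mul, neg_neg] using this
  have h2 := eq_zero_of_sum_cubeChar (F := fun a => (R (a, q) (b, j) : ℂ))
    (fun c => by simpa only [mul_comm] using h1 c) a
  exact_mod_cast h2

/-- The first order unitarity condition of a Fourier matrix, in Fourier coefficients. -/
theorem blockFourier_relation {R : Plane → Plane → ℝ}
    (hR : ∀ i j, ∑ k, star (f9Fun δ k i) * f9Fun δ k j * ((R k j - R k i : ℝ) : ℂ) = 0)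
    (b b' q n : ZMod 3) :
    star (δ b q) * δ b' q * blockFourier R (b' - b) b' q n =
      star (δ b (q + n)) * δ b' (q + n) * blockFourier R (b' - b) b (q + n) n := by
  have hj : ∀ j j', ∑ i, cubeChar (i * (j' - j)) * (star (δ b i) * δ b' i *
        ∑ a, cubeChar (a * (b' - b)) * (R (a, i) (b', j') : ℂ)) =
      ∑ i, cubeChar (i * (j' - j)) * (star (δ b i) * δ b' i *
        ∑ a, cubeChar (a * (b' - b)) * (R (a, i) (b, j) : ℂ)) := by
    intro j j'
    rw [← sub_eq_zero, ← Finset.sum_sub_distrib, ← hR (b, j) (b', j'), Fintype.sum_prod_type,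
      Finset.sum_comm]
    refine Finset.sum_congr rfl fun i _ => ?_
    simp only [Finset.mul_sum, ← Finset.sum_sub_distrib]
    refine Finset.sum_congr rfl fun a _ => ?_
    rw [star_f9Fun_mul]
    push_cast
    ring
  -- The frequencies `q + n` and `q` leave the same character `n` on both sides, with rows `q` on
  -- the left and `q + n` on the right.
  have hl := sum_sum_cubeChar_left (fun i j' => star (δ b i) * δ b' i *
    ∑ a, cubeChar (a * (b' - b)) * (R (a, i) (b', j') : ℂ)) (q + n) q
  have hr := sum_sum_cubeChar_right (fun i j => star (δ b i) * δ b' i *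
    ∑ a, cubeChar (a * (b' - b)) * (R (a, i) (b, j) : ℂ)) (q + n) q
  simp only [hj] at hl
  have h := mul_left_cancel₀ (by norm_num : (3 : ℂ) ≠ 0) (hl.symm.trans hr)
  simp only [add_sub_cancel_left, mul_left_comm, ← Finset.mul_sum] at h
  simpa only [blockFourier] using h

/-- The condition that makes the Fourier matrix with diagonals `δ` have defect four. -/
def GenericDelta (δ : ZMod 3 → ZMod 3 → ℂ) : Prop :=
  ∀ q n, n ≠ 0 →
    (star (δ 2 q) * δ 0 q) * (star (δ 1 (q + n)) * δ 2 (q + n)) *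
      (star (δ 0 (q + n + n)) * δ 1 (q + n + n)) ≠
    (star (δ 2 (q + n)) * δ 0 (q + n)) * (star (δ 1 (q + n + n)) * δ 2 (q + n + n)) *
      (star (δ 0 q) * δ 1 q)

/-- For `c = 1` the relations pass through the column blocks cyclically and shift the row by `n`
each time. Three steps return to the start with a phase, which `GenericDelta` says is not 1 when `n
≠ 0`; for `n = 0` the coefficients vanish by `h0`. -/
theorem blockFourier_one_eq_zero {R : Plane → Plane → ℝ} (hδ : ∀ b i, ‖δ b i‖ = 1)
    (hg : GenericDelta δ)
    (hR : ∀ i j, ∑ k, star (f9Fun δ k i) * f9Fun δ k j * ((R k j - R k i : ℝ) : ℂ) = 0)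
    (h0 : ∀ q, blockFourier R 1 0 q 0 = 0) (b q n : ZMod 3) : blockFourier R 1 b q n = 0 := by
  have r0 : ∀ q n, star (δ 0 q) * δ 1 q * blockFourier R 1 1 q n =
      star (δ 0 (q + n)) * δ 1 (q + n) * blockFourier R 1 0 (q + n) n := fun q n =>
    blockFourier_relation hR 0 1 q n
  have r1 : ∀ q n, star (δ 1 q) * δ 2 q * blockFourier R 1 2 q n =
      star (δ 1 (q + n)) * δ 2 (q + n) * blockFourier R 1 1 (q + n) n := fun q n =>
    blockFourier_relation hR 1 2 q n
  have r2 : ∀ q n, star (δ 2 q) * δ 0 q * blockFourier R 1 0 q n =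
      star (δ 2 (q + n)) * δ 0 (q + n) * blockFourier R 1 2 (q + n) n := fun q n =>
    blockFourier_relation hR 2 0 q n
  have hne : ∀ b b' i, star (δ b i) * δ b' i ≠ 0 := fun b b' i => by
    rw [← norm_ne_zero_iff, norm_mul, norm_star, hδ, hδ]; norm_num
  have h3 : ∀ q n : ZMod 3, q + n + n + n = q := by decide
  have hz : ∀ q, blockFourier R 1 0 q n = 0 := by
    intro q
    by_cases hn : n = 0
    · rw [hn]; exact h0 q
    · have a := r2 q n
      have b := r1 (q + n) n
      have c := r0 (q + n + n) n
      rw [h3] at c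
      refine (mul_eq_zero.1 ?_).resolve_left (sub_ne_zero.2 (hg q n hn))
      linear_combination
        (star (δ 1 (q + n)) * δ 2 (q + n)) * (star (δ 0 (q + n + n)) * δ 1 (q + n + n)) * a +
        (star (δ 2 (q + n)) * δ 0 (q + n)) * (star (δ 0 (q + n + n)) * δ 1 (q + n + n)) * b +
        (star (δ 2 (q + n)) * δ 0 (q + n)) * (star (δ 1 (q + n + n)) * δ 2 (q + n + n)) * c
  have hz1 : ∀ q, blockFourier R 1 1 q n = 0 := by
    intro q
    have := r0 q n
    rw [hz, mul_zero] at this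
    exact (mul_eq_zero.1 this).resolve_left (hne _ _ _)
  have hz2 : ∀ q, blockFourier R 1 2 q n = 0 := by
    intro q
    have := r1 q n
    rw [hz1, mul_zero] at this
    exact (mul_eq_zero.1 this).resolve_left (hne _ _ _)
  fin_cases b
  exacts [hz q, hz1 q, hz2 q]

/-- For `c = 0` the phases cancel and the relation says that the coefficient does not change under
`q ↦ q + n`. For `n = 0` it is real, for `n = 1` independent of `q`, and `n = 2` is conjugate to `n
= 1`. -/
theorem blockFourier_zero_eq_zero {R : Plane → Plane → ℝ} (hδ : ∀ b i, ‖δ b i‖ = 1)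
    (hR : ∀ i j, ∑ k, star (f9Fun δ k i) * f9Fun δ k j * ((R k j - R k i : ℝ) : ℂ) = 0)
    {b : ZMod 3} (h0 : ∀ q, (blockFourier R 0 b q 0).re = 0) (h1 : blockFourier R 0 b 0 1 = 0)
    (q n : ZMod 3) : blockFourier R 0 b q n = 0 := by
  have r : ∀ q n, blockFourier R 0 b q n = blockFourier R 0 b (q + n) n := by
    intro q n
    have := blockFourier_relation hR b b q n
    rwa [sub_self, star_mul_self_of_norm_one (hδ _ _), star_mul_self_of_norm_one (hδ _ _),
      one_mul, one_mul] at this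
  have hz1 : ∀ q, blockFourier R 0 b q 1 = 0 := by
    intro q
    fin_cases q
    · exact h1
    · exact (r 0 1).symm.trans h1
    · exact (r 2 1).trans h1
  fin_cases n
  · have := star_blockFourier R 0 b q 0
    rw [neg_zero] at this
    exact Complex.ext (h0 q) (Complex.conj_eq_iff_im.1 this)
  · exact hz1 q
  · have := star_blockFourier R 0 b q 1
    rw [hz1, star_zero] at this
    exact this.symm

/-- The block Fourier coefficients of a phase matrix of order nine, as linear maps. -/
def f9Fourier (c b q n : ZMod 3) : Matrix (Fin 9) (Fin 9) ℝ →ₗ[ℝ] ℂ where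
  toFun R := blockFourier (fun k j => R (planeEquiv.symm k) (planeEquiv.symm j)) c b q n
  map_add' R S := by
    simp only [blockFourier, Matrix.add_apply, Complex.ofReal_add, mul_add,
      Finset.sum_add_distrib]
  map_smul' c R := by
    simp only [blockFourier, Matrix.smul_apply, smul_eq_mul, Complex.ofReal_mul,
      RingHom.id_apply, Complex.real_smul, Finset.mul_sum]
    exact Finset.sum_congr rfl fun i _ => Finset.sum_congr rfl fun a _ => by ring

/-- Coordinates on the defect space of a generic Fourier matrix. -/
def f9Coords : Matrix (Fin 9) (Fin 9) ℝ →ₗ[ℝ]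
    (ZMod 3 × ZMod 3 → ℝ) × (ZMod 3 → ℂ) × (ZMod 3 → ℂ) :=
  (LinearMap.pi fun i => Complex.reLm ∘ₗ f9Fourier 0 i.1 i.2 0).prod
    ((LinearMap.pi fun b => f9Fourier 0 b 0 1).prod (LinearMap.pi fun q => f9Fourier 1 0 q 0))

/-- `f9Coords` is injective on the solution space, with target of real dimension `9 + 6 + 6`; the
case `c = 2` is conjugate to `c = 1`. -/
theorem finrank_defectSpace_f9Matrix_le {x₁ x₂ x₃ x₄ : ℂ} (h₁ : ‖x₁‖ = 1) (h₂ : ‖x₂‖ = 1)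
    (h₃ : ‖x₃‖ = 1) (h₄ : ‖x₄‖ = 1) (hg : GenericDelta (f9Delta x₁ x₂ x₃ x₄)) :
    Module.finrank ℝ (defectSpace (f9Matrix x₁ x₂ x₃ x₄)) ≤ 21 := by
  have hδ := norm_f9Delta h₁ h₂ h₃ h₄
  have hinj : Function.Injective
      (f9Coords.domRestrict (defectSpace (f9Matrix x₁ x₂ x₃ x₄))) := by
    rw [← LinearMap.ker_eq_bot, LinearMap.ker_eq_bot']
    rintro ⟨R, hRmem⟩ h
    set R' : Plane → Plane → ℝ := fun k j => R (planeEquiv.symm k) (planeEquiv.symm j) with hR'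
    have hR : ∀ i j, ∑ k, star (f9Fun (f9Delta x₁ x₂ x₃ x₄) k i) *
        f9Fun (f9Delta x₁ x₂ x₃ x₄) k j * ((R' k j - R' k i : ℝ) : ℂ) = 0 := by
      intro i j
      rw [← hRmem (planeEquiv.symm i) (planeEquiv.symm j), ← Equiv.sum_comp planeEquiv]
      refine Finset.sum_congr rfl fun k _ => ?_
      simp only [f9Matrix_apply, Equiv.apply_symm_apply, hR', Equiv.symm_apply_apply]
    have a1 : ∀ b q, (blockFourier R' 0 b q 0).re = 0 := fun b q =>
      congrFun (congrArg Prod.fst h) (b, q)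
    have a2 : ∀ b, blockFourier R' 0 b 0 1 = 0 := fun b =>
      congrFun (congrArg (fun x => x.2.1) h) b
    have a3 : ∀ q, blockFourier R' 1 0 q 0 = 0 := fun q =>
      congrFun (congrArg (fun x => x.2.2) h) q
    have hall : ∀ c b q n, blockFourier R' c b q n = 0 := by
      intro c b q n
      fin_cases c
      · exact blockFourier_zero_eq_zero hδ hR (a1 b) (a2 b) q n
      · exact blockFourier_one_eq_zero hδ hg hR a3 b q n
      · have := star_blockFourier R' 1 b q (-n)
        rw [blockFourier_one_eq_zero hδ hg hR a3, star_zero, neg_neg] at this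
        exact this.symm
    have hzero := eq_zero_of_blockFourier hall
    refine Subtype.ext ?_
    ext k j
    have := hzero (planeEquiv k) (planeEquiv j)
    simpa [hR'] using this
  have := LinearMap.finrank_le_finrank_of_injective hinj
  simpa [Module.finrank_prod, Module.finrank_pi_fintype, Complex.finrank_real_complex] using this

theorem defect_f9Matrix_le {x₁ x₂ x₃ x₄ : ℂ} (h₁ : ‖x₁‖ = 1) (h₂ : ‖x₂‖ = 1)
    (h₃ : ‖x₃‖ = 1) (h₄ : ‖x₄‖ = 1) (hg : GenericDelta (f9Delta x₁ x₂ x₃ x₄)) :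
    defect (f9Matrix x₁ x₂ x₃ x₄) ≤ 4 := by
  have := finrank_defectSpace_f9Matrix_le h₁ h₂ h₃ h₄ hg
  rw [defect]
  omega

end Fourier

/-! ### The Fourier orbit and its generic defect -/

section FourierOrbit

theorem mem_F9_iff {H : Matrix (Fin 9) (Fin 9) ℂ} : H ∈ F9 ↔
    ∃ x : Fin 4 → ℂ, (∀ l, ‖x l‖ = 1) ∧ H = f9Matrix (x 0) (x 1) (x 2) (x 3) := by
  constructor
  · rintro ⟨x₁, x₂, x₃, x₄, h₁, h₂, h₃, h₄, rfl⟩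
    refine ⟨![x₁, x₂, x₃, x₄], fun l => ?_, rfl⟩
    fin_cases l
    exacts [h₁, h₂, h₃, h₄]
  · rintro ⟨x, hx, rfl⟩
    exact ⟨_, _, _, _, hx 0, hx 1, hx 2, hx 3, rfl⟩

theorem isHadamard_of_mem_F9 {H : Matrix (Fin 9) (Fin 9) ℂ} (hH : H ∈ F9) : IsHadamard H := by
  obtain ⟨x₁, x₂, x₃, x₄, h₁, h₂, h₃, h₄, rfl⟩ := hH
  have hδ := norm_f9Delta h₁ h₂ h₃ h₄
  rw [isHadamard_iff]
  refine ⟨fun i j => by rw [f9Matrix_apply]; exact norm_f9Fun hδ _ _, fun i j => ?_⟩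
  simp only [f9Matrix_apply]
  rw [Equiv.sum_comp planeEquiv (fun m => star (f9Fun (f9Delta x₁ x₂ x₃ x₄) m (planeEquiv i)) *
    f9Fun (f9Delta x₁ x₂ x₃ x₄) m (planeEquiv j)), sum_star_f9Fun_mul hδ]
  simp

theorem f9Diag_entry (b i : Fin 3) : (∀ x : Fin 4 → ℂ, f9Diag (x 0) (x 1) (x 2) (x 3) b i = 1) ∨
    ∃ l, ∀ x : Fin 4 → ℂ, f9Diag (x 0) (x 1) (x 2) (x 3) b i = x l := by
  fin_cases b <;> fin_cases i
  exacts [.inl fun _ => rfl, .inl fun _ => rfl, .inl fun _ => rfl, .inl fun _ => rfl,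
    .inr ⟨0, fun _ => rfl⟩, .inr ⟨1, fun _ => rfl⟩, .inl fun _ => rfl, .inr ⟨2, fun _ => rfl⟩,
    .inr ⟨3, fun _ => rfl⟩]

theorem contDiff_f9Matrix_entry {E : Type*} [NormedAddCommGroup E] [NormedSpace ℝ E]
    {x : E → Fin 4 → ℂ} (hx : ∀ l, ContDiff ℝ 1 fun t => x t l) (i j : Fin 9) :
    ContDiff ℝ 1 fun t => f9Matrix (x t 0) (x t 1) (x t 2) (x t 3) i j := by
  have h : ∀ b i, ContDiff ℝ 1 fun t => f9Diag (x t 0) (x t 1) (x t 2) (x t 3) b i := by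
    intro b i
    rcases f9Diag_entry b i with h | ⟨l, h⟩
    · simp only [h]
      exact contDiff_const
    · simp only [h]
      exact hx l
  exact contDiff_const.mul ((h _ _).mul contDiff_const)

theorem exists_dephase_f9Matrix (l : Fin 4) : ∃ i j, ∀ x : Fin 4 → ℂ,
    dephase (f9Matrix (x 0) (x 1) (x 2) (x 3)) i j = x l := by
  have hr : ∀ (x : Fin 4 → ℂ) (j : Fin 9), f9Matrix (x 0) (x 1) (x 2) (x 3) 0 j = 1 := by
    intro x j
    have h : ∀ b : Fin 3, f9Diag (x 0) (x 1) (x 2) (x 3) b 0 = 1 := by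
      intro b
      fin_cases b <;> rfl
    change omega ^ (0 * _) * (f9Diag (x 0) (x 1) (x 2) (x 3) _ 0 * omega ^ (0 * _)) = 1
    rw [h, zero_mul, zero_mul, pow_zero, one_mul, one_mul]
  have hc : ∀ (x : Fin 4 → ℂ) (i : Fin 9), f9Matrix (x 0) (x 1) (x 2) (x 3) i 0 = 1 := by
    intro x i
    have h : ∀ b : Fin 3, f9Diag (x 0) (x 1) (x 2) (x 3) 0 b = 1 := by
      intro b
      fin_cases b <;> rfl
    change omega ^ (_ * 0) * (f9Diag (x 0) (x 1) (x 2) (x 3) 0 _ * omega ^ (_ * 0)) = 1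
    rw [h, mul_zero, mul_zero, pow_zero, one_mul, one_mul]
  have key : ∀ (x : Fin 4 → ℂ) (l : Fin 4) (i j : Fin 9),
      f9Matrix (x 0) (x 1) (x 2) (x 3) i j = omega ^ 0 * (x l * omega ^ 0) →
      dephase (f9Matrix (x 0) (x 1) (x 2) (x 3)) i j = x l := by
    intro x l i j h
    rw [dephase_apply, hr, hr, hc, h, pow_zero, star_one]
    ring
  fin_cases l
  · exact ⟨1, 3, fun x => key x 0 _ _ rfl⟩
  · exact ⟨2, 3, fun x => key x 1 _ _ rfl⟩
  · exact ⟨1, 6, fun x => key x 2 _ _ rfl⟩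
  · exact ⟨2, 6, fun x => key x 3 _ _ rfl⟩

theorem isOrbit_F9 : IsOrbit 4 F9 := by
  have hexp : ∀ l : Fin 4, ContDiff ℝ 1 fun t : Fin 4 → ℝ => Complex.exp (t l * Complex.I) :=
    fun l => ((Complex.ofRealCLM.contDiff.comp (contDiff_apply ℝ ℝ l)).mul contDiff_const).cexp
  have hent := contDiff_f9Matrix_entry (x := fun (t : Fin 4 → ℝ) l => Complex.exp (t l * Complex.I))
    hexp
  refine ⟨⟨_, 1, 1, 1, 1, norm_one, norm_one, norm_one, norm_one, rfl⟩,
    fun H hH => isHadamard_of_mem_F9 hH, fun _ => Set.univ, fun _ => Set.univ,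
    fun _ t => f9Matrix (Complex.exp (t 0 * Complex.I)) (Complex.exp (t 1 * Complex.I))
      (Complex.exp (t 2 * Complex.I)) (Complex.exp (t 3 * Complex.I)),
    fun _ => ⟨isOpen_univ, le_rfl, subset_closure, ?_, ?_, ?_⟩, ?_⟩
  · exact (continuous_pi fun i => continuous_pi fun j => (hent i j).continuous).continuousOn
  · exact fun i j => (hent i j).contDiffOn
  · intro t _ v hv
    funext l
    obtain ⟨i, j, hij⟩ := exists_dephase_f9Matrix l
    refine eq_zero_of_fderiv_exp (t := t) ?_
    rw [← hv i j]
    congr 1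
    congr 1
    funext s
    exact (hij fun l => Complex.exp (s l * Complex.I)).symm
  · rw [Set.iUnion_const]
    ext H
    simp only [Set.image_univ, Set.mem_range]
    constructor
    · intro hH
      obtain ⟨x, hx, rfl⟩ := mem_F9_iff.1 hH
      choose t ht using fun l => (Complex.norm_eq_one_iff _).1 (hx l)
      exact ⟨t, by simp only [ht]⟩
    · rintro ⟨t, rfl⟩
      exact mem_F9_iff.2 ⟨fun l => Complex.exp (t l * Complex.I),
        fun l => Complex.norm_exp_ofReal_mul_I _, rfl⟩

/-- `GenericDelta` compares one product at `q` and at `q + n`; for each of `n = 1, 2` this asks that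
three numbers be pairwise distinct. -/
theorem genericDelta_of_ne {x₁ x₂ x₃ x₄ : ℂ}
    (a1 : star x₁ * x₂ * x₃ ≠ star x₂ * star x₃ * x₄) (a2 : star x₂ * star x₃ * x₄ ≠ x₁ * star x₄)
    (a3 : x₁ * star x₄ ≠ star x₁ * x₂ * x₃)
    (b1 : x₁ * star x₂ * x₄ ≠ star x₁ * x₃ * star x₄) (b2 : star x₁ * x₃ * star x₄ ≠ x₂ * star x₃)
    (b3 : x₂ * star x₃ ≠ x₁ * star x₂ * x₄) : GenericDelta (f9Delta x₁ x₂ x₃ x₄) := by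
  intro q n hn h
  fin_cases n
  · exact hn rfl
  · fin_cases q
    · replace h : star 1 * 1 * (star x₁ * x₃) * (star 1 * x₂) =
        star x₃ * 1 * (star x₂ * x₄) * (star 1 * 1) := h
      rw [star_one] at h
      exact a1 (by linear_combination h)
    · replace h : star x₃ * 1 * (star x₂ * x₄) * (star 1 * 1) =
        star x₄ * 1 * (star 1 * 1) * (star 1 * x₁) := h
      rw [star_one] at h
      exact a2 (by linear_combination h)
    · replace h : star x₄ * 1 * (star 1 * 1) * (star 1 * x₁) =
        star 1 * 1 * (star x₁ * x₃) * (star 1 * x₂) := h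
      rw [star_one] at h
      exact a3 (by linear_combination h)
  · fin_cases q
    · replace h : star 1 * 1 * (star x₂ * x₄) * (star 1 * x₁) =
        star x₄ * 1 * (star x₁ * x₃) * (star 1 * 1) := h
      rw [star_one] at h
      exact b1 (by linear_combination h)
    · replace h : star x₃ * 1 * (star 1 * 1) * (star 1 * x₂) =
        star 1 * 1 * (star x₂ * x₄) * (star 1 * x₁) := h
      rw [star_one] at h
      exact b3 (by linear_combination h)
    · replace h : star x₄ * 1 * (star x₁ * x₃) * (star 1 * 1) =
        star x₃ * 1 * (star 1 * 1) * (star 1 * x₂) := h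
      rw [star_one] at h
      exact b2 (by linear_combination h)

theorem finite_roots_of_ne_zero (a b : ℂ) {c : ℂ} (hc : c ≠ 0) :
    {z : ℂ | a * z ^ 2 + b * z + c = 0}.Finite := by
  have h : (Polynomial.C a * Polynomial.X ^ 2 + Polynomial.C b * Polynomial.X + Polynomial.C c :
      Polynomial ℂ) ≠ 0 := by
    intro h
    have := congrArg (Polynomial.eval 0) h
    simp [hc] at this
  refine (Polynomial.finite_setOfPred_isRoot h).subset fun z hz => ?_
  simpa [Polynomial.IsRoot] using hz

/-- Moving the first parameter alone suffices: after multiplication by `z` where `star z` occurs,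
each forbidden equality is a polynomial equation of degree at most two with nonzero constant term.
-/
theorem exists_finite_genericDelta {x₂ x₃ x₄ : ℂ} (h₂ : ‖x₂‖ = 1) (h₃ : ‖x₃‖ = 1)
    (h₄ : ‖x₄‖ = 1) : ∃ F : Set ℂ, F.Finite ∧
      ∀ z, ‖z‖ = 1 → z ∉ F → GenericDelta (f9Delta z x₂ x₃ x₄) := by
  have n₂ : x₂ ≠ 0 := norm_ne_zero_iff.1 (by rw [h₂]; exact one_ne_zero)
  have n₃ : x₃ ≠ 0 := norm_ne_zero_iff.1 (by rw [h₃]; exact one_ne_zero)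
  have n₄ : x₄ ≠ 0 := norm_ne_zero_iff.1 (by rw [h₄]; exact one_ne_zero)
  have s₂ := star_ne_zero.2 n₂
  have s₃ := star_ne_zero.2 n₃
  have s₄ := star_ne_zero.2 n₄
  refine ⟨_, (finite_roots_of_ne_zero 0 (-(star x₂ * star x₃ * x₄)) (mul_ne_zero n₂ n₃)).union <|
    (finite_roots_of_ne_zero 0 (-star x₄) (mul_ne_zero (mul_ne_zero s₂ s₃) n₄)).union <|
    (finite_roots_of_ne_zero (-star x₄) 0 (mul_ne_zero n₂ n₃)).union <|
    (finite_roots_of_ne_zero (-(star x₂ * x₄)) 0 (mul_ne_zero n₃ s₄)).union <|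
    (finite_roots_of_ne_zero 0 (-(x₂ * star x₃)) (mul_ne_zero n₃ s₄)).union <|
    (finite_roots_of_ne_zero 0 (-(star x₂ * x₄)) (mul_ne_zero n₂ s₃)), fun z hz hF => ?_⟩
  have hzz := star_mul_self_of_norm_one hz
  simp only [Set.mem_union, Set.mem_ofPred_eq, not_or] at hF
  obtain ⟨a1, a2, a3, b1, b2, b3⟩ := hF
  refine genericDelta_of_ne (fun h => a1 ?_) (fun h => a2 ?_) (fun h => a3 ?_) (fun h => b1 ?_)
    (fun h => b2 ?_) (fun h => b3 ?_)
  · linear_combination z * h - x₂ * x₃ * hzz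
  · linear_combination h
  · linear_combination -z * h - x₂ * x₃ * hzz
  · linear_combination -z * h - x₃ * star x₄ * hzz
  · linear_combination z * h - x₃ * star x₄ * hzz
  · linear_combination h

theorem F9_subset_closure : F9 ⊆ closure {H ∈ F9 | defect H ≤ (4 : ℕ)} := by
  rintro _ ⟨x₁, x₂, x₃, x₄, h₁, h₂, h₃, h₄, rfl⟩
  obtain ⟨F, hF, hg⟩ := exists_finite_genericDelta h₂ h₃ h₄
  have hc : Continuous fun z : ℂ => f9Matrix z x₂ x₃ x₄ := by
    have := contDiff_f9Matrix_entry (x := fun z : ℂ => ![z, x₂, x₃, x₄]) fun l => by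
      fin_cases l
      exacts [contDiff_id, contDiff_const, contDiff_const, contDiff_const]
    exact continuous_pi fun i => continuous_pi fun j => (this i j).continuous
  refine map_mem_closure (f := fun z => f9Matrix z x₂ x₃ x₄) (x := x₁) (s := {z | ‖z‖ = 1 ∧ z ∉ F})
    hc ?_ ?_
  · rw [Metric.mem_closure_iff]
    intro ε hε
    obtain ⟨z, a, b, c⟩ := exists_unit_near h₁ hε hF
    exact ⟨z, ⟨a, c⟩, by rwa [dist_comm, dist_eq_norm]⟩
  · rintro z ⟨a, c⟩
    exact ⟨⟨z, x₂, x₃, x₄, a, h₂, h₃, h₄, rfl⟩, defect_f9Matrix_le a h₂ h₃ h₄ (hg z a c)⟩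

theorem hasGenericDefect_F9 : HasGenericDefect F9 4 :=
  hasGenericDefect_of_dense isOrbit_F9 F9_subset_closure

end FourierOrbit

/-! ### Exponential sums that are locally constant -/

section ExponentialSums

variable {ι : Type*} [Fintype ι]

/-- The operator `-i d/ds` multiplies each term by its frequency and kills constants, so a
polynomial in it acts by evaluation at the frequencies and, on the constant, at 0. -/
theorem eventually_sum_eval_mul_exp {z : ι → ℂ} {r : ι → ℝ} {c : ℂ}
    (h : ∀ᶠ s : ℝ in 𝓝 0, ∑ l, z l * Complex.exp (s * r l * Complex.I) = c)
    (p : Polynomial ℂ) : ∀ᶠ s : ℝ in 𝓝 0,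
      ∑ l, z l * p.eval (r l : ℂ) * Complex.exp (s * r l * Complex.I) = p.eval 0 * c := by
  induction p using Polynomial.induction_on with
  | C a =>
    filter_upwards [h] with s hs
    rw [Polynomial.eval_C, ← hs, Finset.mul_sum]
    refine Finset.sum_congr rfl fun l _ => ?_
    rw [Polynomial.eval_C]
    ring
  | add p q hp hq =>
    filter_upwards [hp, hq] with s h1 h2
    rw [Polynomial.eval_add, add_mul, ← h1, ← h2, ← Finset.sum_add_distrib]
    refine Finset.sum_congr rfl fun l _ => ?_
    rw [Polynomial.eval_add]
    ring
  | monomial n a ih =>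
    filter_upwards [ih.eventually_nhds] with s hs
    have hd : HasDerivAt (fun s : ℝ => ∑ l, z l * (Polynomial.C a * Polynomial.X ^ n).eval (r l : ℂ) *
        Complex.exp (s * r l * Complex.I))
        (∑ l, z l * (Polynomial.C a * Polynomial.X ^ n).eval (r l : ℂ) *
          (Complex.exp (s * r l * Complex.I) * (r l * Complex.I))) s := by
      refine HasDerivAt.fun_sum fun l _ => HasDerivAt.const_mul _ (HasDerivAt.cexp ?_)
      have := ((hasDerivAt_id s).ofReal_comp.mul_const (r l : ℂ)).mul_const Complex.I
      simpa using this
    have h0 := (hd.congr_of_eventuallyEq (Filter.EventuallyEq.symm hs)).unique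
      (hasDerivAt_const s _)
    simp only [Polynomial.eval_mul, Polynomial.eval_C, Polynomial.eval_pow, Polynomial.eval_X,
      pow_succ, mul_zero, zero_mul] at h0 ⊢
    have h1 := congrArg (fun w => -Complex.I * w) h0
    simp only [Finset.mul_sum, mul_zero] at h1
    rw [← h1]
    refine Finset.sum_congr rfl fun l _ => ?_
    linear_combination (z l * (a * (r l : ℂ) ^ n) * Complex.exp (s * r l * Complex.I) * r l) *
      Complex.I_sq

/-- In an exponential sum that is locally constant the coefficients of each nonzero frequency
cancel. -/
theorem sum_filter_eq_zero_of_exp_sum {z : ι → ℂ} {r : ι → ℝ} {c : ℂ}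
    (h : ∀ᶠ s : ℝ in 𝓝 0, ∑ l, z l * Complex.exp (s * r l * Complex.I) = c) {m : ℝ} (hm : m ≠ 0) :
    ∑ l with r l = m, z l = 0 := by
  -- This polynomial vanishes at 0 and at all frequencies except `m`, so it isolates the terms of
  -- frequency `m`.
  set p : Polynomial ℂ := Polynomial.X *
    ∏ a ∈ (Finset.univ.image r).erase m, (Polynomial.X - Polynomial.C (a : ℂ)) with hp
  have h0 := (eventually_sum_eval_mul_exp h p).self_of_nhds
  have hp0 : p.eval 0 = 0 := by simp [hp]
  have hpm : p.eval (m : ℂ) ≠ 0 := by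
    rw [hp, Polynomial.eval_mul, Polynomial.eval_prod, Polynomial.eval_X]
    refine mul_ne_zero (by exact_mod_cast hm) (Finset.prod_ne_zero_iff.2 fun a ha => ?_)
    rw [Polynomial.eval_sub, Polynomial.eval_X, Polynomial.eval_C, sub_ne_zero]
    exact_mod_cast (Finset.ne_of_mem_erase ha).symm
  have hpl : ∀ l, r l ≠ m → p.eval (r l : ℂ) = 0 := by
    intro l hl
    rw [hp, Polynomial.eval_mul, Polynomial.eval_prod]
    refine mul_eq_zero_of_right _ (Finset.prod_eq_zero (i := r l) ?_ (by simp))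
    exact Finset.mem_erase.2 ⟨hl, Finset.mem_image_of_mem _ (Finset.mem_univ l)⟩
  simp only [Complex.ofReal_zero, zero_mul, Complex.exp_zero, mul_one, hp0] at h0
  rw [← Finset.sum_filter_add_sum_filter_not _ (fun l => r l = m),
    Finset.sum_eq_zero (s := Finset.univ.filter fun l => ¬ r l = m) fun l hl => by
      rw [hpl l (Finset.mem_filter.1 hl).2, mul_zero], add_zero,
    Finset.sum_congr rfl (g := fun l => z l * p.eval (m : ℂ)) fun l hl => by
      rw [(Finset.mem_filter.1 hl).2], ← Finset.sum_mul] at h0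
  exact (mul_eq_zero.1 h0).resolve_right hpm

theorem one_lt_card_of_sum_eq_zero {κ : Type*} {s : Finset κ} {z : κ → ℂ} (hz : ∀ l, z l ≠ 0)
    (hs : s.Nonempty) (h : ∑ l ∈ s, z l = 0) : 1 < s.card := by
  by_contra hc
  obtain ⟨a, rfl⟩ := Finset.card_eq_one.1 (le_antisymm (not_lt.1 hc) hs.card_pos)
  rw [Finset.sum_singleton] at h
  exact hz a h

/-- Four unimodular functions with sum one and linear phases depend on at most one parameter. -/
theorem not_forall_eventually_sum_eq_one {L : (Fin 2 → ℝ) →ₗ[ℝ] (Fin 4 → ℝ)}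
    (hL : Function.Injective L) {z : Fin 4 → ℂ} (hz : ∀ l, z l ≠ 0) :
    ¬ ∀ v, ∀ᶠ s : ℝ in 𝓝 0, ∑ l, z l * Complex.exp (s * L v l * Complex.I) = 1 := by
  intro h
  have hne : ∀ v, v ≠ 0 → ∃ l, L v l ≠ 0 := fun v hv => by
    by_contra! h0
    exact hv (hL (by rw [map_zero]; exact funext h0))
  obtain ⟨v₀, hv₀⟩ := exists_ne (0 : Fin 2 → ℝ)
  obtain ⟨a, ha⟩ := hne v₀ hv₀
  obtain ⟨w, hw, hw0⟩ : ∃ w, L w a = 0 ∧ w ≠ 0 := by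
    have hk : LinearMap.ker ((LinearMap.proj a : (Fin 4 → ℝ) →ₗ[ℝ] ℝ) ∘ₗ L) ≠ ⊥ :=
      LinearMap.ker_ne_bot_of_finrank_lt (by simp)
    obtain ⟨w, hw, hw0⟩ := Submodule.exists_mem_ne_zero_of_ne_bot hk
    exact ⟨w, hw, hw0⟩
  obtain ⟨b, hb⟩ := hne w hw0
  -- Moving along `w` keeps the frequency at `a` and adjusts the one at `b`; the factor 2 makes them
  -- distinct and both nonzero.
  set v := v₀ + ((2 * L v₀ a - L v₀ b) / L w b) • w with hv
  have hva : L v a = L v₀ a := by simp [hv, hw]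
  have hvb : L v b = 2 * L v₀ a := by
    simp only [hv, map_add, map_smul, Pi.add_apply, Pi.smul_apply, smul_eq_mul]
    field_simp
    ring
  have sa := sum_filter_eq_zero_of_exp_sum (h v) (m := L v₀ a) ha
  have sb := sum_filter_eq_zero_of_exp_sum (h v) (m := 2 * L v₀ a) (mul_ne_zero two_ne_zero ha)
  have ca := one_lt_card_of_sum_eq_zero hz ⟨a, by simp [hva]⟩ sa
  have cb := one_lt_card_of_sum_eq_zero hz ⟨b, by simp [hvb]⟩ sb
  have hd : Disjoint (Finset.univ.filter fun l => L v l = L v₀ a)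
      (Finset.univ.filter fun l => L v l = 2 * L v₀ a) := by
    rw [Finset.disjoint_filter]
    intro l _ h1 h2
    rw [h1] at h2
    exact ha (by linarith)
  -- Each frequency class has at least two members, since a single nonzero coefficient cannot
  -- cancel; two disjoint classes exhaust the four indices.
  have hu := Finset.eq_univ_of_card _ (le_antisymm (Finset.card_le_univ _) (by
    rw [Finset.card_union_of_disjoint hd, Fintype.card_fin]
    omega))
  have h1 := (h v).self_of_nhds
  simp only [Complex.ofReal_zero, zero_mul, Complex.exp_zero, mul_one] at h1
  rw [← hu, Finset.sum_union hd, sa, sb, add_zero] at h1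
  exact zero_ne_one h1

end ExponentialSums

/-! ### No equivalent orbit is affine -/

section Nonaffine

variable {N : ℕ}

/-- The products of four entries that are invariant under multiplication of rows and columns by
phases. -/
def phaseProduct (H : Matrix (Fin N) (Fin N) ℂ) (i j k l : Fin N) : ℂ :=
  H i j * H k l * star (H i l * H k j)

theorem phaseProduct_eq {H K : Matrix (Fin N) (Fin N) ℂ} {σ τ : Equiv.Perm (Fin N)}
    {a b : Fin N → ℂ} (ha : ∀ i, ‖a i‖ = 1) (hb : ∀ j, ‖b j‖ = 1)
    (h : ∀ i j, H i j = a i * K (σ i) (τ j) * b j) (i j k l : Fin N) :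
    phaseProduct H i j k l = phaseProduct K (σ i) (τ j) (σ k) (τ l) := by
  have e : ∀ z : ℂ, ‖z‖ = 1 → z * star z = 1 := fun z hz => by
    rw [mul_comm, star_mul_self_of_norm_one hz]
  simp only [phaseProduct, h, star_mul']
  calc _ = (a i * star (a i)) * (a k * star (a k)) * (b j * star (b j)) * (b l * star (b l)) *
        (K (σ i) (τ j) * K (σ k) (τ l) * (star (K (σ i) (τ l)) * star (K (σ k) (τ j)))) := by ring
    _ = _ := by rw [e _ (ha i), e _ (ha k), e _ (hb j), e _ (hb l)]; ring

theorem phaseProduct_zero [NeZero N] (H : Matrix (Fin N) (Fin N) ℂ) (i j : Fin N) :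
    phaseProduct H 0 0 i j = dephase H i j := by
  rw [phaseProduct, dephase_apply, star_mul']
  ring

/-- The products are blind to diagonal factors, so an equivalence is reduced to a pair of
permutations, of which there are finitely many. -/
theorem exists_phaseProduct_dephase_eq [NeZero N] {H K : Matrix (Fin N) (Fin N) ℂ}
    (hH : IsHadamard H) (h : HEquiv H K) : ∃ σ τ : Equiv.Perm (Fin N), ∀ i j k l,
      phaseProduct (dephase H) i j k l = phaseProduct K (σ i) (τ j) (σ k) (τ l) := by
  obtain ⟨σ, τ, d₁, d₂, h₁, h₂, h⟩ := h.exists_apply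
  have hn := (isHadamard_iff.1 hH).1
  refine ⟨σ, τ, phaseProduct_eq (a := fun i => star (H i 0) * d₁ i)
    (b := fun j => d₂ j * (H 0 0 * star (H 0 j))) (fun i => ?_) (fun j => ?_) fun i j => ?_⟩
  · rw [norm_mul, norm_star, hn, h₁, one_mul]
  · rw [norm_mul, norm_mul, norm_star, hn, hn, h₂, one_mul, one_mul]
  · rw [dephase_apply, h i j]
    ring

theorem IsHadamard.phaseProduct_dephase [NeZero N] {H : Matrix (Fin N) (Fin N) ℂ}
    (hH : IsHadamard H) (i j : Fin N) : phaseProduct (CHad.dephase H) 0 0 i j =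
      CHad.dephase H i j := by
  rw [phaseProduct, hH.dephase_zero_left, hH.dephase_zero_left, hH.dephase_zero_right, one_mul,
    one_mul, star_one, mul_one]

/-- The change of the phase of `phaseProduct` along a phase curve. -/
def productPhase (i j k l : Fin N) : Matrix (Fin N) (Fin N) ℝ →ₗ[ℝ] ℝ :=
  Matrix.entryLinearMap ℝ ℝ i j + Matrix.entryLinearMap ℝ ℝ k l -
    (Matrix.entryLinearMap ℝ ℝ i l + Matrix.entryLinearMap ℝ ℝ k j)

theorem phaseCurve_add_smul (H : Matrix (Fin N) (Fin N) ℂ) (R S : Matrix (Fin N) (Fin N) ℝ)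
    (s : ℝ) (i j : Fin N) : phaseCurve H (R + s • S) 1 i j =
      phaseCurve H R 1 i j * Complex.exp (s * S i j * Complex.I) := by
  simp only [phaseCurve, Matrix.of_apply, Matrix.add_apply, Matrix.smul_apply, smul_eq_mul]
  rw [mul_assoc (H i j), ← Complex.exp_add]
  congr 2
  push_cast
  ring

theorem star_exp_mul_I (x : ℝ) :
    star (Complex.exp (x * Complex.I)) = Complex.exp (-x * Complex.I) := by
  rw [Complex.star_def, ← Complex.exp_conj]
  simp

theorem star_phaseProduct_add_smul (H : Matrix (Fin N) (Fin N) ℂ) (R S : Matrix (Fin N) (Fin N) ℝ)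
    (s : ℝ) (i j k l : Fin N) : star (phaseProduct (phaseCurve H (R + s • S) 1) i j k l) =
      star (phaseProduct (phaseCurve H R 1) i j k l) *
        Complex.exp (s * (-productPhase i j k l S : ℝ) * Complex.I) := by
  have h : ∀ i j, star (Complex.exp (s * S i j * Complex.I)) =
      Complex.exp (-(s * S i j) * Complex.I) := fun i j => by
    have := star_exp_mul_I (s * S i j)
    push_cast at this
    exact this
  simp only [phaseProduct, phaseCurve_add_smul, star_mul', star_star]
  simp only [h]
  have e : Complex.exp (s * (-productPhase i j k l S : ℝ) * Complex.I) =
      Complex.exp (-(s * S i j) * Complex.I) * Complex.exp (-(s * S k l) * Complex.I) *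
        (Complex.exp (s * S i l * Complex.I) * Complex.exp (s * S k j * Complex.I)) := by
    rw [← Complex.exp_add, ← Complex.exp_add, ← Complex.exp_add]
    congr 1
    simp only [productPhase, LinearMap.sub_apply, LinearMap.add_apply,
      Matrix.entryLinearMap_apply]
    push_cast
    ring
  rw [e]
  ring

theorem continuous_phaseProduct (i j k l : Fin N) :
    Continuous fun H : Matrix (Fin N) (Fin N) ℂ => phaseProduct H i j k l := by
  unfold phaseProduct
  fun_prop

theorem continuous_phaseCurve {E : Type*} [TopologicalSpace E] {R : E → Matrix (Fin N) (Fin N) ℝ}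
    (H : Matrix (Fin N) (Fin N) ℂ) (hR : Continuous R) :
    Continuous fun t => phaseCurve H (R t) 1 := by
  refine continuous_pi fun i => continuous_pi fun j => ?_
  have : Continuous fun t => R t i j := hR.matrix_elem i j
  change Continuous fun t => H i j * Complex.exp (Complex.I * (1 : ℝ) * R t i j)
  fun_prop

/-- If the interior of a set is covered by finitely many closed sets, one of these has an interior
point. -/
theorem exists_interior_of_subset_iUnion {X ι : Type*} [TopologicalSpace X] [BaireSpace X]
    [Countable ι] {D : Set X} {W : ι → Set X} (hW : ∀ i, IsClosed (W i))
    (hD : (interior D).Nonempty) (h : interior D ⊆ ⋃ i, W i) :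
    ∃ i, (interior (W i) ∩ D).Nonempty := by
  have hd := dense_iUnion_interior_of_closed (f := fun i : Option ι => i.elim (interior D)ᶜ W)
    (fun i => by
      cases i
      exacts [isOpen_interior.isClosed_compl, hW _]) (by
    refine Set.eq_univ_of_forall fun x => Set.mem_iUnion.2 ?_
    by_cases hx : x ∈ interior D
    · obtain ⟨i, hi⟩ := Set.mem_iUnion.1 (h hx)
      exact ⟨some i, hi⟩
    · exact ⟨none, hx⟩)
  obtain ⟨x, hx, hx'⟩ := hd.inter_open_nonempty _ isOpen_interior hD
  obtain ⟨i, hi⟩ := Set.mem_iUnion.1 hx'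
  cases i with
  | none => exact absurd hx (interior_subset hi)
  | some i => exact ⟨i, x, hi, interior_subset hx⟩

theorem not_isAffineOrbit_of_orbitEquiv_BC9 {O : Set (Matrix (Fin 9) (Fin 9) ℂ)}
    (hO : OrbitEquiv BC9 O) : ¬ IsAffineOrbit 2 O := by
  rintro ⟨hOrb, H₀, R, D, hR, hne, hD, hO'⟩
  choose a b hab using exists_dephase_bcMatrix
  set M : (Fin 2 → ℝ) → Matrix (Fin 9) (Fin 9) ℂ := fun t => phaseCurve H₀ (R t) 1 with hM
  have hRc : Continuous R := R.continuous_of_finiteDimensional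
  have hMc : Continuous M := continuous_phaseCurve H₀ hRc
  -- Undoing the permutations `e` turns this product into the dephased entry that equals the
  -- conjugate of the `l`-th parameter, so `x` reads off candidate parameters.
  let x (e : Equiv.Perm (Fin 9) × Equiv.Perm (Fin 9)) (t : Fin 2 → ℝ) (l : Fin 4) : ℂ :=
    star (phaseProduct (M t) (e.1.symm 0) (e.2.symm 0) (e.1.symm (a l)) (e.2.symm (b l)))
  have hxc : ∀ e, Continuous (x e) := fun e => continuous_pi fun l =>
    ((continuous_phaseProduct _ _ _ _).comp hMc).star
  let K (v : Fin 4 → ℂ) : Matrix (Fin 9) (Fin 9) ℂ := bcMatrix (v 0) (v 1) (v 2) (v 3)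
  -- The parameter values for which `e` works: the candidates sum to one and reproduce all of `M t`.
  let W (e : Equiv.Perm (Fin 9) × Equiv.Perm (Fin 9)) : Set (Fin 2 → ℝ) :=
    {t | ∑ l, x e t l = 1} ∩
      ⋂ i, ⋂ j, {t | M t i j = phaseProduct (K (x e t)) (e.1 0) (e.2 0) (e.1 i) (e.2 j)}
  have hWc : ∀ e, IsClosed (W e) := by
    intro e
    refine IsClosed.inter (isClosed_eq (continuous_finsetSum _ fun l _ =>
      (continuous_apply l).comp (hxc e)) continuous_const) ?_
    exact isClosed_iInter fun i => isClosed_iInter fun j => isClosed_eq (hMc.matrix_elem i j)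
      ((continuous_phaseProduct _ _ _ _).comp (continuous_bcMatrix.comp (hxc e)))
  have hMO : ∀ t ∈ D, ∃ H ∈ O, dephase H = M t := fun t ht => by
    have : M t ∈ dephase '' O := by
      rw [hO']
      exact ⟨t, ht, rfl⟩
    exact this
  have hcov : interior D ⊆ ⋃ e, W e := by
    intro t ht
    obtain ⟨H, hH, hHM⟩ := hMO t (interior_subset ht)
    obtain ⟨K', hK', hHK⟩ := hO.2 H hH
    obtain ⟨v, hv, hs, rfl⟩ := mem_BC9_iff.1 hK'
    have hHad := hOrb.hadamard H hH
    obtain ⟨σ, τ, hp⟩ := exists_phaseProduct_dephase_eq hHad hHK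
    have hx : x (σ, τ) t = v := by
      funext l
      simp only [x, ← hHM, hp, Equiv.apply_symm_apply, phaseProduct_zero]
      rw [hab l v hv, star_star]
    refine Set.mem_iUnion.2 ⟨(σ, τ), ?_, Set.mem_iInter.2 fun i => Set.mem_iInter.2 fun j => ?_⟩
    · change ∑ l, x (σ, τ) t l = 1
      rw [hx, Fin.sum_univ_four, hs]
    · change M t i j = phaseProduct (K (x (σ, τ) t)) (σ 0) (τ 0) (σ i) (τ j)
      rw [hx, ← hHM, ← hHad.phaseProduct_dephase, hp]
  obtain ⟨e, t₀, ht₀, ht₀D⟩ := exists_interior_of_subset_iUnion hWc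
    (closure_nonempty_iff.1 (hne.mono hD)) hcov
  -- Nothing is assumed about the moduli of `H₀`; they are controlled through a point of `D`.
  have hM1 : ∀ i j, ‖M t₀ i j‖ = 1 := by
    obtain ⟨H, hH, hHM⟩ := hMO t₀ ht₀D
    rw [← hHM]
    exact (hOrb.hadamard H hH).dephase.1
  have hline : ∀ v : Fin 2 → ℝ, ∀ᶠ s : ℝ in 𝓝 0, t₀ + s • v ∈ W e := by
    intro v
    have hc : ContinuousAt (fun s : ℝ => t₀ + s • v) 0 := by fun_prop
    refine hc.eventually_mem ?_
    simpa using mem_interior_iff_mem_nhds.1 ht₀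
  let L : (Fin 2 → ℝ) →ₗ[ℝ] (Fin 4 → ℝ) := LinearMap.pi fun l =>
    (-productPhase (e.1.symm 0) (e.2.symm 0) (e.1.symm (a l)) (e.2.symm (b l))) ∘ₗ R
  have hxs : ∀ (s : ℝ) v l, x e (t₀ + s • v) l =
      x e t₀ l * Complex.exp (s * L v l * Complex.I) := by
    intro s v l
    simp only [x, hM, map_add, map_smul]
    exact star_phaseProduct_add_smul H₀ (R t₀) (R v) s _ _ _ _
  -- If the four parameters do not move along `v`, neither does `M`, which they determine on `W e`;
  -- hence `R v = 0`.
  have hLinj : Function.Injective L := by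
    rw [← LinearMap.ker_eq_bot, LinearMap.ker_eq_bot']
    intro v hv
    refine hR ?_
    rw [map_zero]
    ext i j
    by_contra hij
    have hx0 : ∀ s : ℝ, x e (t₀ + s • v) = x e t₀ := by
      intro s
      funext l
      rw [hxs, hv]
      simp
    have hMs : ∀ᶠ s : ℝ in 𝓝 0,
        ∑ _l : Unit, (1 : ℂ) * Complex.exp (s * (R v i j : ℝ) * Complex.I) = 1 := by
      filter_upwards [hline v] with s hs
      have h1 := Set.mem_iInter.1 (Set.mem_iInter.1 hs.2 i) j
      have h2 := Set.mem_iInter.1 (Set.mem_iInter.1 (interior_subset ht₀).2 i) j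
      simp only [Set.mem_ofPred_eq, hx0] at h1 h2
      rw [← h2] at h1
      simp only [hM, map_add, map_smul, phaseCurve_add_smul] at h1
      rw [Fintype.sum_unique, one_mul]
      refine mul_left_cancel₀ (a := M t₀ i j) ?_ (h1.trans (mul_one _).symm)
      exact norm_ne_zero_iff.1 (by rw [hM1]; exact one_ne_zero)
    have := sum_filter_eq_zero_of_exp_sum (r := fun _ => R v i j) hMs hij
    simp at this
  refine not_forall_eventually_sum_eq_one hLinj (z := x e t₀) (fun l => ?_) fun v => ?_
  · refine norm_ne_zero_iff.1 ?_
    simp only [x, phaseProduct, norm_star, norm_mul, hM1]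
    norm_num
  · filter_upwards [hline v] with s hs
    simp only [← hxs]
    exact hs.1

end Nonaffine

end CHad

end

theorem mainTheorem5 :
    -- `BC₉⁽²⁾` is a two-parameter orbit, not equivalent to an affine one
    CHad.IsOrbit 2 CHad.BC9 ∧
    (∀ O : Set (Matrix (Fin 9) (Fin 9) ℂ),
      CHad.OrbitEquiv CHad.BC9 O → ¬ CHad.IsAffineOrbit 2 O) ∧
    -- its generic defect is 2, attained for instance at `B₉⁽⁰⁾` and `W_{9A}`
    CHad.HasGenericDefect CHad.BC9 2 ∧
    (∀ σ : Equiv.Perm (Fin 4), CHad.bcPerm CHad.paramB σ ∈ CHad.BC9 ∧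
      ∀ H : Matrix (Fin 9) (Fin 9) ℂ,
        CHad.HEquiv H (CHad.bcPerm CHad.paramB σ) → CHad.defect H = 2) ∧
    (∀ σ : Equiv.Perm (Fin 4), CHad.bcPerm CHad.paramW σ ∈ CHad.BC9 ∧
      ∀ H : Matrix (Fin 9) (Fin 9) ℂ,
        CHad.HEquiv H (CHad.bcPerm CHad.paramW σ) → CHad.defect H = 2) ∧
    -- it is not contained in any orbit with more parameters
    (∀ p : ℕ, 2 < p → ∀ O : Set (Matrix (Fin 9) (Fin 9) ℂ),
      CHad.IsOrbit p O → ¬ CHad.IsSuborbit CHad.BC9 O) ∧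
    -- in particular not in the Fourier orbit, whose defect is at least, and generically, 4
    CHad.IsOrbit 4 CHad.F9 ∧
    CHad.HasGenericDefect CHad.F9 4 ∧
    (∀ H ∈ CHad.F9, 4 ≤ CHad.defect H) ∧
    ¬ CHad.IsSuborbit CHad.BC9 CHad.F9 := by
  have hmem := CHad.defect_bcPerm CHad.norm_paramB CHad.sum_paramB CHad.genericPoint_paramB
  -- One explicit element of defect at most two serves every `p > 2`.
  have hlt : ∀ p : ℕ, 2 < p → ∃ H ∈ CHad.BC9, CHad.defect H < p := by
    intro p hp
    refine ⟨_, (hmem 1).1, ?_⟩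
    have := CHad.defect_bcMatrix_le CHad.norm_paramB CHad.sum_paramB CHad.genericPoint_paramB
    exact lt_of_le_of_lt this (by exact_mod_cast hp)
  have hsub : ∀ p : ℕ, 2 < p → ∀ O : Set (Matrix (Fin 9) (Fin 9) ℂ),
      CHad.IsOrbit p O → ¬ CHad.IsSuborbit CHad.BC9 O := by
    intro p hp O hO
    obtain ⟨H, hH, hd⟩ := hlt p hp
    exact hO.not_isSuborbit hH hd
  exact ⟨CHad.isOrbit_BC9, fun O hO => CHad.not_isAffineOrbit_of_orbitEquiv_BC9 hO,
    CHad.hasGenericDefect_BC9, hmem,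
    CHad.defect_bcPerm CHad.norm_paramW CHad.sum_paramW CHad.genericPoint_paramW, hsub,
    CHad.isOrbit_F9, CHad.hasGenericDefect_F9, fun H hH => CHad.isOrbit_F9.le_defect hH,
    hsub 4 (by norm_num) _ CHad.isOrbit_F9⟩
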